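/- Consider the HL-model \[ \omega_t+u\,\omega_x=\theta_x,\qquad \theta_t+u\,\theta_x=0,\qquad u_x=H\omega , \] for real functions $\omega(x,t),\theta(x,t)$, where $H$ is the Hilbert transform and $u$ is given by \[ u(x,t)=\frac1\pi\int_0^L\omega(y,t)\log\Bigl|\sin\frac{\pi(x-y)}{L}\Bigr|\,dy \] in the periodic case (all functions $L$-periodic in $x$), and by \[ u(x,t)=\frac1\pi\int_{\mathbb R}\omega(y,t)\log|x-y|\,dy \] in the real-line case. A smooth global solution with initial data $(\omega_0,\theta_0)$ is a pair $(\omega,\theta)$ of functions that are $C^\infty$ on $\mathbb R\times[0,\infty)$ (up to $t=0$), satisfy the equations for all $t\ge 0$, and equal $(\omega_0,\theta_0)$ at $t=0$. In the periodic case $\omega$ and $\theta$ are also required to be $L$-periodic in $x$. In the real-line case $\omega$ is also required to decay as follows: for every $T>0$ there is a bounded function $g$ with $\int_{\mathbb R} g(y)\log(2+|y|)\,dy<\infty$ and $|\omega(x,t)|\le g(x)$ for all $x\in\mathbb R$, $t\in[0,T]$. **Theorem.** 1. (Periodic case.) For every $L>0$ there are $C^\infty$, $L$-periodic initial data $(\omega_0,\theta_0)$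 on $\mathbb R$ for which the HL-model has no smooth global solution. 2. (Real-line case.) There are $C^\infty$ initial data $(\omega_0,\theta_0)$ on $\mathbb R$, with $\omega_0$ and $\theta_{0x}$ compactly supported, for which the HL-model has no smooth global solution. -/

import Mathlib

namespace HLModel

noncomputable section

/-- The velocity on the circle of length `L` (functions on the circle are `L`-periodic functions
on `ℝ`) generated by the vorticity `w`:
`u(x) = (1/π) ∫₀ᴸ w(y) log |sin (π (x - y) / L)| dy`.
It satisfies `u_x = H w` for the periodic Hilbert transform
`H w(x) = (1/L) P.V. ∫₀ᴸ w(y) cot (π (x - y) / L) dy`. -/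
def circleVelocity (L : ℝ) (w : ℝ → ℝ) (x : ℝ) : ℝ :=
  (1 / Real.pi) * ∫ y in (0 : ℝ)..L, w y * Real.log |Real.sin (Real.pi / L * (x - y))|

/-- The velocity on the real line generated by the vorticity `w`:
`u(x) = (1/π) ∫ w(y) log |x - y| dy`.
It satisfies `u_x = H w` for the Hilbert transform
`H w(x) = (1/π) P.V. ∫ w(y) / (x - y) dy`. -/
def lineVelocity (w : ℝ → ℝ) (x : ℝ) : ℝ :=
  (1 / Real.pi) * ∫ y : ℝ, w y * Real.log |x - y|

/-- `(ω, θ)`, written `ω t x` and `θ t x`, is smooth on `[0, ∞) × ℝ`, takes the initial values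
`(ω₀, θ₀)`, and solves `ω_t + u ω_x = θ_x`, `θ_t + u θ_x = 0` for all `t ≥ 0`,
where `u(t, ·) = V (ω(t, ·))`. The time derivative is one-sided at `t = 0`. -/
structure IsSmoothGlobalSolution (V : (ℝ → ℝ) → ℝ → ℝ) (ω₀ θ₀ : ℝ → ℝ)
    (ω θ : ℝ → ℝ → ℝ) : Prop where
  smooth_vorticity : ContDiffOn ℝ (⊤ : ℕ∞) (Function.uncurry ω) (Set.Ici (0 : ℝ) ×ˢ Set.univ)
  smooth_temperature : ContDiffOn ℝ (⊤ : ℕ∞) (Function.uncurry θ) (Set.Ici (0 : ℝ) ×ˢ Set.univ)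
  initial_vorticity : ω 0 = ω₀
  initial_temperature : θ 0 = θ₀
  vorticity_eq : ∀ t : ℝ, 0 ≤ t → ∀ x : ℝ,
    HasDerivWithinAt (fun s => ω s x)
      (deriv (θ t) x - V (ω t) x * deriv (ω t) x) (Set.Ici 0) t
  temperature_eq : ∀ t : ℝ, 0 ≤ t → ∀ x : ℝ,
    HasDerivWithinAt (fun s => θ s x)
      (-(V (ω t) x * deriv (θ t) x)) (Set.Ici 0) t

/-- A smooth global solution on the circle of length `L`. -/
structure IsCircleSolution (L : ℝ) (ω₀ θ₀ : ℝ → ℝ) (ω θ : ℝ → ℝ → ℝ) : Prop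
    extends IsSmoothGlobalSolution (circleVelocity L) ω₀ θ₀ ω θ where
  periodic_vorticity : ∀ t : ℝ, 0 ≤ t → Function.Periodic (ω t) L
  periodic_temperature : ∀ t : ℝ, 0 ≤ t → Function.Periodic (θ t) L

/-- The decay at infinity that makes the integral defining `lineVelocity (ω t)` converge, locally
uniformly in time: on every bounded time interval `|ω|` is dominated by a bounded function of `x`
that is integrable against the logarithmic weight. No decay of `θ` is asked for. -/
def HasLogDecay (ω : ℝ → ℝ → ℝ) : Prop :=
  ∀ T : ℝ, 0 < T → ∃ g : ℝ → ℝ,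
    BddAbove (Set.range g) ∧
    MeasureTheory.Integrable (fun y => g y * Real.log (2 + |y|)) MeasureTheory.volume ∧
    ∀ t ∈ Set.Icc 0 T, ∀ x : ℝ, |ω t x| ≤ g x

/-- A smooth global solution on the real line. -/
structure IsLineSolution (ω₀ θ₀ : ℝ → ℝ) (ω θ : ℝ → ℝ → ℝ) : Prop
    extends IsSmoothGlobalSolution lineVelocity ω₀ θ₀ ω θ where
  decay : HasLogDecay ω

end

end HLModel

/-! The data are `ω₀ = 0` and an even `θ₀` that vanishes at `0` and increases on `[0, b]`, with `b =
L / 2` on the circle and `b = 1` on the line, where `θ₀ = 1` beyond `b`. While a solution is smooth,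
`ω` stays odd and `θ` even, `ω` and `θ_x` are nonnegative on `[0, b]`, and `ω` vanishes at `0` and
at `b`.

The weight `φ`, equal to `cot (π x / L)` or `1 / x`, is chosen so that for odd vorticity `-π u(x)`
is the integral of `ω(y) log |(φ x + φ y) / (φ x - φ y)|` over `(0, b)`. Put `I = ∫ θ φ` and `J = ∫
θ ω φ`. The elementary bound `F log ((F + G) / (F - G)) ≥ 2 G` for `F > G > 0` and an integration by
parts give `I' ≥ (2 / π) J` (`integral_temperature_deriv_potential_ge`). In `J' = -∫ u (θ ω)_x φ + ∫
θ θ_x φ` the first integral contributes a nonnegative amount: after an integration by parts it is a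
double integral against `ω(x) ω(y)` whose symmetrised kernel is nonnegative
(`integral_prod_deriv_potential_nonneg`). The second is at least a multiple of `I ^ 2` by
Cauchy-Schwarz (`sq_integral_le`). So `I` grows like a solution of `I'' = c I ^ 2` with `I(0) > 0`
and becomes infinite in finite time, while smoothness keeps it bounded (`false_of_blowupProfile`).

The solution to be excluded is arbitrary, so its symmetry has to be proved, by uniqueness
(`HasLocalKernel.unique`). In the equation for the difference of two temperature gradients the term
`u_x = H ω` is not bounded by the supremum of `ω`. It loses a logarithm of `ω_x`, which a refined
Gronwall argument absorbs (`eq_zero_of_log_gronwall`).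

On the line only logarithmic decay of `ω` is given. It yields velocities of logarithmic growth,
hence trajectories and a bounded support of `ω` and `θ_x` (`exists_support_bound`). Then uniqueness
applies, the signs follow, and the flow on `x ≥ 0` points to the origin, which confines the
vorticity to `[-1, 1]` (`vorticity_eq_zero`). -/

open Set Filter Topology MeasureTheory Function

/-! ### Calculus of functions smooth on `[0, ∞) × ℝ`, up to the initial time -/

namespace HLModel

/-- Smoothness of `f t x` on `[0, ∞) × ℝ`, up to `t = 0`. -/
abbrev SmoothST (f : ℝ → ℝ → ℝ) : Prop :=
  ContDiffOn ℝ (⊤ : ℕ∞) (uncurry f) (Ici (0 : ℝ) ×ˢ univ)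

theorem uniqueDiffOn_spaceTime : UniqueDiffOn ℝ (Ici (0 : ℝ) ×ˢ (univ : Set ℝ)) :=
  (uniqueDiffOn_Ici 0).prod uniqueDiffOn_univ

theorem SmoothST.hasFDerivWithinAt {f : ℝ → ℝ → ℝ} (hf : SmoothST f) {t : ℝ} (ht : 0 ≤ t) (x : ℝ) :
    HasFDerivWithinAt (uncurry f) (fderivWithin ℝ (uncurry f) (Ici (0 : ℝ) ×ˢ univ) (t, x))
      (Ici (0 : ℝ) ×ˢ univ) (t, x) :=
  ((hf.differentiableOn (by simp)) (t, x) ⟨ht, mem_univ _⟩).hasFDerivWithinAt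

theorem hasDerivAt_slice_of_hasFDerivWithinAt {E : Type*} [NormedAddCommGroup E] [NormedSpace ℝ E]
    {F : ℝ × ℝ → E} {D : ℝ × ℝ →L[ℝ] E} {t : ℝ} (ht : 0 ≤ t) {x : ℝ}
    (hF : HasFDerivWithinAt F D (Ici (0 : ℝ) ×ˢ univ) (t, x)) :
    HasDerivAt (fun y => F (t, y)) (D (0, 1)) x := by
  rw [← hasDerivWithinAt_univ]
  have h : HasDerivWithinAt (fun y : ℝ => (t, y)) ((0 : ℝ), (1 : ℝ)) univ x :=
    (hasDerivWithinAt_const x univ t).prodMk (hasDerivWithinAt_id x univ)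
  exact hF.comp_hasDerivWithinAt x h (fun y _ => ⟨ht, mem_univ _⟩)

theorem hasDerivWithinAt_curve_of_hasFDerivWithinAt {E : Type*} [NormedAddCommGroup E]
    [NormedSpace ℝ E] {F : ℝ × ℝ → E} {D : ℝ × ℝ →L[ℝ] E} {I : Set ℝ} (hI : I ⊆ Ici 0)
    {X : ℝ → ℝ} {v s : ℝ} (hF : HasFDerivWithinAt F D (Ici (0 : ℝ) ×ˢ univ) (s, X s))
    (hX : HasDerivWithinAt X v I s) :
    HasDerivWithinAt (fun r => F (r, X r)) (D (1, v)) I s := by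
  have h : HasDerivWithinAt (fun r : ℝ => (r, X r)) ((1 : ℝ), v) I s :=
    (hasDerivWithinAt_id s I).prodMk hX
  exact hF.comp_hasDerivWithinAt s h (fun y (hy : y ∈ I) => (⟨hI hy, mem_univ _⟩ : (y, X y) ∈ Ici (0 : ℝ) ×ˢ univ))

theorem SmoothST.fderivWithin_snd {f : ℝ → ℝ → ℝ} (hf : SmoothST f) {t : ℝ} (ht : 0 ≤ t) (x : ℝ) :
    fderivWithin ℝ (uncurry f) (Ici (0 : ℝ) ×ˢ univ) (t, x) (0, 1) = deriv (f t) x :=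
  (hasDerivAt_slice_of_hasFDerivWithinAt ht (hf.hasFDerivWithinAt ht x)).deriv.symm

theorem SmoothST.fderivWithin_fst {f : ℝ → ℝ → ℝ} (hf : SmoothST f) {t : ℝ} (ht : 0 ≤ t) (x : ℝ)
    {g : ℝ} (hg : HasDerivWithinAt (fun s => f s x) g (Ici 0) t) :
    fderivWithin ℝ (uncurry f) (Ici (0 : ℝ) ×ˢ univ) (t, x) (1, 0) = g :=
  (uniqueDiffOn_Ici (0 : ℝ) t ht).eq_deriv _
    (hasDerivWithinAt_curve_of_hasFDerivWithinAt (X := fun _ => x) subset_rfl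
      (hf.hasFDerivWithinAt ht x) (hasDerivWithinAt_const t _ x)) hg

theorem SmoothST.hasDerivAt {f : ℝ → ℝ → ℝ} (hf : SmoothST f) {t : ℝ} (ht : 0 ≤ t) (x : ℝ) :
    HasDerivAt (f t) (deriv (f t) x) x :=
  (hasDerivAt_slice_of_hasFDerivWithinAt ht
    (hf.hasFDerivWithinAt ht x)).differentiableAt.hasDerivAt

theorem SmoothST.continuous_slice {f : ℝ → ℝ → ℝ} (hf : SmoothST f) {t : ℝ} (ht : 0 ≤ t) :
    Continuous (f t) :=
  continuous_iff_continuousAt.2 fun x => (hf.hasDerivAt ht x).continuousAt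

theorem SmoothST.deriv {f : ℝ → ℝ → ℝ} (hf : SmoothST f) :
    SmoothST (fun t x => deriv (f t) x) := by
  have h : ContDiffOn ℝ (⊤ : ℕ∞) (fun p => fderivWithin ℝ (uncurry f) (Ici (0 : ℝ) ×ˢ univ) p
      ((0 : ℝ), (1 : ℝ))) (Ici (0 : ℝ) ×ˢ univ) :=
    (hf.fderivWithin uniqueDiffOn_spaceTime (by simp)).clm_apply contDiffOn_const
  refine h.congr ?_
  rintro ⟨t, x⟩ ⟨ht, -⟩
  exact (hf.fderivWithin_snd ht x).symm

theorem SmoothST.continuousOn_time {f : ℝ → ℝ → ℝ} (hf : SmoothST f) (x : ℝ) :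
    ContinuousOn (fun t => f t x) (Ici 0) :=
  hf.continuousOn.comp (f := fun t : ℝ => (t, x)) (by fun_prop) (fun _ ht => ⟨ht, mem_univ _⟩)

/-- The mixed derivative `∂ₜ ∂ₓ f = ∂ₓ ∂ₜ f`. -/
theorem SmoothST.hasDerivWithinAt_deriv {f g : ℝ → ℝ → ℝ} (hf : SmoothST f)
    (hg : ∀ t, 0 ≤ t → ∀ x, HasDerivWithinAt (fun s => f s x) (g t x) (Ici 0) t)
    {t : ℝ} (ht : 0 ≤ t) {x g' : ℝ} (hg' : HasDerivAt (g t) g' x) :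
    HasDerivWithinAt (fun s => _root_.deriv (f s) x) g' (Ici 0) t := by
  set S : Set (ℝ × ℝ) := Ici (0 : ℝ) ×ˢ univ with hS
  set A := fderivWithin ℝ (uncurry f) S with hA
  have hAd : HasFDerivWithinAt A (fderivWithin ℝ A S (t, x)) S (t, x) := by
    have h1 : ContDiffOn ℝ (⊤ : ℕ∞) A S := hf.fderivWithin uniqueDiffOn_spaceTime (by simp)
    exact ((h1.differentiableOn (by simp)) (t, x) ⟨ht, mem_univ _⟩).hasFDerivWithinAt
  -- Symmetry of the second derivative holds also at `t = 0`, because every point of the closed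
  -- half-plane is a limit of interior points.
  have hsymm : IsSymmSndFDerivWithinAt ℝ (uncurry f) S (t, x) := by
    refine (hf (t, x) ⟨ht, mem_univ _⟩).isSymmSndFDerivWithinAt
      (by simp only [minSmoothness_of_isRCLikeNormedField]; exact WithTop.coe_le_coe.2 (le_top : (2 : ℕ∞) ≤ ⊤))
      uniqueDiffOn_spaceTime ?_ ⟨ht, mem_univ _⟩
    rw [interior_prod_eq, interior_Ici, interior_univ, closure_prod_eq, closure_Ioi]
    exact ⟨ht, by simp⟩
  have h1 : HasDerivWithinAt (fun s => A (s, x) (0, 1))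
      (fderivWithin ℝ A S (t, x) (1, 0) (0, 1)) (Ici 0) t :=
    (hasDerivWithinAt_curve_of_hasFDerivWithinAt (X := fun _ => x) subset_rfl hAd
      (hasDerivWithinAt_const t _ x)).clm_apply (hasDerivWithinAt_const t _ _) |>.congr_deriv
      (by simp)
  have h2 : HasDerivAt (fun y => A (t, y) (1, 0))
      (fderivWithin ℝ A S (t, x) (0, 1) (1, 0)) x :=
    (hasDerivAt_slice_of_hasFDerivWithinAt ht hAd).clm_apply (hasDerivAt_const x _)
      |>.congr_deriv (by simp)
  have h3 : (fun y => A (t, y) (1, 0)) = g t :=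
    funext fun y => hf.fderivWithin_fst ht y (hg t ht y)
  rw [h3] at h2
  rw [hsymm.eq, h2.unique hg'] at h1
  exact h1.congr (fun s hs => (hf.fderivWithin_snd hs x).symm) (hf.fderivWithin_snd ht x).symm

/-- The derivative of a smooth function along a curve. -/
theorem SmoothST.hasDerivWithinAt_curve {f : ℝ → ℝ → ℝ} (hf : SmoothST f) {t s : ℝ}
    (hs : s ∈ Icc 0 t) {X : ℝ → ℝ} {v g : ℝ} (hX : HasDerivWithinAt X v (Icc 0 t) s)
    (hg : HasDerivWithinAt (fun r => f r (X s)) g (Ici 0) s) :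
    HasDerivWithinAt (fun r => f r (X r)) (g + v * _root_.deriv (f s) (X s)) (Icc 0 t) s := by
  have h := hasDerivWithinAt_curve_of_hasFDerivWithinAt (fun r hr => hr.1)
    (hf.hasFDerivWithinAt hs.1 (X s)) hX
  refine h.congr_deriv ?_
  have : ((1 : ℝ), v) = (1, 0) + v • ((0 : ℝ), (1 : ℝ)) := by simp
  rw [this, map_add, map_smul, hf.fderivWithin_fst hs.1 _ hg, hf.fderivWithin_snd hs.1]
  rfl

theorem SmoothST.bounded {f : ℝ → ℝ → ℝ} (hf : SmoothST f) (T R : ℝ) :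
    ∃ M, 0 ≤ M ∧ ∀ t ∈ Icc 0 T, ∀ x ∈ Icc (-R) R, |f t x| ≤ M := by
  have hK : IsCompact (Icc 0 T ×ˢ Icc (-R) R) := isCompact_Icc.prod isCompact_Icc
  obtain ⟨C, hC⟩ := hK.exists_bound_of_continuousOn
    (hf.continuousOn.mono (prod_mono (fun t ht => ht.1) (subset_univ _)))
  exact ⟨max C 0, le_max_right _ _, fun t ht x hx => (hC (t, x) ⟨ht, hx⟩).trans (le_max_left _ _)⟩

/-! ### Backward trajectories and scalar differential inequalities -/

/-- `X` is a trajectory of the velocity field `u` on the time interval `[0, t]`, ending at `x`. -/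
def IsTrajectory (u : ℝ → ℝ → ℝ) (t x : ℝ) (X : ℝ → ℝ) : Prop :=
  X t = x ∧ ∀ s ∈ Icc 0 t, HasDerivWithinAt X (u s (X s)) (Icc 0 t) s

/-- The logarithm is sublinear. In the Picard-Lindelöf theorem this gives a ball of radius `a` that
a velocity of logarithmic growth cannot leave in the given time. -/
theorem exists_radius_of_log_growth (c d : ℝ) :
    ∃ a : ℝ, 0 ≤ a ∧ c * (1 + Real.log (d + a)) ≤ a := by
  have h1 : Tendsto (fun a : ℝ => d + a) atTop atTop := tendsto_atTop_add_const_left _ _ tendsto_id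
  have h2 := (Real.isLittleO_log_id_atTop.comp_tendsto h1).def
    (show (0 : ℝ) < 1 / (2 * (|c| + 1)) by positivity)
  obtain ⟨a, ha, ha1, ha2⟩ := (h2.and ((eventually_ge_atTop (4 * |c| + |d|)).and
    (eventually_ge_atTop 0))).exists
  refine ⟨a, ha2, ?_⟩
  simp only [comp_apply, id, Real.norm_eq_abs] at ha
  have hc := abs_nonneg c
  have h3 : |c| * |Real.log (d + a)| ≤ (1 / 2) * |d + a| := by
    calc |c| * |Real.log (d + a)| ≤ (|c| + 1) * |Real.log (d + a)| := by
          gcongr; linarith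
      _ ≤ (|c| + 1) * (1 / (2 * (|c| + 1)) * |d + a|) := by gcongr
      _ = _ := by field_simp
  have h4 : c * Real.log (d + a) ≤ |c| * |Real.log (d + a)| := by
    rw [← abs_mul]; exact le_abs_self _
  have h5 : |d + a| ≤ |d| + a := by
    calc |d + a| ≤ |d| + |a| := abs_add_le _ _
      _ = _ := by rw [abs_of_nonneg ha2]
  have h6 := le_abs_self c
  nlinarith [abs_nonneg d]

/-- Picard-Lindelöf is applied with the right end `t` as the base time. The radius from
`exists_radius_of_log_growth` makes one application cover all of `[0, t]`, without a continuation
argument. -/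
theorem exists_trajectory {u : ℝ → ℝ → ℝ} {t : ℝ} (ht : 0 ≤ t) (x : ℝ)
    (hcont : ∀ y, ContinuousOn (fun s => u s y) (Icc 0 t))
    (hlip : ∀ R, ∃ K, ∀ s ∈ Icc 0 t, ∀ y ∈ Icc (-R) R, ∀ z ∈ Icc (-R) R,
      |u s y - u s z| ≤ K * |y - z|)
    (hgrow : ∃ C, ∀ s ∈ Icc 0 t, ∀ y, |u s y| ≤ C * (1 + Real.log (2 + |y|))) :
    ∃ X, IsTrajectory u t x X := by
  obtain ⟨C, hC⟩ := hgrow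
  have hC0 : 0 ≤ C := by
    have h1 := (abs_nonneg _).trans (hC 0 ⟨le_rfl, ht⟩ 0)
    have h2 : 0 < 1 + Real.log (2 + |(0 : ℝ)|) := by
      have := Real.log_nonneg (show (1 : ℝ) ≤ 2 + |(0 : ℝ)| by simp)
      linarith
    by_contra h
    push Not at h
    nlinarith
  obtain ⟨a, ha0, ha⟩ := exists_radius_of_log_growth (C * t) (2 + |x|)
  obtain ⟨K, hK⟩ := hlip (|x| + a)
  have hball : ∀ y ∈ Metric.closedBall x a, y ∈ Icc (-(|x| + a)) (|x| + a) := by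
    intro y hy
    rw [Metric.mem_closedBall, Real.dist_eq] at hy
    rw [mem_Icc, ← abs_le]
    calc |y| = |(y - x) + x| := by ring_nf
      _ ≤ |y - x| + |x| := abs_add_le _ _
      _ ≤ _ := by linarith
  have hlog0 : 0 ≤ Real.log (2 + |x| + a) := Real.log_nonneg (by linarith [abs_nonneg x])
  have hP : IsPicardLindelof u (tmin := 0) (tmax := t) ⟨t, ht, le_rfl⟩ x ⟨a, ha0⟩ 0
      ⟨C * (1 + Real.log (2 + |x| + a)), by positivity⟩ ⟨|K|, abs_nonneg K⟩ := by
    refine ⟨?_, ?_, ?_, ?_⟩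
    · intro s hs
      refine LipschitzOnWith.of_dist_le_mul fun y hy z hz => ?_
      rw [Real.dist_eq, Real.dist_eq]
      refine (hK s hs y (hball y hy) z (hball z hz)).trans ?_
      exact mul_le_mul_of_nonneg_right (le_abs_self K) (abs_nonneg _)
    · intro y _
      exact hcont y
    · intro s hs y hy
      refine (hC s hs y).trans ?_
      have h1 : |y| ≤ |x| + a := abs_le.2 (hball y hy)
      have h2 : Real.log (2 + |y|) ≤ Real.log (2 + |x| + a) :=
        Real.log_le_log (by positivity) (by linarith)
      exact mul_le_mul_of_nonneg_left (by linarith) hC0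
    · simp only [sub_self, sub_zero, NNReal.coe_zero]
      rw [max_eq_right ht]
      change C * (1 + Real.log (2 + |x| + a)) * t ≤ a
      linarith
  exact hP.exists_eq_forall_mem_Icc_hasDerivWithinAt₀

/-- `f ^ 2 * exp (2 K r)` is nondecreasing and `f ^ 2 * exp (-2 K r)` nonincreasing, so a zero
spreads to earlier and to later times. -/
theorem eq_zero_of_abs_deriv_le {f f' : ℝ → ℝ} {t K s₀ : ℝ}
    (hf : ∀ s ∈ Icc 0 t, HasDerivWithinAt f (f' s) (Icc 0 t) s)
    (hK : ∀ s ∈ Icc 0 t, |f' s| ≤ K * |f s|) (hs₀ : s₀ ∈ Icc 0 t) (h0 : f s₀ = 0) :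
    ∀ s ∈ Icc 0 t, f s = 0 := by
  have hprod : ∀ s ∈ Icc 0 t, |f s * f' s| ≤ K * (f s) ^ 2 := fun s hs => by
    rw [abs_mul, ← sq_abs (f s)]
    nlinarith [hK s hs, abs_nonneg (f s)]
  have hd : ∀ c : ℝ, ∀ s ∈ Icc 0 t, HasDerivWithinAt (fun r => f r ^ 2 * Real.exp (c * r))
      ((2 * (f s * f' s) + c * f s ^ 2) * Real.exp (c * s)) (Icc 0 t) s := by
    intro c s hs
    have h1 : HasDerivAt (fun r => Real.exp (c * r)) (Real.exp (c * s) * c) s := by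
      simpa using ((hasDerivAt_id s).const_mul c).exp
    refine (((hf s hs).pow 2).mul h1.hasDerivWithinAt).congr_deriv ?_
    simp only [Pi.pow_apply]
    push_cast
    ring
  have hcont : ∀ c : ℝ, ContinuousOn (fun r => f r ^ 2 * Real.exp (c * r)) (Icc 0 t) :=
    fun c s hs => (hd c s hs).continuousWithinAt
  have hmono : MonotoneOn (fun r => f r ^ 2 * Real.exp (2 * K * r)) (Icc 0 t) := by
    refine monotoneOn_of_hasDerivWithinAt_nonneg (convex_Icc 0 t) (hcont _)
      (fun s hs => (hd (2 * K) s (interior_subset hs)).mono interior_subset) ?_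
    intro s hs
    have := (abs_le.1 (hprod s (interior_subset hs))).1
    exact mul_nonneg (by linarith) (Real.exp_nonneg _)
  have hanti : AntitoneOn (fun r => f r ^ 2 * Real.exp (-(2 * K) * r)) (Icc 0 t) := by
    refine antitoneOn_of_hasDerivWithinAt_nonpos (convex_Icc 0 t) (hcont _)
      (fun s hs => (hd (-(2 * K)) s (interior_subset hs)).mono interior_subset) ?_
    intro s hs
    have := (abs_le.1 (hprod s (interior_subset hs))).2
    exact mul_nonpos_of_nonpos_of_nonneg (by linarith) (Real.exp_nonneg _)
  intro s hs
  have key : ∀ c : ℝ, f s ^ 2 * Real.exp (c * s) ≤ f s₀ ^ 2 * Real.exp (c * s₀) → f s = 0 := by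
    intro c h
    rw [h0] at h
    have h1 : f s ^ 2 ≤ 0 := by
      by_contra h2
      push Not at h2
      have := mul_pos h2 (Real.exp_pos (c * s))
      simp at h
      linarith
    exact pow_eq_zero_iff (two_ne_zero) |>.1 (le_antisymm h1 (sq_nonneg _))
  rcases le_total s s₀ with h | h
  · exact key _ (hmono hs hs₀ h)
  · exact key _ (hanti hs₀ hs h)

/-- A change of sign would produce a zero, and a zero makes `f` vanish identically. The sign may be
prescribed at any time `s₀`: at the final one for trajectories, at the initial one for transported
quantities. -/
theorem nonneg_of_abs_deriv_le {f f' : ℝ → ℝ} {t K s₀ : ℝ}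
    (hf : ∀ s ∈ Icc 0 t, HasDerivWithinAt f (f' s) (Icc 0 t) s)
    (hK : ∀ s ∈ Icc 0 t, |f' s| ≤ K * |f s|) (hs₀ : s₀ ∈ Icc 0 t) (h0 : 0 ≤ f s₀) :
    ∀ s ∈ Icc 0 t, 0 ≤ f s := by
  intro s hs
  by_contra hneg
  push Not at hneg
  have hcont : ContinuousOn f (Icc 0 t) := fun r hr => (hf r hr).continuousWithinAt
  have hsub : uIcc s s₀ ⊆ Icc 0 t := (convex_Icc 0 t).ordConnected.uIcc_subset hs hs₀
  obtain ⟨r, hr, hr0⟩ := intermediate_value_uIcc (hcont.mono hsub)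
    (show (0 : ℝ) ∈ uIcc (f s) (f s₀) from by rw [uIcc_of_le (by linarith)]; exact ⟨hneg.le, h0⟩)
  have := eq_zero_of_abs_deriv_le hf hK (hsub hr) hr0 s hs
  linarith

/-- Gronwall, to be read backwards: a trajectory that ends far out was already far out at time `s`.
-/
theorem one_add_abs_le_exp_of_linear_growth {X X' : ℝ → ℝ} {t C s : ℝ} (hC : 0 < C)
    (hX : ∀ r ∈ Icc 0 t, HasDerivWithinAt X (X' r) (Icc 0 t) r)
    (hX' : ∀ r ∈ Icc 0 t, |X' r| ≤ C * (1 + |X r|)) (hs : s ∈ Icc 0 t) :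
    1 + |X t| ≤ (1 + |X s|) * Real.exp (C * (t - s)) := by
  have hcont : ContinuousOn X (Icc s t) := fun r hr =>
    ((hX r ⟨hs.1.trans hr.1, hr.2⟩).mono (Icc_subset_Icc_left hs.1)).continuousWithinAt
  have h := norm_le_gronwallBound_of_norm_deriv_right_le (f := X) (f' := X') (δ := |X s|) (K := C)
    (ε := C) (a := s) (b := t) hcont (fun r hr => ?_) le_rfl (fun r hr => ?_) t ⟨hs.2, le_rfl⟩
  · rw [gronwallBound_of_K_ne_0 hC.ne', div_self hC.ne', Real.norm_eq_abs] at h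
    linarith
  · exact (hX r ⟨hs.1.trans hr.1, hr.2.le⟩).mono_of_mem_nhdsWithin
      (Filter.mem_of_superset (Icc_mem_nhdsGE_of_mem hr) (Icc_subset_Icc_left hs.1))
  · have := hX' r ⟨hs.1.trans hr.1, hr.2.le⟩
    rw [Real.norm_eq_abs, Real.norm_eq_abs]
    linarith

theorem eq_of_hasDerivWithinAt_zero {f : ℝ → ℝ} {t : ℝ} (ht : 0 ≤ t)
    (hf : ∀ s ∈ Icc 0 t, HasDerivWithinAt f 0 (Icc 0 t) s) : f t = f 0 := by
  have h := norm_image_sub_le_of_norm_deriv_le_segment' (C := 0) hf (fun s _ => by simp) t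
    ⟨ht, le_rfl⟩
  simpa [sub_eq_zero] using h

theorem le_of_hasDerivWithinAt_nonneg {f f' : ℝ → ℝ} {t : ℝ} (ht : 0 ≤ t)
    (hf : ∀ s ∈ Icc 0 t, HasDerivWithinAt f (f' s) (Icc 0 t) s)
    (hf' : ∀ s ∈ Icc 0 t, 0 ≤ f' s) {s : ℝ} (hs : s ∈ Icc 0 t) : f 0 ≤ f s ∧ f s ≤ f t := by
  have hmono : MonotoneOn f (Icc 0 t) :=
    monotoneOn_of_hasDerivWithinAt_nonneg (convex_Icc 0 t)
      (fun s hs => (hf s hs).continuousWithinAt)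
      (fun s hs => (hf s (interior_subset hs)).mono interior_subset)
      (fun s hs => hf' s (interior_subset hs))
  exact ⟨hmono ⟨le_rfl, ht⟩ hs hs.1, hmono hs ⟨ht, le_rfl⟩ hs.2⟩

/-! ### Convolution with kernels of logarithmic singularity -/

/-- A kernel on `(0, a]` with a singularity of logarithmic type at `0`. -/
structure LogKernel (a C : ℝ) (k k' : ℝ → ℝ) : Prop where
  pos : 0 < a
  nonneg : 0 ≤ C
  bound : ∀ z ∈ Ioc 0 a, |k z| ≤ C * (1 + Real.log (a / z))
  hasDerivAt : ∀ z ∈ Ioc 0 a, HasDerivAt k (k' z) z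
  bound_deriv : ∀ z ∈ Ioc 0 a, |k' z| ≤ C / z
  continuousOn_deriv : ContinuousOn k' (Ioc 0 a)

/-- Convolution over `[-a, a]` with the even extension of the kernel `k`. -/
noncomputable def evenConv (a : ℝ) (k w : ℝ → ℝ) (x : ℝ) : ℝ :=
  ∫ z in (0 : ℝ)..a, (w (x - z) + w (x + z)) * k z

/-- The integrable power `z ^ (-1/2)` stands in for the logarithm: its integral over `(0, δ)` is
explicit and carries the small factor `√δ`. -/
theorem one_add_log_le_rpow {a z : ℝ} (ha : 0 < a) (hz : 0 < z) :
    1 + Real.log (a / z) ≤ 2 * Real.sqrt a * z ^ (-(1 / 2) : ℝ) := by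
  have h1 : 0 < a / z := by positivity
  have h2 : Real.log (a / z) = 2 * Real.log (Real.sqrt (a / z)) := by
    rw [Real.log_sqrt h1.le]; ring
  have h3 := Real.log_le_sub_one_of_pos (Real.sqrt_pos.2 h1)
  have h4 : Real.sqrt (a / z) = Real.sqrt a * z ^ (-(1 / 2) : ℝ) := by
    rw [Real.sqrt_div' _ hz.le, Real.rpow_neg hz.le, Real.sqrt_eq_rpow z, div_eq_mul_inv]
  linarith

theorem integral_rpow_neg_half {δ : ℝ} :
    ∫ z in (0 : ℝ)..δ, z ^ (-(1 / 2) : ℝ) = 2 * Real.sqrt δ := by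
  rw [integral_rpow (by norm_num)]
  norm_num [Real.sqrt_eq_rpow]
  ring

theorem intervalIntegrable_rpow_neg_half (a b : ℝ) :
    IntervalIntegrable (fun z : ℝ => z ^ (-(1 / 2) : ℝ)) volume a b :=
  intervalIntegral.intervalIntegrable_rpow' (by norm_num)

namespace LogKernel

variable {a C : ℝ} {k k' : ℝ → ℝ}

theorem abs_le_rpow (hk : LogKernel a C k k') {z : ℝ} (hz : z ∈ Ioc 0 a) :
    |k z| ≤ 2 * C * Real.sqrt a * z ^ (-(1 / 2) : ℝ) := by
  refine (hk.bound z hz).trans ?_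
  have := mul_le_mul_of_nonneg_left (one_add_log_le_rpow hk.pos hz.1) hk.nonneg
  linarith

theorem continuousOn (hk : LogKernel a C k k') : ContinuousOn k (Ioc 0 a) := fun z hz =>
  (hk.hasDerivAt z hz).continuousAt.continuousWithinAt

theorem aestronglyMeasurable (hk : LogKernel a C k k') :
    AEStronglyMeasurable k (volume.restrict (uIoc 0 a)) := by
  rw [uIoc_of_le hk.pos.le]
  exact hk.continuousOn.aestronglyMeasurable measurableSet_Ioc

theorem intervalIntegrable (hk : LogKernel a C k k') : IntervalIntegrable k volume 0 a := by
  refine ((intervalIntegrable_rpow_neg_half 0 a).const_mul (2 * C * Real.sqrt a)).mono_fun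
    hk.aestronglyMeasurable ?_
  refine (ae_restrict_iff' measurableSet_uIoc).2 (Eventually.of_forall fun z hz => ?_)
  rw [uIoc_of_le hk.pos.le] at hz
  exact (hk.abs_le_rpow hz).trans (le_abs_self _)

theorem integrable_mul (hk : LogKernel a C k k') {g : ℝ → ℝ} (hg : Continuous g) :
    IntervalIntegrable (fun z => g z * k z) volume 0 a :=
  hk.intervalIntegrable.continuousOn_mul hg.continuousOn

theorem abs_integral_le (hk : LogKernel a C k k') {g : ℝ → ℝ} {A δ : ℝ}
    (hδ : δ ∈ Icc 0 a) (hgA : ∀ z ∈ Ioc 0 δ, |g z| ≤ A) :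
    |∫ z in (0 : ℝ)..δ, g z * k z| ≤ 4 * C * A * Real.sqrt a * Real.sqrt δ := by
  have h := intervalIntegral.norm_integral_le_of_norm_le (μ := volume) (a := 0) (b := δ)
    (f := fun z => g z * k z) (g := fun z => A * (2 * C * Real.sqrt a) * z ^ (-(1 / 2) : ℝ)) hδ.1
    (Eventually.of_forall fun z hz => ?_)
    ((intervalIntegrable_rpow_neg_half 0 δ).const_mul _)
  · rw [intervalIntegral.integral_const_mul, integral_rpow_neg_half] at h
    refine h.trans (le_of_eq (by ring))
  · rw [Real.norm_eq_abs, abs_mul]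
    have h1 := hgA z hz
    have h2 := hk.abs_le_rpow ⟨hz.1, hz.2.trans hδ.2⟩
    calc |g z| * |k z| ≤ A * (2 * C * Real.sqrt a * z ^ (-(1 / 2) : ℝ)) :=
          mul_le_mul h1 h2 (abs_nonneg _) ((abs_nonneg _).trans h1)
      _ = _ := by ring

theorem abs_evenConv_le_of_local (hk : LogKernel a C k k') {w : ℝ → ℝ} {A x : ℝ}
    (hA : ∀ y ∈ Icc (x - a) (x + a), |w y| ≤ A) : |evenConv a k w x| ≤ 8 * C * a * A := by
  have h := hk.abs_integral_le (g := fun z => w (x - z) + w (x + z)) (A := 2 * A) (δ := a)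
    ⟨hk.pos.le, le_rfl⟩ (fun z hz => by
      have := abs_add_le (w (x - z)) (w (x + z))
      linarith [hA (x - z) ⟨by linarith [hz.2], by linarith [hz.1, hk.pos]⟩,
        hA (x + z) ⟨by linarith [hz.1, hk.pos], by linarith [hz.2]⟩])
  refine h.trans (le_of_eq ?_)
  rw [mul_assoc (4 * C * (2 * A)), Real.mul_self_sqrt hk.pos.le]
  ring

theorem abs_evenConv_le (hk : LogKernel a C k k') {w : ℝ → ℝ} {A x : ℝ}
    (hA : ∀ y, |w y| ≤ A) : |evenConv a k w x| ≤ 8 * C * a * A :=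
  hk.abs_evenConv_le_of_local fun y _ => hA y

/-- The derivative falls on `w`, since that of the kernel, of size `1 / z`, need not be integrable.
Thus `u_x` appears as a convolution of `ω_x` with the logarithmic kernel instead of a principal
value. -/
theorem hasDerivAt_evenConv (hk : LogKernel a C k k') {w w' : ℝ → ℝ}
    (hw : ∀ y, HasDerivAt w (w' y) y) (hw' : Continuous w') (x : ℝ) :
    HasDerivAt (evenConv a k w) (evenConv a k w' x) x := by
  have hwc : Continuous w := continuous_iff_continuousAt.2 fun y => (hw y).continuousAt
  obtain ⟨M, hM⟩ := (isCompact_Icc (a := x - 1 - a) (b := x + 1 + a)).exists_bound_of_continuousOn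
    hw'.continuousOn
  refine (intervalIntegral.hasDerivAt_integral_of_dominated_loc_of_deriv_le
    (F := fun y z => (w (y - z) + w (y + z)) * k z)
    (F' := fun y z => (w' (y - z) + w' (y + z)) * k z)
    (bound := fun z => (2 * M) * |k z|) (Metric.ball_mem_nhds x one_pos)
    (Eventually.of_forall fun y => ?_) (hk.integrable_mul (by fun_prop)) ?_
    (Eventually.of_forall fun z hz y hy => ?_) (hk.intervalIntegrable.abs.const_mul _)
    (Eventually.of_forall fun z hz y hy => ?_)).2
  · exact (Continuous.aestronglyMeasurable (by fun_prop)).mul hk.aestronglyMeasurable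
  · exact (Continuous.aestronglyMeasurable (by fun_prop)).mul hk.aestronglyMeasurable
  · rw [uIoc_of_le hk.pos.le] at hz
    rw [Metric.mem_ball, Real.dist_eq, abs_lt] at hy
    rw [norm_mul, Real.norm_eq_abs (k z)]
    refine mul_le_mul_of_nonneg_right ?_ (abs_nonneg _)
    have h1 := hM (y - z) ⟨by linarith [hz.2], by linarith [hz.1, hk.pos]⟩
    have h2 := hM (y + z) ⟨by linarith [hz.1, hk.pos], by linarith [hz.2]⟩
    linarith [norm_add_le (w' (y - z)) (w' (y + z))]
  · exact (((hw _).comp_sub_const y z).add ((hw _).comp_add_const y z)).mul_const _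

theorem continuousOn_evenConv_time (hk : LogKernel a C k k') {f : ℝ → ℝ → ℝ} (hf : SmoothST f)
    (x : ℝ) : ContinuousOn (fun t => evenConv a k (f t) x) (Ici 0) := by
  intro t ht
  obtain ⟨M, -, hM⟩ := hf.bounded (t + 1) (|x| + a)
  refine intervalIntegral.continuousWithinAt_of_dominated_interval
    (bound := fun z => (2 * M) * |k z|) ?_ ?_ (hk.intervalIntegrable.abs.const_mul _) ?_
  · filter_upwards [self_mem_nhdsWithin] with s hs
    have := hf.continuous_slice hs
    exact (Continuous.aestronglyMeasurable (by fun_prop)).mul hk.aestronglyMeasurable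
  · have h1 : ∀ᶠ s in 𝓝[Ici 0] t, s < t + 1 :=
      mem_nhdsWithin_of_mem_nhds (Iio_mem_nhds (by linarith))
    filter_upwards [self_mem_nhdsWithin, h1] with s hs hs1
    refine Eventually.of_forall fun z hz => ?_
    rw [uIoc_of_le hk.pos.le] at hz
    rw [norm_mul, Real.norm_eq_abs (k z)]
    refine mul_le_mul_of_nonneg_right ?_ (abs_nonneg _)
    have hx := abs_le.1 (le_refl |x|)
    have h2 := hM s ⟨hs, hs1.le⟩ (x - z) ⟨by linarith [hz.2], by linarith [hz.1, hk.pos]⟩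
    have h3 := hM s ⟨hs, hs1.le⟩ (x + z) ⟨by linarith [hz.1, hk.pos], by linarith [hz.2]⟩
    exact (abs_add_le _ _).trans (by linarith)
  · refine Eventually.of_forall fun z _ => ?_
    exact (((hf.continuousOn_time _) t ht).add ((hf.continuousOn_time _) t ht)).mul
      continuousWithinAt_const

/-- A bound for the convolution of `k` with a derivative `g'`, in which the size of `g'` enters with
a factor that is exponentially small in `N`, at the price of a factor `N` for the size of `g`. -/
theorem abs_integral_deriv_le (hk : LogKernel a C k k') {g g' : ℝ → ℝ} {A M N : ℝ}
    (hg : ∀ z, HasDerivAt g (g' z) z) (hg' : Continuous g') (hA : ∀ z, |g z| ≤ A)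
    (hM : ∀ z, |g' z| ≤ M) (hN : 1 ≤ N) :
    |∫ z in (0 : ℝ)..a, g' z * k z| ≤ 4 * C * (a + 1) * (M * Real.exp (-N / 2) + N * A) := by
  have ha := hk.pos
  have hA0 : 0 ≤ A := (abs_nonneg _).trans (hA 0)
  have hM0 : 0 ≤ M := (abs_nonneg _).trans (hM 0)
  have hC := hk.nonneg
  -- The cut `δ` balances two regions. On `(0, δ)` the bound by `√δ` gives `exp (-N / 2)`. On `[δ,
  -- a]` the derivative is moved to the kernel, where `∫ C / z = C N`, and the boundary value at `δ`
  -- is at most `C (1 + N)`.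
  set δ := a * Real.exp (-N) with hδdef
  have hδ0 : 0 < δ := by positivity
  have hδa : δ ≤ a := by
    have : Real.exp (-N) ≤ 1 := Real.exp_le_one_iff.2 (by linarith)
    nlinarith
  have hsub : Icc δ a ⊆ Ioc 0 a := fun z hz => ⟨hδ0.trans_le hz.1, hz.2⟩
  have hlog : Real.log (a / δ) = N := by
    rw [hδdef, div_mul_eq_div_div, div_self ha.ne', one_div, ← Real.exp_neg, neg_neg, Real.log_exp]
  have hint := hk.integrable_mul hg'
  have hi1 : IntervalIntegrable (fun z => g' z * k z) volume 0 δ :=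
    hint.mono_set (by rw [uIcc_of_le hδ0.le, uIcc_of_le ha.le]; exact Icc_subset_Icc_right hδa)
  have hi2 : IntervalIntegrable (fun z => g' z * k z) volume δ a :=
    hint.mono_set (by rw [uIcc_of_le hδa, uIcc_of_le ha.le]; exact Icc_subset_Icc_left hδ0.le)
  rw [← intervalIntegral.integral_add_adjacent_intervals hi1 hi2]
  have hk'int : IntervalIntegrable k' volume δ a :=
    (hk.continuousOn_deriv.mono (by rw [uIcc_of_le hδa]; exact hsub)).intervalIntegrable
  have h1 := hk.abs_integral_le (g := g') (A := M) ⟨hδ0.le, hδa⟩ (fun z _ => hM z)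
  have hsqrt : Real.sqrt a * Real.sqrt δ = a * Real.exp (-N / 2) := by
    rw [← Real.sqrt_mul ha.le, hδdef, show a * (a * Real.exp (-N)) = (a * Real.exp (-N / 2)) ^ 2 by
      rw [mul_pow, ← Real.exp_nat_mul]; push_cast; ring_nf]
    exact Real.sqrt_sq (by positivity)
  have h2 : ∫ z in δ..a, g' z * k z = g a * k a - g δ * k δ - ∫ z in δ..a, g z * k' z := by
    have h := intervalIntegral.integral_mul_deriv_eq_deriv_mul
      (fun z hz => hk.hasDerivAt z (hsub (by rwa [uIcc_of_le hδa] at hz)))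
      (fun z _ => hg z) hk'int (hg'.intervalIntegrable _ _)
    simpa only [mul_comm] using h
  have h3 : |∫ z in δ..a, g z * k' z| ≤ A * C * N := by
    have h := intervalIntegral.norm_integral_le_of_norm_le (μ := volume) (a := δ) (b := a)
      (f := fun z => g z * k' z) (g := fun z => A * C * z⁻¹) hδa
      (Eventually.of_forall fun z hz => ?_) ?_
    · rw [intervalIntegral.integral_const_mul, integral_inv_of_pos hδ0 ha, hlog] at h
      exact h
    · rw [Real.norm_eq_abs, abs_mul, mul_assoc]
      exact mul_le_mul (hA z) (hk.bound_deriv z (hsub ⟨hz.1.le, hz.2⟩)) (abs_nonneg _) hA0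
    · refine IntervalIntegrable.const_mul ?_ _
      refine intervalIntegral.intervalIntegrable_inv (fun z hz => ?_) continuousOn_id
      rw [uIcc_of_le hδa] at hz
      exact (hδ0.trans_le hz.1).ne'
  have h4 : |g a * k a| ≤ A * C := by
    rw [abs_mul]
    have := hk.bound a ⟨ha, le_rfl⟩
    rw [div_self ha.ne', Real.log_one, add_zero, mul_one] at this
    exact mul_le_mul (hA a) this (abs_nonneg _) hA0
  have h5 : |g δ * k δ| ≤ A * (C * (1 + N)) := by
    rw [abs_mul]
    have := hk.bound δ ⟨hδ0, hδa⟩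
    rw [hlog] at this
    exact mul_le_mul (hA δ) this (abs_nonneg _) hA0
  rw [h2]
  rw [mul_assoc (4 * C * M), hsqrt] at h1
  have h6 : A * C ≤ N * (A * C) := le_mul_of_one_le_left (by positivity) hN
  have h7 : 0 ≤ M * Real.exp (-N / 2) * C := by positivity
  have h8 : 0 ≤ N * (A * C) * a := by positivity
  have b1 := abs_le.1 h1
  have b3 := abs_le.1 h3
  have b4 := abs_le.1 h4
  have b5 := abs_le.1 h5
  rw [abs_le]
  constructor <;> nlinarith

/-- The symmetric sum `w' (x - z) + w' (x + z)` is the `z`-derivative of `w (x + z) - w (x - z)`, so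
`abs_integral_deriv_le` applies. This is the logarithmic bound for the Hilbert transform. -/
theorem abs_evenConv_deriv_le (hk : LogKernel a C k k') {w w' : ℝ → ℝ} {A M N x : ℝ}
    (hw : ∀ y, HasDerivAt w (w' y) y) (hw' : Continuous w') (hA : ∀ y, |w y| ≤ A)
    (hM : ∀ y, |w' y| ≤ M) (hN : 1 ≤ N) :
    |evenConv a k w' x| ≤ 8 * C * (a + 1) * (M * Real.exp (-N / 2) + N * A) := by
  have h := hk.abs_integral_deriv_le (g := fun z => w (x + z) - w (x - z))
    (g' := fun z => w' (x - z) + w' (x + z)) (A := 2 * A) (M := 2 * M) (N := N)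
    (fun z => ?_) (by fun_prop) (fun z => ?_) (fun z => ?_) hN
  · refine h.trans (le_of_eq (by ring))
  · exact (((hw _).comp_const_add x z).sub ((hw _).comp_const_sub x z)).congr_deriv (by ring)
  · exact (abs_sub _ _).trans (by linarith [hA (x + z), hA (x - z)])
  · exact (abs_add_le _ _).trans (by linarith [hM (x + z), hM (x - z)])

end LogKernel

/-! ### A Gronwall inequality with logarithmic loss -/

theorem abs_le_of_exp_deriv_bound {f f' : ℝ → ℝ} {t₀ t c lam E : ℝ} (ht₀ : 0 ≤ t₀) (ht : t₀ ≤ t)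
    (hf : ∀ s ∈ Icc 0 t, HasDerivWithinAt f (f' s) (Icc 0 t) s) (h0 : f t₀ = 0) (hc : 0 ≤ c)
    (hf' : ∀ s ∈ Icc t₀ t, |f' s| ≤ c * lam * Real.exp (lam * (s - t₀)) + E) :
    |f t| ≤ c * Real.exp (lam * (t - t₀)) + E * (t - t₀) := by
  have hB : ∀ s : ℝ, HasDerivAt (fun s => c * Real.exp (lam * (s - t₀)) + E * (s - t₀))
      (c * lam * Real.exp (lam * (s - t₀)) + E) s := by
    intro s
    have h1 : HasDerivAt (fun s => lam * (s - t₀)) lam s := by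
      simpa using ((hasDerivAt_id s).sub_const t₀).const_mul lam
    have h2 : HasDerivAt (fun s => E * (s - t₀)) E s := by
      simpa using ((hasDerivAt_id s).sub_const t₀).const_mul E
    exact ((h1.exp.const_mul c).add h2).congr_deriv (by ring)
  refine image_norm_le_of_norm_deriv_right_le_deriv_boundary (f := f) (f' := f')
    (fun r hr => ?_) (fun r hr => ?_) (by simpa [h0] using hc) hB
    (fun s hs => hf' s ⟨hs.1, hs.2.le⟩) ⟨ht, le_rfl⟩
  · exact ((hf r ⟨ht₀.trans hr.1, hr.2⟩).mono (Icc_subset_Icc_left ht₀)).continuousWithinAt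
  · exact (hf r ⟨ht₀.trans hr.1, hr.2.le⟩).mono_of_mem_nhdsWithin
      (Filter.mem_of_superset (Icc_mem_nhdsGE_of_mem hr) (Icc_subset_Icc_left ht₀))

/-- A logarithmically lossy Gronwall inequality along curves: two bounded functions that vanish
initially vanish identically if their derivatives along suitable curves are controlled by
`C * (N * A + exp (-N / 2))` for every `N ≥ 1`, where `A` is a bound for the functions. -/
theorem eq_zero_of_log_gronwall {w r : ℝ → ℝ → ℝ} {T M C : ℝ} (hC : 0 < C)
    (hb : ∀ t ∈ Icc 0 T, ∀ x, |w t x| ≤ M ∧ |r t x| ≤ M)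
    (h0 : ∀ x, w 0 x = 0 ∧ r 0 x = 0)
    (H : ∀ t ∈ Icc 0 T, ∀ x, ∃ X w' r' : ℝ → ℝ, X t = x ∧ ∀ s ∈ Icc 0 t,
      HasDerivWithinAt (fun q => w q (X q)) (w' s) (Icc 0 t) s ∧
      HasDerivWithinAt (fun q => r q (X q)) (r' s) (Icc 0 t) s ∧
      ∀ A N, 1 ≤ N → (∀ y, |w s y| ≤ A ∧ |r s y| ≤ A) →
        |w' s| ≤ C * (N * A + Real.exp (-N / 2)) ∧ |r' s| ≤ C * (N * A + Real.exp (-N / 2))) :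
    ∀ t ∈ Icc 0 T, ∀ x, w t x = 0 ∧ r t x = 0 := by
  -- With this step length the growth factor `exp (2 C N τ) = exp (N / 4)` is beaten by the error
  -- `exp (-N / 2)`.
  set τ := 1 / (8 * C) with hτ
  have hτ0 : 0 < τ := by positivity
  have step : ∀ t₀ ∈ Icc 0 T, (∀ x, w t₀ x = 0 ∧ r t₀ x = 0) →
      ∀ t ∈ Icc 0 T, t₀ ≤ t → t ≤ t₀ + τ → ∀ x, w t x = 0 ∧ r t x = 0 := by
    intro t₀ ht₀ hz t ht ht0t htτ x
    have hM0 : 0 ≤ M := (abs_nonneg _).trans (hb t ht x).1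
    -- Picard-type iteration for fixed `N`. A bound `D * exp (2 C N (t - t₀))` for both functions,
    -- integrated along the curves with rate `C N`, returns with `D / 2`, plus at most `C exp (-N /
    -- 2) τ`. The fixed point of this map is `2 C exp (-N / 2) τ`. No continuity in time of a
    -- supremum is needed.
    have main : ∀ N : ℝ, 1 ≤ N → ∀ n : ℕ, ∀ t ∈ Icc 0 T, t₀ ≤ t → t ≤ t₀ + τ → ∀ x,
        |w t x| ≤ (M / 2 ^ n + 2 * (C * Real.exp (-N / 2) * τ)) *
          Real.exp (2 * C * N * (t - t₀)) ∧
        |r t x| ≤ (M / 2 ^ n + 2 * (C * Real.exp (-N / 2) * τ)) *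
          Real.exp (2 * C * N * (t - t₀)) := by
      intro N hN n
      have hE : 0 < C * Real.exp (-N / 2) := by positivity
      induction n with
      | zero =>
        intro t ht h1 h2 x
        have he : 1 ≤ Real.exp (2 * C * N * (t - t₀)) := by
          rw [Real.one_le_exp_iff]
          have : 0 ≤ t - t₀ := by linarith
          positivity
        have hM : M ≤ (M / 2 ^ 0 + 2 * (C * Real.exp (-N / 2) * τ)) *
            Real.exp (2 * C * N * (t - t₀)) := by
          have h3 : M ≤ M / 2 ^ 0 + 2 * (C * Real.exp (-N / 2) * τ) := by
            rw [pow_zero, div_one]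
            nlinarith
          exact h3.trans (le_mul_of_one_le_right (hM0.trans h3) he)
        exact ⟨(hb t ht x).1.trans hM, (hb t ht x).2.trans hM⟩
      | succ n ih =>
        intro t ht h1 h2 x
        obtain ⟨X, w', r', hX, hd⟩ := H t ht x
        set D := M / 2 ^ n + 2 * (C * Real.exp (-N / 2) * τ) with hD
        have hD0 : 0 ≤ D := by positivity
        have hA : ∀ s ∈ Icc t₀ t, ∀ y, |w s y| ≤ D * Real.exp (2 * C * N * (s - t₀)) ∧
            |r s y| ≤ D * Real.exp (2 * C * N * (s - t₀)) := fun s hs y =>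
          ih s ⟨ht₀.1.trans hs.1, hs.2.trans ht.2⟩ hs.1 (hs.2.trans h2) y
        have hfin : D / 2 * Real.exp (2 * C * N * (t - t₀)) + C * Real.exp (-N / 2) * (t - t₀) ≤
            (M / 2 ^ (n + 1) + 2 * (C * Real.exp (-N / 2) * τ)) *
              Real.exp (2 * C * N * (t - t₀)) := by
          have he : 1 ≤ Real.exp (2 * C * N * (t - t₀)) := by
            rw [Real.one_le_exp_iff]
            have : 0 ≤ t - t₀ := by linarith
            positivity
          have h3 : C * Real.exp (-N / 2) * (t - t₀) ≤ C * Real.exp (-N / 2) * τ *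
              Real.exp (2 * C * N * (t - t₀)) := by
            have h4 : C * Real.exp (-N / 2) * (t - t₀) ≤ C * Real.exp (-N / 2) * τ :=
              mul_le_mul_of_nonneg_left (by linarith) hE.le
            exact h4.trans (le_mul_of_one_le_right (by positivity) he)
          have h5 : M / 2 ^ (n + 1) + 2 * (C * Real.exp (-N / 2) * τ) =
              D / 2 + C * Real.exp (-N / 2) * τ := by
            rw [hD, pow_succ]; field_simp; ring
          rw [h5, add_mul]
          linarith
        have hder : ∀ s ∈ Icc t₀ t,
            |w' s| ≤ D / 2 * (2 * C * N) * Real.exp (2 * C * N * (s - t₀)) + C * Real.exp (-N / 2) ∧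
            |r' s| ≤ D / 2 * (2 * C * N) * Real.exp (2 * C * N * (s - t₀)) +
              C * Real.exp (-N / 2) := by
          intro s hs
          obtain ⟨-, -, h3⟩ := hd s ⟨ht₀.1.trans hs.1, hs.2⟩
          obtain ⟨h4, h5⟩ := h3 _ N hN (hA s hs)
          exact ⟨h4.trans (le_of_eq (by ring)), h5.trans (le_of_eq (by ring))⟩
        have hw := abs_le_of_exp_deriv_bound (f := fun q => w q (X q)) ht₀.1 h1
          (fun s hs => (hd s hs).1) (hz _).1 (by positivity) (fun s hs => (hder s hs).1)
        have hr := abs_le_of_exp_deriv_bound (f := fun q => r q (X q)) ht₀.1 h1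
          (fun s hs => (hd s hs).2.1) (hz _).2 (by positivity) (fun s hs => (hder s hs).2)
        simp only [hX] at hw hr
        exact ⟨hw.trans hfin, hr.trans hfin⟩
    -- First `n → ∞`, then `N → ∞`: what remains is at most `exp (-N / 2) * exp (N / 4)`.
    have small : ∀ q : ℝ, (∀ N : ℝ, 1 ≤ N → ∀ n : ℕ,
        |q| ≤ (M / 2 ^ n + 2 * (C * Real.exp (-N / 2) * τ)) *
          Real.exp (2 * C * N * (t - t₀))) → q = 0 := by
      intro q hq
      have h1 : ∀ N : ℝ, 1 ≤ N → |q| ≤ Real.exp (-(N / 4)) := by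
        intro N hN
        have hlim : Tendsto (fun n : ℕ => (M / 2 ^ n + 2 * (C * Real.exp (-N / 2) * τ)) *
            Real.exp (2 * C * N * (t - t₀))) atTop (𝓝 ((0 + 2 * (C * Real.exp (-N / 2) * τ)) *
            Real.exp (2 * C * N * (t - t₀)))) := by
          refine Tendsto.mul_const _ (Tendsto.add_const _ ?_)
          exact tendsto_const_nhds.div_atTop (tendsto_pow_atTop_atTop_of_one_lt (by norm_num))
        have h2 := ge_of_tendsto' hlim (hq N hN)
        have h3 : 2 * C * N * (t - t₀) ≤ N / 4 := by
          have h4 : 2 * C * N * (t - t₀) ≤ 2 * C * N * τ :=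
            mul_le_mul_of_nonneg_left (by linarith) (by positivity)
          refine h4.trans (le_of_eq ?_)
          rw [hτ]; field_simp; norm_num
        have h5 : 2 * (C * Real.exp (-N / 2) * τ) ≤ Real.exp (-N / 2) := by
          have : C * τ = 1 / 8 := by rw [hτ]; field_simp
          have h6 := Real.exp_pos (-N / 2)
          nlinarith
        calc |q| ≤ _ := h2
          _ ≤ Real.exp (-N / 2) * Real.exp (N / 4) := by
            rw [zero_add]
            exact mul_le_mul h5 (Real.exp_le_exp.2 h3) (Real.exp_nonneg _) (Real.exp_nonneg _)
          _ = Real.exp (-(N / 4)) := by rw [← Real.exp_add]; ring_nf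
      have hlim : Tendsto (fun N : ℝ => Real.exp (-(N / 4))) atTop (𝓝 0) :=
        Real.tendsto_exp_neg_atTop_nhds_zero.comp (tendsto_id.atTop_div_const (by norm_num))
      have h2 : |q| ≤ 0 := ge_of_tendsto hlim ((eventually_ge_atTop 1).mono h1)
      exact abs_eq_zero.1 (le_antisymm h2 (abs_nonneg _))
    exact ⟨small _ fun N hN n => (main N hN n t ht ht0t htτ x).1,
      small _ fun N hN n => (main N hN n t ht ht0t htτ x).2⟩
  -- The step length `τ` does not depend on the starting time, so finitely many steps reach `T`.
  have all : ∀ n : ℕ, ∀ t ∈ Icc 0 T, t ≤ n * τ → ∀ x, w t x = 0 ∧ r t x = 0 := by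
    intro n
    induction n with
    | zero =>
      intro t ht htn x
      have : t = 0 := le_antisymm (by simpa using htn) ht.1
      exact this ▸ h0 x
    | succ n ih =>
      intro t ht htn x
      rcases le_total t (n * τ) with h | h
      · exact ih t ht h x
      · have hn : (n : ℝ) * τ ∈ Icc 0 T := ⟨by positivity, h.trans ht.2⟩
        refine step _ hn (ih _ hn le_rfl) t ht h ?_ x
        push_cast at htn
        linarith
  intro t ht x
  obtain ⟨n, hn⟩ := exists_nat_ge (t / τ)
  exact all n t ht ((div_le_iff₀ hτ0).1 hn) x

/-! ### Flow solutions and uniqueness -/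

/-- A smooth solution of the transport system with a velocity `u` that is differentiable in space
and whose backward trajectories exist. -/
structure IsFlowSolution (ω θ u u' : ℝ → ℝ → ℝ) : Prop where
  smooth_vorticity : SmoothST ω
  smooth_temperature : SmoothST θ
  vorticity_eq : ∀ t : ℝ, 0 ≤ t → ∀ x : ℝ,
    HasDerivWithinAt (fun s => ω s x) (deriv (θ t) x - u t x * deriv (ω t) x) (Ici 0) t
  temperature_eq : ∀ t : ℝ, 0 ≤ t → ∀ x : ℝ,
    HasDerivWithinAt (fun s => θ s x) (-(u t x * deriv (θ t) x)) (Ici 0) t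
  hasDerivAt_velocity : ∀ t : ℝ, 0 ≤ t → ∀ x : ℝ, HasDerivAt (u t) (u' t x) x
  exists_trajectory : ∀ t : ℝ, 0 ≤ t → ∀ x : ℝ, ∃ X, IsTrajectory u t x X
  lipschitz : ∀ T R : ℝ, ∃ K : ℝ, ∀ s ∈ Icc 0 T, ∀ y ∈ Icc (-R) R, ∀ z ∈ Icc (-R) R,
    |u s y - u s z| ≤ K * |y - z|

namespace IsFlowSolution

variable {ω θ u u' : ℝ → ℝ → ℝ}

theorem temperature_deriv_eq (h : IsFlowSolution ω θ u u') {t : ℝ} (ht : 0 ≤ t) (x : ℝ) :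
    HasDerivWithinAt (fun s => deriv (θ s) x)
      (-(u' t x * deriv (θ t) x + u t x * deriv (deriv (θ t)) x)) (Ici 0) t :=
  h.smooth_temperature.hasDerivWithinAt_deriv h.temperature_eq ht
    ((h.hasDerivAt_velocity t ht x).mul (h.smooth_temperature.deriv.hasDerivAt ht x)).neg

theorem vorticity_along (h : IsFlowSolution ω θ u u') {t x : ℝ} {X : ℝ → ℝ}
    (hX : IsTrajectory u t x X) {s : ℝ} (hs : s ∈ Icc 0 t) :
    HasDerivWithinAt (fun q => ω q (X q)) (deriv (θ s) (X s)) (Icc 0 t) s :=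
  (h.smooth_vorticity.hasDerivWithinAt_curve hs (hX.2 s hs)
    (h.vorticity_eq s hs.1 (X s))).congr_deriv (by ring)

theorem temperature_deriv_along (h : IsFlowSolution ω θ u u') {t x : ℝ} {X : ℝ → ℝ}
    (hX : IsTrajectory u t x X) {s : ℝ} (hs : s ∈ Icc 0 t) :
    HasDerivWithinAt (fun q => deriv (θ q) (X q)) (-(u' s (X s) * deriv (θ s) (X s)))
      (Icc 0 t) s :=
  (h.smooth_temperature.deriv.hasDerivWithinAt_curve hs (hX.2 s hs)
    (h.temperature_deriv_eq hs.1 (X s))).congr_deriv (by ring)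

end IsFlowSolution

/-- The velocity is given on `B` by convolution with a kernel, the vorticity and the temperature
gradient are bounded together with their derivatives up to time `T`, and vanish outside `B`. -/
structure HasLocalKernel (T M a : ℝ) (k : ℝ → ℝ) (B : Set ℝ) (ω θ u u' : ℝ → ℝ → ℝ) : Prop where
  velocity : ∀ t ∈ Icc 0 T, ∀ x ∈ B, u t x = evenConv a k (ω t) x
  velocity_deriv : ∀ t ∈ Icc 0 T, ∀ x ∈ B, u' t x = evenConv a k (deriv (ω t)) x
  outside : ∀ t ∈ Icc 0 T, ∀ x, x ∉ B → ω t x = 0 ∧ deriv (ω t) x = 0 ∧ deriv (θ t) x = 0 ∧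
    deriv (deriv (θ t)) x = 0
  bound : ∀ t ∈ Icc 0 T, ∀ x, |ω t x| ≤ M ∧ |deriv (ω t) x| ≤ M ∧ |deriv (θ t) x| ≤ M ∧
    |deriv (deriv (θ t)) x| ≤ M

theorem LogKernel.evenConv_sub {a C : ℝ} {k k' : ℝ → ℝ} (hk : LogKernel a C k k') {f g : ℝ → ℝ}
    (hf : Continuous f) (hg : Continuous g) (x : ℝ) :
    evenConv a k f x - evenConv a k g x = evenConv a k (fun y => f y - g y) x := by
  unfold evenConv
  rw [← intervalIntegral.integral_sub (hk.integrable_mul (by fun_prop))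
    (hk.integrable_mul (by fun_prop))]
  congr 1
  ext z
  ring

/-- Both differences are followed along the trajectories of the first flow. With `w = ω₁ - ω₂` and
`r = θ₁ₓ - θ₂ₓ` one has `w' = r - (u₁ - u₂) ω₂ₓ` and `r' = -u₁ₓ r - (u₁ₓ - u₂ₓ) θ₂ₓ - (u₁ - u₂)
θ₂ₓₓ`. Only `u₁ₓ - u₂ₓ` is not controlled by the supremum of `w`; `abs_evenConv_deriv_le` bounds it
with the loss that `eq_zero_of_log_gronwall` tolerates. -/
theorem HasLocalKernel.unique {T M a C : ℝ} {k k' : ℝ → ℝ} {B : Set ℝ}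
    {ω₁ θ₁ u₁ u₁' ω₂ θ₂ u₂ u₂' : ℝ → ℝ → ℝ} (hk : LogKernel a C k k')
    (s₁ : IsFlowSolution ω₁ θ₁ u₁ u₁') (s₂ : IsFlowSolution ω₂ θ₂ u₂ u₂')
    (l₁ : HasLocalKernel T M a k B ω₁ θ₁ u₁ u₁') (l₂ : HasLocalKernel T M a k B ω₂ θ₂ u₂ u₂')
    (hω : ω₁ 0 = ω₂ 0) (hθ : θ₁ 0 = θ₂ 0) :
    ∀ t ∈ Icc 0 T, ∀ x, ω₁ t x = ω₂ t x ∧ deriv (θ₁ t) x = deriv (θ₂ t) x := by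
  intro t ht
  have hM0 : 0 ≤ M := (abs_nonneg _).trans (l₁.bound t ht 0).1
  have ha := hk.pos
  have hC := hk.nonneg
  set Q := 8 * C * (a + 1) with hQ
  have hQ0 : 0 ≤ Q := by positivity
  have hQa : 8 * C * a ≤ Q := by rw [hQ]; nlinarith
  have key := eq_zero_of_log_gronwall (w := fun t x => ω₁ t x - ω₂ t x)
    (r := fun t x => deriv (θ₁ t) x - deriv (θ₂ t) x) (T := T) (M := 2 * M)
    (C := 1 + 3 * Q * M + 2 * Q * M ^ 2) (by positivity) (fun t ht x => ?_)
    (fun x => by simp [hω, hθ]) (fun t ht x => ?_) t ht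
  · intro x
    exact ⟨sub_eq_zero.1 (key x).1, sub_eq_zero.1 (key x).2⟩
  · obtain ⟨h1, -, h2, -⟩ := l₁.bound t ht x
    obtain ⟨h3, -, h4, -⟩ := l₂.bound t ht x
    exact ⟨(abs_sub _ _).trans (by linarith), (abs_sub _ _).trans (by linarith)⟩
  · obtain ⟨X, hX⟩ := s₁.exists_trajectory t ht.1 x
    refine ⟨X, fun s => (deriv (θ₁ s) (X s) - deriv (θ₂ s) (X s)) -
        (u₁ s (X s) - u₂ s (X s)) * deriv (ω₂ s) (X s),
      fun s => -(u₁' s (X s) * (deriv (θ₁ s) (X s) - deriv (θ₂ s) (X s))) -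
        (u₁' s (X s) - u₂' s (X s)) * deriv (θ₂ s) (X s) -
        (u₁ s (X s) - u₂ s (X s)) * deriv (deriv (θ₂ s)) (X s), hX.1, fun s hs => ⟨?_, ?_, ?_⟩⟩
    · refine ((s₁.vorticity_along hX hs).sub (s₂.smooth_vorticity.hasDerivWithinAt_curve hs
        (hX.2 s hs) (s₂.vorticity_eq s hs.1 (X s)))).congr_deriv ?_
      ring
    · refine ((s₁.temperature_deriv_along hX hs).sub
        (s₂.smooth_temperature.deriv.hasDerivWithinAt_curve hs
        (hX.2 s hs) (s₂.temperature_deriv_eq hs.1 (X s)))).congr_deriv ?_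
      ring
    · intro A N hN hA
      have hsT : s ∈ Icc 0 T := ⟨hs.1, hs.2.trans ht.2⟩
      set y := X s
      set E := Real.exp (-N / 2)
      have hE : 0 < E := Real.exp_pos _
      have hA0 : 0 ≤ A := (abs_nonneg _).trans (hA y).1
      have hAN : A ≤ N * A := le_mul_of_one_le_left hA0 hN
      by_cases hy : y ∈ B
      · obtain ⟨-, b2, b3, b4⟩ := l₂.bound s hsT y
        have hu : |u₁ s y - u₂ s y| ≤ Q * A := by
          rw [l₁.velocity s hsT y hy, l₂.velocity s hsT y hy,
            hk.evenConv_sub (s₁.smooth_vorticity.continuous_slice hs.1)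
              (s₂.smooth_vorticity.continuous_slice hs.1)]
          exact (hk.abs_evenConv_le fun z => (hA z).1).trans (mul_le_mul_of_nonneg_right hQa hA0)
        have hu1 : |u₁' s y| ≤ Q * M := by
          rw [l₁.velocity_deriv s hsT y hy]
          exact (hk.abs_evenConv_le fun z => (l₁.bound s hsT z).2.1).trans
            (mul_le_mul_of_nonneg_right hQa hM0)
        have hu' : |u₁' s y - u₂' s y| ≤ Q * (2 * M * E + N * A) := by
          rw [l₁.velocity_deriv s hsT y hy, l₂.velocity_deriv s hsT y hy,
            hk.evenConv_sub (s₁.smooth_vorticity.deriv.continuous_slice hs.1)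
              (s₂.smooth_vorticity.deriv.continuous_slice hs.1)]
          refine hk.abs_evenConv_deriv_le (w := fun z => ω₁ s z - ω₂ s z)
            (fun z => (s₁.smooth_vorticity.hasDerivAt hs.1 z).sub
              (s₂.smooth_vorticity.hasDerivAt hs.1 z)) ?_ (fun z => (hA z).1) (fun z => ?_) hN
          · exact (s₁.smooth_vorticity.deriv.continuous_slice hs.1).sub
              (s₂.smooth_vorticity.deriv.continuous_slice hs.1)
          · exact (abs_sub _ _).trans
              (by linarith [(l₁.bound s hsT z).2.1, (l₂.bound s hsT z).2.1])
        have hr := (hA y).2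
        have p1 : |(u₁ s y - u₂ s y) * deriv (ω₂ s) y| ≤ Q * A * M := by
          rw [abs_mul]; exact mul_le_mul hu b2 (abs_nonneg _) (by positivity)
        have p2 : |u₁' s y * (deriv (θ₁ s) y - deriv (θ₂ s) y)| ≤ Q * M * A := by
          rw [abs_mul]; exact mul_le_mul hu1 hr (abs_nonneg _) (by positivity)
        have p3 : |(u₁' s y - u₂' s y) * deriv (θ₂ s) y| ≤ Q * (2 * M * E + N * A) * M := by
          rw [abs_mul]; exact mul_le_mul hu' b3 (abs_nonneg _) (by positivity)
        have p4 : |(u₁ s y - u₂ s y) * deriv (deriv (θ₂ s)) y| ≤ Q * A * M := by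
          rw [abs_mul]; exact mul_le_mul hu b4 (abs_nonneg _) (by positivity)
        have q1 : Q * M * A ≤ Q * M * (N * A) := mul_le_mul_of_nonneg_left hAN (by positivity)
        have q2 : 0 ≤ Q * M * E := by positivity
        have q3 : 0 ≤ Q * M ^ 2 * (N * A) := by positivity
        have q4 : 0 ≤ Q * M * (N * A) := by positivity
        have q5 : 0 ≤ Q * M ^ 2 * E := by positivity
        have e : (1 + 3 * Q * M + 2 * Q * M ^ 2) * (N * A + E) = N * A + E + 3 * (Q * M * (N * A))
          + 3 * (Q * M * E) + 2 * (Q * M ^ 2 * (N * A)) + 2 * (Q * M ^ 2 * E) := by ring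
        have e3 : Q * (2 * M * E + N * A) * M = 2 * (Q * M ^ 2 * E) + Q * M * (N * A) := by ring
        have e1 : Q * A * M = Q * M * A := by ring
        rw [e1] at p1 p4
        rw [e3] at p3
        rw [e]
        constructor
        · refine (abs_sub _ _).trans ?_
          linarith
        · refine (abs_sub _ _).trans ?_
          refine (add_le_add_left (abs_sub _ _) _).trans ?_
          rw [abs_neg]
          linarith
      -- Outside `B` no formula for the velocities is available, but each term contains a factor
      -- that vanishes there.
      · obtain ⟨-, -, c3, -⟩ := l₁.outside s hsT y hy
        obtain ⟨-, d2, d3, d4⟩ := l₂.outside s hsT y hy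
        have : 0 ≤ (1 + 3 * Q * M + 2 * Q * M ^ 2) * (N * A + E) := by positivity
        constructor
        · refine le_of_eq_of_le (abs_eq_zero.2 ?_) this
          change (deriv (θ₁ s) (X s) - deriv (θ₂ s) (X s)) -
            (u₁ s (X s) - u₂ s (X s)) * deriv (ω₂ s) (X s) = 0
          rw [c3, d2, d3]
          ring
        · refine le_of_eq_of_le (abs_eq_zero.2 ?_) this
          change -(u₁' s (X s) * (deriv (θ₁ s) (X s) - deriv (θ₂ s) (X s))) -
            (u₁' s (X s) - u₂' s (X s)) * deriv (θ₂ s) (X s) -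
            (u₁ s (X s) - u₂ s (X s)) * deriv (deriv (θ₂ s)) (X s) = 0
          rw [c3, d3, d4]
          ring

/-! ### The regularised kernel `log |(F + G) / (F - G)|` -/

/-- With `x = (A - B) / (A + B)` the right side is `artanh x`, and `artanh x ≥ x` for `x ≥ 0`. -/
theorem sub_div_add_le_half_log {A B : ℝ} (hB : 0 < B) (h : B ≤ A) :
    (A - B) / (A + B) ≤ 1 / 2 * Real.log (A / B) := by
  have h1 := Real.le_log_one_add_of_nonneg (x := (A - B) / B) (div_nonneg (by linarith) hB.le)
  have h2 : 1 + (A - B) / B = A / B := by field_simp; ring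
  have h3 : 2 * ((A - B) / B) / ((A - B) / B + 2) = 2 * ((A - B) / (A + B)) := by
    have : (A - B) / B + 2 = (A + B) / B := by field_simp; ring
    rw [this]
    have : A + B ≠ 0 := by linarith
    field_simp
  rw [h2, h3] at h1
  linarith

/-- The kernel `log |(F + G) / (F - G)|`, regularised by `ε`. -/
noncomputable def logKer (ε F G : ℝ) : ℝ :=
  1 / 2 * Real.log (((F + G) ^ 2 + ε * (F * G)) / ((F - G) ^ 2 + ε * (F * G)))

section logKer

variable {ε F G : ℝ}

theorem logKer_comm (ε F G : ℝ) : logKer ε F G = logKer ε G F := by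
  unfold logKer
  rw [show (G - F) ^ 2 = (F - G) ^ 2 by ring, add_comm G F, mul_comm G F]

theorem logKer_den_pos (hε : 0 ≤ ε) (hF : 0 < F) (hG : 0 < G) (h : 0 < ε ∨ F ≠ G) :
    0 < (F - G) ^ 2 + ε * (F * G) := by
  have hFG := mul_pos hF hG
  rcases h with h | h
  · have := mul_pos h hFG
    positivity
  · have := sq_pos_of_ne_zero (sub_ne_zero.2 h)
    positivity

/-- `artanh x ≥ x` for the numerator and denominator inside `logKer`, whose difference is `4 F G`
and whose sum is `2 (F ^ 2 + G ^ 2 + ε F G)`. -/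
theorem logKer_ge (hε : 0 ≤ ε) (hF : 0 < F) (hG : 0 < G) (h : 0 < ε ∨ F ≠ G) :
    2 * (F * G) / (F ^ 2 + G ^ 2 + ε * (F * G)) ≤ logKer ε F G := by
  have hFG := mul_pos hF hG
  have h1 := sub_div_add_le_half_log (logKer_den_pos hε hF hG h)
    (show (F - G) ^ 2 + ε * (F * G) ≤ (F + G) ^ 2 + ε * (F * G) by nlinarith)
  refine le_trans (le_of_eq ?_) h1
  have h2 : 0 < F ^ 2 + G ^ 2 + ε * (F * G) := by positivity
  have h3 : (F + G) ^ 2 + ε * (F * G) + ((F - G) ^ 2 + ε * (F * G)) =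
    2 * (F ^ 2 + G ^ 2 + ε * (F * G)) := by ring
  rw [h3]
  field_simp
  ring

theorem logKer_nonneg (hε : 0 ≤ ε) (hF : 0 < F) (hG : 0 < G) (h : 0 < ε ∨ F ≠ G) :
    0 ≤ logKer ε F G :=
  le_trans (by positivity) (logKer_ge hε hF hG h)

/-- The regularising term is quadratic, so the kernel depends only on `F / G`. Hence the bound is
uniform although the weights are unbounded near the origin. -/
theorem logKer_le (hε : 0 < ε) (hF : 0 < F) (hG : 0 < G) :
    logKer ε F G ≤ 1 / 2 * Real.log (1 + 4 / ε) := by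
  have hFG := mul_pos hF hG
  have hd := logKer_den_pos hε.le hF hG (Or.inl hε)
  unfold logKer
  refine mul_le_mul_of_nonneg_left (Real.log_le_log (by positivity) ?_) (by norm_num)
  rw [div_le_iff₀ hd]
  have : (1 + 4 / ε) * ((F - G) ^ 2 + ε * (F * G)) =
    (F + G) ^ 2 + ε * (F * G) + 4 / ε * (F - G) ^ 2 := by field_simp; ring
  rw [this]
  have : 0 ≤ 4 / ε * (F - G) ^ 2 := by positivity
  linarith

/-- Adding the same positive number to both parts of a fraction that is at least `1` decreases it.
This provides the dominating function for the limit `ε → 0`. -/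
theorem logKer_anti (hε : 0 ≤ ε) (hF : 0 < F) (hG : 0 < G) (h : F ≠ G) :
    logKer ε F G ≤ logKer 0 F G := by
  have hFG := mul_pos hF hG
  have hd := logKer_den_pos hε hF hG (Or.inr h)
  have hd0 := logKer_den_pos le_rfl hF hG (Or.inr h)
  unfold logKer
  refine mul_le_mul_of_nonneg_left (Real.log_le_log (by positivity) ?_) (by norm_num)
  rw [div_le_div_iff₀ hd hd0]
  nlinarith [mul_nonneg hε (mul_pos hFG hFG).le]

theorem tendsto_logKer (hF : 0 < F) (hG : 0 < G) (h : F ≠ G) {ε : ℕ → ℝ}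
    (hε : Tendsto ε atTop (𝓝 0)) :
    Tendsto (fun n => logKer (ε n) F G) atTop (𝓝 (logKer 0 F G)) := by
  have hFG := mul_pos hF hG
  have hd0 := logKer_den_pos le_rfl hF hG (Or.inr h)
  unfold logKer
  refine Tendsto.const_mul _ (Tendsto.log (Tendsto.div ?_ ?_ hd0.ne') ?_)
  · exact (hε.mul_const _).const_add _
  · exact (hε.mul_const _).const_add _
  · have : 0 < ((F + G) ^ 2 + 0 * (F * G)) / ((F - G) ^ 2 + 0 * (F * G)) :=
      div_pos (by positivity) hd0
    exact this.ne'

theorem logKer_zero (hF : 0 < F) (hG : 0 < G) (h : F ≠ G) :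
    logKer 0 F G = Real.log |F + G| - Real.log |F - G| := by
  have h1 : F - G ≠ 0 := sub_ne_zero.2 h
  have h2 : F + G ≠ 0 := by positivity
  unfold logKer
  rw [zero_mul, add_zero, add_zero, Real.log_div (by positivity) (by positivity), Real.log_pow,
    Real.log_pow, Real.log_abs, Real.log_abs]
  push_cast
  ring

/-- Here `logKer 0 F G = artanh (G / F) * 2 / 2 + artanh (G / F)`, that is `2 artanh (G / F)`, and
`artanh x ≥ x`. This is the pointwise source of `I' ≥ (2 / π) J`. -/
theorem mul_logKer_zero_ge (hG : 0 < G) (h : G < F) : 2 * G ≤ F * logKer 0 F G := by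
  have hF : 0 < F := hG.trans h
  rw [logKer_zero hF hG h.ne', abs_of_pos (by linarith), abs_of_pos (by linarith),
    ← Real.log_div (by linarith) (by linarith)]
  have h1 := sub_div_add_le_half_log (A := F + G) (B := F - G) (by linarith) (by linarith)
  have h2 : (F + G - (F - G)) / (F + G + (F - G)) = G / F := by
    rw [show F + G - (F - G) = 2 * G by ring, show F + G + (F - G) = 2 * F by ring]
    field_simp
  rw [h2, div_le_iff₀ hF] at h1
  linarith

/-- `logKer + F ∂_F logKer`, the logarithmic derivative factor of `F * logKer ε F G`. -/
noncomputable def logKerAux (ε F G : ℝ) : ℝ :=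
  logKer ε F G + 2 * (F * G) * (G ^ 2 - F ^ 2) /
    (((F + G) ^ 2 + ε * (F * G)) * ((F - G) ^ 2 + ε * (F * G)))

theorem hasDerivAt_mul_logKer (hε : 0 < ε) (hF : 0 < F) (hG : 0 < G) :
    HasDerivAt (fun s => s * logKer ε s G) (logKerAux ε F G) F := by
  have hFG := mul_pos hF hG
  have hd := logKer_den_pos hε.le hF hG (Or.inl hε)
  have hn : 0 < (F + G) ^ 2 + ε * (F * G) := by positivity
  have h1 : HasDerivAt (fun s : ℝ => (s + G) ^ 2 + ε * (s * G)) (2 * (F + G) + ε * G) F := by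
    refine ((((hasDerivAt_id F).add_const G).pow 2).add
      (((hasDerivAt_id F).mul_const G).const_mul ε)).congr_deriv ?_
    simp
  have h2 : HasDerivAt (fun s : ℝ => (s - G) ^ 2 + ε * (s * G)) (2 * (F - G) + ε * G) F := by
    refine ((((hasDerivAt_id F).sub_const G).pow 2).add
      (((hasDerivAt_id F).mul_const G).const_mul ε)).congr_deriv ?_
    simp
  have h3 := ((h1.div h2 hd.ne').log (div_pos hn hd).ne').const_mul (1 / 2 : ℝ)
  refine ((hasDerivAt_id F).mul h3).congr_deriv ?_
  simp only [id, one_mul, Pi.div_apply]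
  unfold logKerAux logKer
  congr 1
  field_simp
  ring

theorem abs_logKerAux_le (hε : 0 < ε) (hF : 0 < F) (hG : 0 < G) :
    |logKerAux ε F G| ≤ 1 / 2 * Real.log (1 + 4 / ε) + 2 / ε := by
  have hFG := mul_pos hF hG
  have hd := logKer_den_pos hε.le hF hG (Or.inl hε)
  have hn : 0 < (F + G) ^ 2 + ε * (F * G) := by positivity
  refine (abs_add_le _ _).trans (add_le_add ?_ ?_)
  · rw [abs_of_nonneg (logKer_nonneg hε.le hF hG (Or.inl hε))]
    exact logKer_le hε hF hG
  · rw [abs_div, abs_of_pos (mul_pos hn hd), div_le_div_iff₀ (mul_pos hn hd) hε, abs_mul,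
      abs_of_pos (by positivity : 0 < 2 * (F * G))]
    have h1 : |G ^ 2 - F ^ 2| ≤ (F + G) ^ 2 := by
      rw [abs_le]; constructor <;> nlinarith
    have h2 : ε * (F * G) ≤ (F - G) ^ 2 + ε * (F * G) := by nlinarith [sq_nonneg (F - G)]
    have h3 : (F + G) ^ 2 ≤ (F + G) ^ 2 + ε * (F * G) := by
      have : 0 < ε * (F * G) := by positivity
      linarith
    have h4 : |G ^ 2 - F ^ 2| * (ε * (F * G)) ≤
        ((F + G) ^ 2 + ε * (F * G)) * ((F - G) ^ 2 + ε * (F * G)) :=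
      mul_le_mul (h1.trans h3) h2 (by positivity) hn.le
    linarith

theorem logKerAux_nonneg (hε : 0 < ε) (hF : 0 < F) (h : F ≤ G) : 0 ≤ logKerAux ε F G := by
  have hG : 0 < G := hF.trans_le h
  have hd := logKer_den_pos hε.le hF hG (Or.inl hε)
  refine add_nonneg (logKer_nonneg hε.le hF hG (Or.inl hε)) (div_nonneg ?_ (by positivity))
  exact mul_nonneg (by positivity) (by nlinarith)

/-- The symmetrised kernel is nonnegative. -/
theorem logKerAux_symm_nonneg (hε : 0 < ε) (hF : 0 < F) (hG : 0 < G) :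
    0 ≤ F ^ 2 * logKerAux ε F G + G ^ 2 * logKerAux ε G F := by
  have hFG := mul_pos hF hG
  have hd := logKer_den_pos hε.le hF hG (Or.inl hε)
  have hn : 0 < (F + G) ^ 2 + ε * (F * G) := by positivity
  have hS : 0 < F ^ 2 + G ^ 2 + ε * (F * G) := by positivity
  have h1 := mul_le_mul_of_nonneg_left (logKer_ge hε.le hF hG (Or.inl hε))
    (show 0 ≤ F ^ 2 + G ^ 2 by positivity)
  have h2 : F ^ 2 * logKerAux ε F G + G ^ 2 * logKerAux ε G F =
      (F ^ 2 + G ^ 2) * logKer ε F G - 2 * (F * G) * (G ^ 2 - F ^ 2) ^ 2 /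
        (((F + G) ^ 2 + ε * (F * G)) * ((F - G) ^ 2 + ε * (F * G))) := by
    unfold logKerAux
    rw [logKer_comm ε G F, show (G - F) ^ 2 = (F - G) ^ 2 by ring, add_comm G F, mul_comm G F]
    field_simp
    ring
  have h3 : 2 * (F * G) * (G ^ 2 - F ^ 2) ^ 2 /
        (((F + G) ^ 2 + ε * (F * G)) * ((F - G) ^ 2 + ε * (F * G))) ≤
      (F ^ 2 + G ^ 2) * (2 * (F * G) / (F ^ 2 + G ^ 2 + ε * (F * G))) := by
    rw [← mul_div_assoc, div_le_div_iff₀ (mul_pos hn hd) hS]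
    -- For `ε = 0` the lower bound `logKer_ge` cancels the rational term exactly. The regularisation
    -- leaves the explicit nonnegative remainder on the right.
    have h4 : (F ^ 2 + G ^ 2) * (2 * (F * G)) *
          (((F + G) ^ 2 + ε * (F * G)) * ((F - G) ^ 2 + ε * (F * G))) -
        2 * (F * G) * (G ^ 2 - F ^ 2) ^ 2 * (F ^ 2 + G ^ 2 + ε * (F * G)) =
        2 * (F * G) * (ε * (F * G)) *
          ((F ^ 2 + G ^ 2) * (F ^ 2 + G ^ 2 + ε * (F * G)) + 4 * (F * G) ^ 2) := by ring
    have h5 : 0 ≤ 2 * (F * G) * (ε * (F * G)) *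
          ((F ^ 2 + G ^ 2) * (F ^ 2 + G ^ 2 + ε * (F * G)) + 4 * (F * G) ^ 2) := by positivity
    linarith
  rw [h2]
  linarith

end logKer

/-! ### Blow-up weights and profiles, and the lower bound for `∫ θ θ' φ` -/

theorem integrableOn_Ioo_of_bound {b B : ℝ} {g : ℝ → ℝ} (hg : ContinuousOn g (Ioo 0 b))
    (hB : ∀ x ∈ Ioo 0 b, |g x| ≤ B) : IntegrableOn g (Ioo 0 b) :=
  Integrable.of_bound (hg.aestronglyMeasurable measurableSet_Ioo) B
    ((ae_restrict_iff' measurableSet_Ioo).2 (Eventually.of_forall hB))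

theorem integral_Ioo_of_hasDerivAt {b A B : ℝ} {F f : ℝ → ℝ} (hb : 0 < b)
    (hF : ∀ x ∈ Ioo 0 b, HasDerivAt F (f x) x) (hf : IntegrableOn f (Ioo 0 b))
    (h0 : Tendsto F (𝓝[>] 0) (𝓝 A)) (h1 : Tendsto F (𝓝[<] b) (𝓝 B)) :
    ∫ x in Ioo 0 b, f x = B - A := by
  rw [← integral_Ioc_eq_integral_Ioo, ← intervalIntegral.integral_of_le hb.le]
  exact intervalIntegral.integral_eq_sub_of_hasDerivAt_of_tendsto hb hF
    ((intervalIntegrable_iff_integrableOn_Ioo_of_le hb.le).2 hf) h0 h1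

/-- A decreasing weight `φ` on `(0, b]`, singular like `1 / x` at `0`, with `φ' = -q`, such that
`q / φ ^ 2` is nondecreasing and bounded below. -/
structure IsBlowupWeight (b m K : ℝ) (φ q : ℝ → ℝ) : Prop where
  pos : 0 < b
  m_pos : 0 < m
  K_nonneg : 0 ≤ K
  weight_pos : ∀ x ∈ Ioo 0 b, 0 < φ x
  end_nonneg : 0 ≤ φ b
  continuousOn : ContinuousOn φ (Ioc 0 b)
  hasDerivAt : ∀ x ∈ Ioo 0 b, HasDerivAt φ (-q x) x
  continuousOn_deriv : ContinuousOn q (Ioo 0 b)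
  le_deriv : ∀ x ∈ Ioo 0 b, m * φ x ^ 2 ≤ q x
  le_div : ∀ x ∈ Ioo 0 b, φ x ≤ K / x
  deriv_le_div : ∀ x ∈ Ioo 0 b, q x ≤ K / x ^ 2
  monotone : ∀ x ∈ Ioo 0 b, ∀ y ∈ Ioo 0 b, y < x → q y * φ x ^ 2 ≤ q x * φ y ^ 2

/-- Vorticity and temperature profiles on `[0, b]` with the signs and the vanishing orders of the
blow-up scenario. -/
structure IsBlowupProfile (b M : ℝ) (θ θ' ω ω' : ℝ → ℝ) : Prop where
  hasDerivAt_temperature : ∀ x, HasDerivAt θ (θ' x) x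
  hasDerivAt_vorticity : ∀ x, HasDerivAt ω (ω' x) x
  continuous_temperature_deriv : Continuous θ'
  continuous_vorticity_deriv : Continuous ω'
  temperature_zero : θ 0 = 0
  vorticity_end : ω b = 0
  temperature_deriv_nonneg : ∀ x ∈ Icc 0 b, 0 ≤ θ' x
  vorticity_nonneg : ∀ x ∈ Icc 0 b, 0 ≤ ω x
  temperature_le : ∀ x ∈ Icc 0 b, θ x ≤ M * x ^ 2
  temperature_deriv_le : ∀ x ∈ Icc 0 b, θ' x ≤ M * x
  vorticity_le : ∀ x ∈ Icc 0 b, ω x ≤ M * x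
  vorticity_deriv_le : ∀ x ∈ Icc 0 b, |ω' x| ≤ M

namespace IsBlowupWeight

variable {b m K : ℝ} {φ q : ℝ → ℝ}

theorem deriv_pos (h : IsBlowupWeight b m K φ q) {x : ℝ} (hx : x ∈ Ioo 0 b) : 0 < q x :=
  lt_of_lt_of_le (mul_pos h.m_pos (pow_pos (h.weight_pos x hx) 2)) (h.le_deriv x hx)

theorem continuousOn_Ioo (h : IsBlowupWeight b m K φ q) : ContinuousOn φ (Ioo 0 b) :=
  h.continuousOn.mono Ioo_subset_Ioc_self

theorem strictAnti (h : IsBlowupWeight b m K φ q) {x y : ℝ} (hx : x ∈ Ioo 0 b) (hy : y ∈ Ioo 0 b)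
    (hxy : x < y) : φ y < φ x := by
  have := strictAntiOn_of_deriv_neg (convex_Ioo 0 b) h.continuousOn_Ioo (fun z hz => ?_)
  · exact this hx hy hxy
  · rw [interior_Ioo] at hz
    rw [(h.hasDerivAt z hz).deriv]
    exact neg_neg_of_pos (h.deriv_pos hz)

theorem ne (h : IsBlowupWeight b m K φ q) {x y : ℝ} (hx : x ∈ Ioo 0 b) (hy : y ∈ Ioo 0 b)
    (hxy : x ≠ y) : φ x ≠ φ y := by
  rcases lt_or_gt_of_ne hxy with h1 | h1
  · exact (h.strictAnti hx hy h1).ne'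
  · exact (h.strictAnti hy hx h1).ne

theorem mul_le (h : IsBlowupWeight b m K φ q) {x : ℝ} (hx : x ∈ Ioo 0 b) : φ x * x ≤ K := by
  have := h.le_div x hx
  rwa [le_div_iff₀ hx.1] at this

theorem deriv_mul_le (h : IsBlowupWeight b m K φ q) {x : ℝ} (hx : x ∈ Ioo 0 b) :
    q x * x ^ 2 ≤ K := by
  have := h.deriv_le_div x hx
  rwa [le_div_iff₀ (pow_pos hx.1 2)] at this

theorem tendsto_end (h : IsBlowupWeight b m K φ q) : Tendsto φ (𝓝[<] b) (𝓝 (φ b)) := by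
  have h1 := h.continuousOn b ⟨h.pos, le_rfl⟩
  exact h1.mono_left (nhdsWithin_le_of_mem
    (Filter.mem_of_superset (Ioo_mem_nhdsLT h.pos) Ioo_subset_Ioc_self))

end IsBlowupWeight

theorem tendsto_zero_of_abs_le_linear {b B : ℝ} {g : ℝ → ℝ} (hb : 0 < b)
    (hg : ∀ x ∈ Ioo 0 b, |g x| ≤ B * x) : Tendsto g (𝓝[>] 0) (𝓝 0) := by
  have h1 : Tendsto (fun x : ℝ => B * x) (𝓝[>] 0) (𝓝 0) := by
    have : Tendsto (fun x : ℝ => B * x) (𝓝 0) (𝓝 (B * 0)) := tendsto_id.const_mul B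
    rw [mul_zero] at this
    exact this.mono_left nhdsWithin_le_nhds
  refine squeeze_zero_norm' ?_ h1
  filter_upwards [Ioo_mem_nhdsGT hb] with x hx using hg x hx

namespace IsBlowupProfile

variable {b m K M : ℝ} {φ q θ θ' ω ω' : ℝ → ℝ}

theorem continuous_temperature (p : IsBlowupProfile b M θ θ' ω ω') : Continuous θ :=
  continuous_iff_continuousAt.2 fun x => (p.hasDerivAt_temperature x).continuousAt

theorem continuous_vorticity (p : IsBlowupProfile b M θ θ' ω ω') : Continuous ω :=
  continuous_iff_continuousAt.2 fun x => (p.hasDerivAt_vorticity x).continuousAt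

theorem temperature_mono (p : IsBlowupProfile b M θ θ' ω ω') : MonotoneOn θ (Icc 0 b) :=
  monotoneOn_of_hasDerivWithinAt_nonneg (convex_Icc 0 b) p.continuous_temperature.continuousOn
    (fun x _ => (p.hasDerivAt_temperature x).hasDerivWithinAt)
    (fun x hx => p.temperature_deriv_nonneg x (interior_subset hx))

theorem temperature_nonneg (p : IsBlowupProfile b M θ θ' ω ω') {x : ℝ} (hx : x ∈ Icc 0 b) :
    0 ≤ θ x := by
  have := p.temperature_mono ⟨le_rfl, hx.1.trans hx.2⟩ hx hx.1
  rwa [p.temperature_zero] at this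

theorem M_nonneg (p : IsBlowupProfile b M θ θ' ω ω') (hb : 0 < b) : 0 ≤ M := by
  have h1 := p.temperature_nonneg (x := b) ⟨hb.le, le_rfl⟩
  have h2 := p.temperature_le b ⟨hb.le, le_rfl⟩
  by_contra h
  push Not at h
  have : M * b ^ 2 < 0 := mul_neg_of_neg_of_pos h (by positivity)
  linarith

section

variable (p : IsBlowupProfile b M θ θ' ω ω') (W : IsBlowupWeight b m K φ q)
include p W

/-- This bound and the similar ones that follow weigh the vanishing orders `θ = O(x ^ 2)`, `θ' =
O(x)`, `ω = O(x)` against `φ = O(1 / x)`, `q = O(1 / x ^ 2)`. All integrands below are therefore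
bounded up to the singular end. -/
theorem temperature_weight_le {x : ℝ} (hx : x ∈ Ioo 0 b) : |θ x * φ x| ≤ M * K * x := by
  have h0 := p.temperature_nonneg (Ioo_subset_Icc_self hx)
  have h1 := W.weight_pos x hx
  rw [abs_of_nonneg (mul_nonneg h0 h1.le)]
  calc θ x * φ x ≤ M * x ^ 2 * φ x :=
        mul_le_mul_of_nonneg_right (p.temperature_le x (Ioo_subset_Icc_self hx)) h1.le
    _ = M * x * (φ x * x) := by ring
    _ ≤ M * x * K := mul_le_mul_of_nonneg_left (W.mul_le hx)
        (mul_nonneg (p.M_nonneg W.pos) hx.1.le)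
    _ = _ := by ring

theorem temperature_deriv_weight_le {x : ℝ} (hx : x ∈ Ioo 0 b) : |θ' x * φ x| ≤ M * K := by
  have h0 := p.temperature_deriv_nonneg x (Ioo_subset_Icc_self hx)
  have h1 := W.weight_pos x hx
  rw [abs_of_nonneg (mul_nonneg h0 h1.le)]
  calc θ' x * φ x ≤ M * x * φ x :=
        mul_le_mul_of_nonneg_right (p.temperature_deriv_le x (Ioo_subset_Icc_self hx)) h1.le
    _ = M * (φ x * x) := by ring
    _ ≤ M * K := mul_le_mul_of_nonneg_left (W.mul_le hx) (p.M_nonneg W.pos)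

theorem vorticity_weight_le {x : ℝ} (hx : x ∈ Ioo 0 b) : |ω x * φ x| ≤ M * K := by
  have h0 := p.vorticity_nonneg x (Ioo_subset_Icc_self hx)
  have h1 := W.weight_pos x hx
  rw [abs_of_nonneg (mul_nonneg h0 h1.le)]
  calc ω x * φ x ≤ M * x * φ x :=
        mul_le_mul_of_nonneg_right (p.vorticity_le x (Ioo_subset_Icc_self hx)) h1.le
    _ = M * (φ x * x) := by ring
    _ ≤ M * K := mul_le_mul_of_nonneg_left (W.mul_le hx) (p.M_nonneg W.pos)

theorem temperature_abs_le {x : ℝ} (hx : x ∈ Ioo 0 b) : |θ x| ≤ M * b ^ 2 := by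
  rw [abs_of_nonneg (p.temperature_nonneg (Ioo_subset_Icc_self hx))]
  refine (p.temperature_le x (Ioo_subset_Icc_self hx)).trans ?_
  exact mul_le_mul_of_nonneg_left (pow_le_pow_left₀ hx.1.le hx.2.le 2) (p.M_nonneg W.pos)

theorem vorticity_abs_le {x : ℝ} (hx : x ∈ Ioo 0 b) : |ω x| ≤ M * b := by
  rw [abs_of_nonneg (p.vorticity_nonneg x (Ioo_subset_Icc_self hx))]
  refine (p.vorticity_le x (Ioo_subset_Icc_self hx)).trans ?_
  exact mul_le_mul_of_nonneg_left hx.2.le (p.M_nonneg W.pos)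

theorem prod_deriv_weight_le {x : ℝ} (hx : x ∈ Ioo 0 b) :
    |(θ' x * ω x + θ x * ω' x) * φ x| ≤ 2 * M ^ 2 * K * b := by
  have hM := p.M_nonneg W.pos
  have h1 : |θ' x * φ x * ω x| ≤ M * K * (M * b) := by
    rw [abs_mul]
    exact mul_le_mul (p.temperature_deriv_weight_le W hx) (p.vorticity_abs_le W hx) (abs_nonneg _)
      (mul_nonneg hM W.K_nonneg)
  have h2 : |θ x * φ x * ω' x| ≤ M * K * b * M := by
    rw [abs_mul]
    refine mul_le_mul ((p.temperature_weight_le W hx).trans ?_)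
      (p.vorticity_deriv_le x (Ioo_subset_Icc_self hx)) (abs_nonneg _)
      (mul_nonneg (mul_nonneg hM W.K_nonneg) W.pos.le)
    exact mul_le_mul_of_nonneg_left hx.2.le (mul_nonneg hM W.K_nonneg)
  calc |(θ' x * ω x + θ x * ω' x) * φ x| = |θ' x * φ x * ω x + θ x * φ x * ω' x| := by
        congr 1; ring
    _ ≤ _ := abs_add_le _ _
    _ ≤ _ := by linarith

theorem temperature_sq_deriv_le {x : ℝ} (hx : x ∈ Ioo 0 b) :
    |θ x ^ 2 * q x| ≤ M ^ 2 * K * b ^ 2 := by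
  have hq := W.deriv_pos hx
  have h0 := p.temperature_nonneg (Ioo_subset_Icc_self hx)
  rw [abs_of_nonneg (by positivity)]
  have h1 : θ x ^ 2 ≤ (M * x ^ 2) ^ 2 :=
    pow_le_pow_left₀ h0 (p.temperature_le x (Ioo_subset_Icc_self hx)) 2
  have h2 : x ^ 2 ≤ b ^ 2 := pow_le_pow_left₀ hx.1.le hx.2.le 2
  calc θ x ^ 2 * q x ≤ (M * x ^ 2) ^ 2 * q x := mul_le_mul_of_nonneg_right h1 hq.le
    _ = M ^ 2 * x ^ 2 * (q x * x ^ 2) := by ring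
    _ ≤ M ^ 2 * x ^ 2 * K := mul_le_mul_of_nonneg_left (W.deriv_mul_le hx) (by positivity)
    _ = M ^ 2 * K * x ^ 2 := by ring
    _ ≤ _ := mul_le_mul_of_nonneg_left h2 (mul_nonneg (sq_nonneg _) W.K_nonneg)

theorem prod_weight_deriv_le {x : ℝ} (hx : x ∈ Ioo 0 b) :
    |θ x * ω x * q x| ≤ M ^ 2 * K * b := by
  have hq := W.deriv_pos hx
  have hM := p.M_nonneg W.pos
  have h0 := p.temperature_nonneg (Ioo_subset_Icc_self hx)
  have h0' := p.vorticity_nonneg x (Ioo_subset_Icc_self hx)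
  rw [abs_of_nonneg (by positivity)]
  have h1 : θ x * ω x ≤ (M * x ^ 2) * (M * x) :=
    mul_le_mul (p.temperature_le x (Ioo_subset_Icc_self hx))
      (p.vorticity_le x (Ioo_subset_Icc_self hx)) h0' (mul_nonneg hM (sq_nonneg _))
  calc θ x * ω x * q x ≤ (M * x ^ 2) * (M * x) * q x := mul_le_mul_of_nonneg_right h1 hq.le
    _ = M ^ 2 * x * (q x * x ^ 2) := by ring
    _ ≤ M ^ 2 * x * K := mul_le_mul_of_nonneg_left (W.deriv_mul_le hx)
        (mul_nonneg (sq_nonneg _) hx.1.le)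
    _ = M ^ 2 * K * x := by ring
    _ ≤ _ := mul_le_mul_of_nonneg_left hx.2.le (mul_nonneg (sq_nonneg _) W.K_nonneg)

theorem integrableOn_temperature_weight : IntegrableOn (fun x => θ x * φ x) (Ioo 0 b) :=
  integrableOn_Ioo_of_bound (p.continuous_temperature.continuousOn.mul W.continuousOn_Ioo)
    (B := M * K * b) fun _ hx => (p.temperature_weight_le W hx).trans
      (mul_le_mul_of_nonneg_left hx.2.le (mul_nonneg (p.M_nonneg W.pos) W.K_nonneg))

theorem integrableOn_vorticity_weight : IntegrableOn (fun x => ω x * φ x) (Ioo 0 b) :=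
  integrableOn_Ioo_of_bound (p.continuous_vorticity.continuousOn.mul W.continuousOn_Ioo)
    fun _ hx => p.vorticity_weight_le W hx

theorem integrableOn_prod_weight : IntegrableOn (fun x => θ x * ω x * φ x) (Ioo 0 b) := by
  refine integrableOn_Ioo_of_bound (B := M * b ^ 2 * (M * K)) ((p.continuous_temperature.mul
    p.continuous_vorticity).continuousOn.mul W.continuousOn_Ioo) fun x hx => ?_
  rw [mul_assoc, abs_mul]
  exact mul_le_mul (p.temperature_abs_le W hx) (p.vorticity_weight_le W hx) (abs_nonneg _)
    (mul_nonneg (p.M_nonneg W.pos) (sq_nonneg _))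

theorem integrableOn_temperature_deriv_weight :
    IntegrableOn (fun x => θ x * θ' x * φ x) (Ioo 0 b) := by
  refine integrableOn_Ioo_of_bound (B := M * b ^ 2 * (M * K)) ((p.continuous_temperature.mul
    p.continuous_temperature_deriv).continuousOn.mul W.continuousOn_Ioo) fun x hx => ?_
  rw [mul_assoc, abs_mul]
  exact mul_le_mul (p.temperature_abs_le W hx) (p.temperature_deriv_weight_le W hx) (abs_nonneg _)
    (mul_nonneg (p.M_nonneg W.pos) (sq_nonneg _))

theorem integrableOn_temperature_sq_deriv : IntegrableOn (fun x => θ x ^ 2 * q x) (Ioo 0 b) :=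
  integrableOn_Ioo_of_bound ((p.continuous_temperature.pow 2).continuousOn.mul W.continuousOn_deriv)
    fun _ hx => p.temperature_sq_deriv_le W hx

/-- `∫ θ θ' φ ≥ (m / 2b) (∫ θ φ)²`. -/
theorem sq_integral_le :
    m / (2 * b) * (∫ x in Ioo 0 b, θ x * φ x) ^ 2 ≤ ∫ x in Ioo 0 b, θ x * θ' x * φ x := by
  have hb := W.pos
  have i1 := p.integrableOn_temperature_weight W
  have i2 := p.integrableOn_temperature_deriv_weight W
  have i3 := p.integrableOn_temperature_sq_deriv W
  -- Integration of `(θ ^ 2 φ / 2)' = θ θ' φ - θ ^ 2 q / 2`. The boundary term vanishes at `0` and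
  -- has a favourable sign at `b`.
  have hparts : ∫ x in Ioo 0 b, (θ x * θ' x * φ x - 1 / 2 * (θ x ^ 2 * q x)) =
      1 / 2 * θ b ^ 2 * φ b - 0 := by
    refine integral_Ioo_of_hasDerivAt (F := fun x => 1 / 2 * θ x ^ 2 * φ x) hb (fun x hx => ?_)
      (i2.sub (i3.const_mul _)) ?_ ?_
    · refine ((((p.hasDerivAt_temperature x).pow 2).const_mul (1 / 2 : ℝ)).mul
        (W.hasDerivAt x hx)).congr_deriv ?_
      simp only [Pi.pow_apply]
      push_cast
      ring
    · refine tendsto_zero_of_abs_le_linear (B := 1 / 2 * (M * b ^ 2) * (M * K)) hb fun x hx => ?_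
      have h1 := mul_le_mul (p.temperature_abs_le W hx) (p.temperature_weight_le W hx)
        (abs_nonneg _) (mul_nonneg (p.M_nonneg W.pos) (sq_nonneg _))
      rw [show 1 / 2 * θ x ^ 2 * φ x = 1 / 2 * (θ x * (θ x * φ x)) by ring, abs_mul, abs_mul,
        abs_of_pos (by norm_num : (0 : ℝ) < 1 / 2)]
      linarith
    · exact (((p.continuous_temperature.tendsto b).mono_left nhdsWithin_le_nhds).pow 2
        |>.const_mul _).mul W.tendsto_end
  rw [integral_sub i2 (i3.const_mul _), integral_const_mul, sub_zero] at hparts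
  have hend : 0 ≤ 1 / 2 * θ b ^ 2 * φ b := mul_nonneg (by positivity) W.end_nonneg
  -- Cauchy-Schwarz, `(∫ θ φ) ^ 2 ≤ b ∫ θ ^ 2 φ ^ 2`, together with `m φ ^ 2 ≤ q`. It is obtained by
  -- integrating `(θ φ - A / b) ^ 2 ≥ 0`, with `A / b` the mean of `θ φ`.
  have hcs : m * (∫ x in Ioo 0 b, θ x * φ x) ^ 2 ≤ b * ∫ x in Ioo 0 b, θ x ^ 2 * q x := by
    set A := ∫ x in Ioo 0 b, θ x * φ x with hA
    have h1 : ∫ x in Ioo 0 b, (2 * (A / b) * (θ x * φ x) - (A / b) ^ 2) = A ^ 2 / b := by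
      rw [integral_sub (i1.const_mul _) (by simp), integral_const_mul, ← hA]
      simp only [setIntegral_const, measureReal_def, Real.volume_Ioo, sub_zero,
        ENNReal.toReal_ofReal hb.le, smul_eq_mul]
      field_simp
      ring
    have h2 : m * ∫ x in Ioo 0 b, (2 * (A / b) * (θ x * φ x) - (A / b) ^ 2) ≤
        ∫ x in Ioo 0 b, θ x ^ 2 * q x := by
      rw [← integral_const_mul]
      refine setIntegral_mono_on (((i1.const_mul _).sub (by simp)).const_mul _) i3
        measurableSet_Ioo fun x hx => ?_
      have h3 := mul_le_mul_of_nonneg_left (W.le_deriv x hx) (sq_nonneg (θ x))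
      have h4 := mul_nonneg W.m_pos.le (sq_nonneg (θ x * φ x - A / b))
      nlinarith
    rw [h1] at h2
    have h5 := mul_le_mul_of_nonneg_left h2 hb.le
    calc m * A ^ 2 = b * (m * (A ^ 2 / b)) := by field_simp
      _ ≤ _ := h5
  have h6 : m / (2 * b) * (∫ x in Ioo 0 b, θ x * φ x) ^ 2 ≤
      1 / 2 * ∫ x in Ioo 0 b, θ x ^ 2 * q x := by
    rw [div_mul_eq_mul_div, div_le_iff₀ (by positivity)]
    linarith
  linarith

end

end IsBlowupProfile

/-! ### The lower bound for the growth of `∫ θ φ` -/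

/-- `V x = ∫ ω(y) log |(φ x + φ y) / (φ x - φ y)| dy` on `(0, b)`, a bounded continuous function. -/
structure IsLogPotential (b M : ℝ) (φ ω V : ℝ → ℝ) : Prop where
  continuousOn : ContinuousOn V (Ioo 0 b)
  bound : ∀ x ∈ Ioo 0 b, |V x| ≤ M
  integrableOn : ∀ x ∈ Ioo 0 b, IntegrableOn (fun y => ω y * logKer 0 (φ x) (φ y)) (Ioo 0 b)
  eq : ∀ x ∈ Ioo 0 b, V x = ∫ y in Ioo 0 b, ω y * logKer 0 (φ x) (φ y)

namespace IsBlowupProfile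

variable {b m K M M' : ℝ} {φ q θ θ' ω ω' V : ℝ → ℝ}
variable (p : IsBlowupProfile b M θ θ' ω ω') (W : IsBlowupWeight b m K φ q)
include p W

theorem vorticity_logKer_nonneg {ε x y : ℝ} (hε : 0 ≤ ε) (hx : x ∈ Ioo 0 b) (hy : y ∈ Ioo 0 b)
    (h : 0 < ε ∨ x ≠ y) : 0 ≤ ω y * logKer ε (φ x) (φ y) :=
  mul_nonneg (p.vorticity_nonneg y (Ioo_subset_Icc_self hy))
    (logKer_nonneg hε (W.weight_pos x hx) (W.weight_pos y hy) (h.imp_right (W.ne hx hy)))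

/-- The part `y < x` is discarded, the kernel being nonnegative. For `y > x` the weight is smaller,
`φ y < φ x`, and `mul_logKer_zero_ge` applies. -/
theorem weight_mul_potential_ge (hV : IsLogPotential b M' φ ω V) {x : ℝ} (hx : x ∈ Ioo 0 b) :
    2 * ∫ y in x..b, ω y * φ y ≤ φ x * V x := by
  have hsub : Ioo x b ⊆ Ioo 0 b := Ioo_subset_Ioo_left hx.1.le
  rw [hV.eq x hx, intervalIntegral.integral_of_le hx.2.le, integral_Ioc_eq_integral_Ioo,
    ← integral_const_mul, ← integral_const_mul]
  have hi : IntegrableOn (fun y => φ x * (ω y * logKer 0 (φ x) (φ y))) (Ioo 0 b) :=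
    (hV.integrableOn x hx).const_mul (φ x)
  calc ∫ y in Ioo x b, 2 * (ω y * φ y) ≤
      ∫ y in Ioo x b, φ x * (ω y * logKer 0 (φ x) (φ y)) := by
        refine setIntegral_mono_on
          (((p.integrableOn_vorticity_weight W).mono_set hsub).const_mul 2) (hi.mono_set hsub)
          measurableSet_Ioo fun y hy => ?_
        have h1 := mul_logKer_zero_ge (W.weight_pos y (hsub hy)) (W.strictAnti hx (hsub hy) hy.1)
        have h2 := mul_le_mul_of_nonneg_left h1
          (p.vorticity_nonneg y (Ioo_subset_Icc_self (hsub hy)))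
        linarith
    _ ≤ ∫ y in Ioo 0 b, φ x * (ω y * logKer 0 (φ x) (φ y)) := by
        refine setIntegral_mono_set hi ?_ (Eventually.of_forall fun _ hy => hsub hy)
        have hne : ∀ᵐ y ∂(volume.restrict (Ioo 0 b)), y ≠ x := Measure.ae_ne _ x
        filter_upwards [hne, ae_restrict_mem measurableSet_Ioo] with y hy hyb
        exact mul_nonneg (W.weight_pos x hx).le
          (p.vorticity_logKer_nonneg W le_rfl hx hyb (Or.inr hy.symm))

theorem integrableOn_temperature_deriv_potential (hV : IsLogPotential b M' φ ω V) :
    IntegrableOn (fun x => θ' x * φ x * V x) (Ioo 0 b) := by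
  refine integrableOn_Ioo_of_bound (B := M * K * M') ((p.continuous_temperature_deriv.continuousOn
    |>.mul W.continuousOn_Ioo).mul hV.continuousOn) fun x hx => ?_
  rw [abs_mul]
  exact mul_le_mul (p.temperature_deriv_weight_le W hx) (hV.bound x hx) (abs_nonneg _)
    (mul_nonneg (p.M_nonneg W.pos) W.K_nonneg)

/-- After `weight_mul_potential_ge`, an integration by parts with `G x = ∫ ω φ` over `(x, b)` turns
`∫ θ' G` into `∫ θ ω φ`. The boundary terms vanish because `θ 0 = 0` and `G` tends to `0` at `b`. -/
theorem integral_temperature_deriv_potential_ge (hV : IsLogPotential b M' φ ω V) :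
    2 * ∫ x in Ioo 0 b, θ x * ω x * φ x ≤ ∫ x in Ioo 0 b, θ' x * φ x * V x := by
  have hb := W.pos
  have hM := p.M_nonneg hb
  set G : ℝ → ℝ := fun x => ∫ y in x..b, ω y * φ y with hG
  have hcont : ContinuousOn (fun y => ω y * φ y) (Ioo 0 b) :=
    p.continuous_vorticity.continuousOn.mul W.continuousOn_Ioo
  have hint : IntervalIntegrable (fun y => ω y * φ y) volume 0 b :=
    (intervalIntegrable_iff_integrableOn_Ioo_of_le hb.le).2 (p.integrableOn_vorticity_weight W)
  have hGd : ∀ x ∈ Ioo 0 b, HasDerivAt G (-(ω x * φ x)) x := by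
    intro x hx
    refine intervalIntegral.integral_hasDerivAt_left (hint.mono_set ?_)
      (hcont.stronglyMeasurableAtFilter isOpen_Ioo x hx)
      (hcont.continuousAt (isOpen_Ioo.mem_nhds hx))
    rw [uIcc_of_le hx.2.le, uIcc_of_le hb.le]
    exact Icc_subset_Icc_left hx.1.le
  have hGb : ∀ x ∈ Ioo 0 b, |G x| ≤ M * K * (b - x) := by
    intro x hx
    rw [hG]
    dsimp only
    rw [intervalIntegral.integral_of_le hx.2.le, integral_Ioc_eq_integral_Ioo]
    have := norm_setIntegral_le_of_norm_le_const (μ := volume) (s := Ioo x b) (C := M * K)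
      (f := fun y => ω y * φ y) (by simp)
      (fun y hy => p.vorticity_weight_le W ⟨hx.1.trans hy.1, hy.2⟩)
    simpa [measureReal_def, hx.2.le] using this
  have iG : IntegrableOn (fun x => θ' x * G x) (Ioo 0 b) := by
    refine integrableOn_Ioo_of_bound (B := M * b * (M * K * b))
      (p.continuous_temperature_deriv.continuousOn.mul
        fun x hx => (hGd x hx).continuousAt.continuousWithinAt) fun x hx => ?_
    have h1 := p.temperature_deriv_nonneg x (Ioo_subset_Icc_self hx)
    have h2 := p.temperature_deriv_le x (Ioo_subset_Icc_self hx)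
    rw [abs_mul, abs_of_nonneg h1]
    refine mul_le_mul (h2.trans (mul_le_mul_of_nonneg_left hx.2.le hM)) ((hGb x hx).trans ?_)
      (abs_nonneg _) (mul_nonneg hM hb.le)
    exact mul_le_mul_of_nonneg_left (by linarith [hx.1]) (mul_nonneg hM W.K_nonneg)
  have i2 := p.integrableOn_prod_weight W
  have hparts : ∫ x in Ioo 0 b, (θ' x * G x - θ x * ω x * φ x) = 0 - 0 := by
    refine integral_Ioo_of_hasDerivAt (F := fun x => θ x * G x) hb (fun x hx => ?_)
      (iG.sub i2) ?_ ?_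
    · exact ((p.hasDerivAt_temperature x).mul (hGd x hx)).congr_deriv (by ring)
    · refine tendsto_zero_of_abs_le_linear (B := M * b * (M * K * b)) hb fun x hx => ?_
      have h1 : |θ x| ≤ M * b * x := by
        rw [abs_of_nonneg (p.temperature_nonneg (Ioo_subset_Icc_self hx))]
        refine (p.temperature_le x (Ioo_subset_Icc_self hx)).trans ?_
        have := mul_le_mul_of_nonneg_left hx.2.le (mul_nonneg hM hx.1.le)
        nlinarith
      rw [abs_mul]
      have h2 : |G x| ≤ M * K * b := (hGb x hx).trans
        (mul_le_mul_of_nonneg_left (by linarith [hx.1]) (mul_nonneg hM W.K_nonneg))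
      have := mul_le_mul h1 h2 (abs_nonneg _) (mul_nonneg (mul_nonneg hM hb.le) hx.1.le)
      linarith
    · have h1 : Tendsto (fun x : ℝ => M * b ^ 2 * (M * K * (b - x))) (𝓝[<] b) (𝓝 0) := by
        have : Tendsto (fun x : ℝ => M * b ^ 2 * (M * K * (b - x))) (𝓝 b)
            (𝓝 (M * b ^ 2 * (M * K * (b - b)))) := by
          exact Continuous.tendsto (by fun_prop) b
        rw [sub_self, mul_zero, mul_zero] at this
        exact this.mono_left nhdsWithin_le_nhds
      refine squeeze_zero_norm' ?_ h1
      filter_upwards [Ioo_mem_nhdsLT hb] with x hx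
      rw [norm_mul]
      exact mul_le_mul (p.temperature_abs_le W hx) (hGb x hx) (abs_nonneg _)
        (mul_nonneg hM (sq_nonneg _))
  rw [integral_sub iG i2, sub_zero, sub_eq_zero] at hparts
  rw [← hparts, ← integral_const_mul]
  refine setIntegral_mono_on (iG.const_mul 2) (p.integrableOn_temperature_deriv_potential W hV)
    measurableSet_Ioo fun x hx => ?_
  have := mul_le_mul_of_nonneg_left (p.weight_mul_potential_ge W hV hx)
    (p.temperature_deriv_nonneg x (Ioo_subset_Icc_self hx))
  linarith

end IsBlowupProfile

/-! ### Positivity of the quadratic form in the vorticity -/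

theorem integral_prod_nonneg_of_symm {α : Type*} [MeasurableSpace α] {μ : Measure α} [SFinite μ]
    {H : α × α → ℝ} (hi : Integrable H (μ.prod μ))
    (hH : ∀ᵐ z ∂(μ.prod μ), 0 ≤ H z + H z.swap) : 0 ≤ ∫ z, H z ∂(μ.prod μ) := by
  have h1 : ∫ z, H z.swap ∂(μ.prod μ) = ∫ z, H z ∂(μ.prod μ) := integral_prod_swap H
  have h2 : 0 ≤ ∫ z, (H z + H z.swap) ∂(μ.prod μ) := integral_nonneg_of_ae hH
  have h3 := integral_add hi hi.swap
  simp only [comp_apply] at h3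
  rw [h3, h1] at h2
  linarith

theorem integrable_prod_Ioo_of_bound {b B : ℝ} {g : ℝ × ℝ → ℝ}
    (hg : ContinuousOn g (Ioo 0 b ×ˢ Ioo 0 b)) (hB : ∀ z ∈ Ioo 0 b ×ˢ Ioo 0 b, |g z| ≤ B) :
    Integrable g ((volume.restrict (Ioo 0 b)).prod (volume.restrict (Ioo 0 b))) := by
  have hm : MeasurableSet (Ioo (0 : ℝ) b ×ˢ Ioo (0 : ℝ) b) := measurableSet_Ioo.prod measurableSet_Ioo
  refine Integrable.of_bound ?_ B ?_
  · rw [Measure.prod_restrict]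
    exact hg.aestronglyMeasurable hm
  · rw [Measure.prod_restrict]
    exact (ae_restrict_iff' hm).2 (Eventually.of_forall hB)

theorem continuousOn_logKer {α : Type*} [TopologicalSpace α] {s : Set α} {f g : α → ℝ} {ε : ℝ}
    (hε : 0 < ε) (hf : ContinuousOn f s) (hg : ContinuousOn g s) (hf0 : ∀ x ∈ s, 0 < f x)
    (hg0 : ∀ x ∈ s, 0 < g x) : ContinuousOn (fun x => logKer ε (f x) (g x)) s := by
  unfold logKer
  have hd : ∀ z ∈ s, 0 < (f z - g z) ^ 2 + ε * (f z * g z) :=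
    fun z hz => logKer_den_pos hε.le (hf0 z hz) (hg0 z hz) (Or.inl hε)
  have hn : ∀ z ∈ s, 0 < (f z + g z) ^ 2 + ε * (f z * g z) :=
    fun z hz => by
      have h1 := hf0 z hz
      have h2 := hg0 z hz
      positivity
  refine continuousOn_const.mul (ContinuousOn.log (ContinuousOn.div (by fun_prop) (by fun_prop)
    fun z hz => (hd z hz).ne') fun z hz => (div_pos (hn z hz) (hd z hz)).ne')

theorem continuousOn_logKerAux {α : Type*} [TopologicalSpace α] {s : Set α} {f g : α → ℝ} {ε : ℝ}
    (hε : 0 < ε) (hf : ContinuousOn f s) (hg : ContinuousOn g s) (hf0 : ∀ x ∈ s, 0 < f x)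
    (hg0 : ∀ x ∈ s, 0 < g x) : ContinuousOn (fun x => logKerAux ε (f x) (g x)) s := by
  unfold logKerAux
  refine (continuousOn_logKer hε hf hg hf0 hg0).add
    (ContinuousOn.div (by fun_prop) (by fun_prop) fun z hz => ?_)
  have h1 := hf0 z hz
  have h2 := hg0 z hz
  have hd := logKer_den_pos hε.le h1 h2 (Or.inl hε)
  positivity

attribute [local irreducible] logKer logKerAux

namespace IsBlowupProfile

variable {b m K M M' : ℝ} {φ q θ θ' ω ω' V : ℝ → ℝ}
variable (p : IsBlowupProfile b M θ θ' ω ω') (W : IsBlowupWeight b m K φ q)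
include p W

/-- Since `φ x < φ y`, the first kernel value is nonnegative. Monotonicity of `θ` and of `q / φ ^ 2`
permits replacing `θ x * q x * φ y ^ 2` by the smaller `θ y * q y * φ x ^ 2`. What remains is `θ y *
q y` times the combination in `logKerAux_symm_nonneg`. -/
theorem symm_kernel_nonneg {ε : ℝ} (hε : 0 < ε) {x y : ℝ} (hx : x ∈ Ioo 0 b) (hy : y ∈ Ioo 0 b)
    (hxy : y < x) :
    0 ≤ θ x * q x * logKerAux ε (φ x) (φ y) + θ y * q y * logKerAux ε (φ y) (φ x) := by
  have hF := W.weight_pos x hx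
  have hG := W.weight_pos y hy
  have hFG := W.strictAnti hy hx hxy
  have h1 := logKerAux_nonneg hε hF hFG.le
  have h2 := logKerAux_symm_nonneg hε hF hG
  have hθy := p.temperature_nonneg (Ioo_subset_Icc_self hy)
  have hθ := p.temperature_mono (Ioo_subset_Icc_self hy) (Ioo_subset_Icc_self hx) hxy.le
  have hq := W.monotone x hx y hy hxy
  have hqx := W.deriv_pos hx
  have hqy := W.deriv_pos hy
  have h3 : θ y * (q y * φ x ^ 2) ≤ θ x * (q x * φ y ^ 2) :=
    mul_le_mul hθ hq (by positivity) (hθy.trans hθ)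
  have h4 := mul_le_mul_of_nonneg_right h3 h1
  have h5 := mul_nonneg (mul_nonneg hθy hqy.le) h2
  have h6 : 0 ≤ φ y ^ 2 *
      (θ x * q x * logKerAux ε (φ x) (φ y) + θ y * q y * logKerAux ε (φ y) (φ x)) := by
    linarith
  exact nonneg_of_mul_nonneg_right h6 (by positivity)

theorem integral_prod_kernel_nonneg {ε : ℝ} (hε : 0 < ε) :
    0 ≤ ∫ z, θ z.1 * ω z.1 * q z.1 * (ω z.2 * logKerAux ε (φ z.1) (φ z.2))
      ∂((volume.restrict (Ioo 0 b)).prod (volume.restrict (Ioo 0 b))) := by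
  have m1 : MapsTo (Prod.fst : ℝ × ℝ → ℝ) (Ioo 0 b ×ˢ Ioo 0 b) (Ioo 0 b) := fun z hz => hz.1
  have m2 : MapsTo (Prod.snd : ℝ × ℝ → ℝ) (Ioo 0 b ×ˢ Ioo 0 b) (Ioo 0 b) := fun z hz => hz.2
  have hφ1 : ContinuousOn (fun z : ℝ × ℝ => φ z.1) (Ioo 0 b ×ˢ Ioo 0 b) :=
    W.continuousOn_Ioo.comp continuousOn_fst m1
  have hφ2 : ContinuousOn (fun z : ℝ × ℝ => φ z.2) (Ioo 0 b ×ˢ Ioo 0 b) :=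
    W.continuousOn_Ioo.comp continuousOn_snd m2
  have hθ := p.continuous_temperature
  have hω := p.continuous_vorticity
  have hq : ContinuousOn (fun z : ℝ × ℝ => q z.1) (Ioo 0 b ×ˢ Ioo 0 b) :=
    W.continuousOn_deriv.comp continuousOn_fst m1
  have hker : ContinuousOn (fun z : ℝ × ℝ => logKerAux ε (φ z.1) (φ z.2)) (Ioo 0 b ×ˢ Ioo 0 b) :=
    continuousOn_logKerAux hε hφ1 hφ2 (fun z hz => W.weight_pos _ hz.1) fun z hz => W.weight_pos _ hz.2
  have hM := p.M_nonneg W.pos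
  have hK := W.K_nonneg
  have hb := W.pos
  refine integral_prod_nonneg_of_symm (integrable_prod_Ioo_of_bound (B := M ^ 2 * K * b *
    (M * b * (1 / 2 * Real.log (1 + 4 / ε) + 2 / ε))) ?_ ?_) ?_
  · exact ((by fun_prop : Continuous fun z : ℝ × ℝ => θ z.1 * ω z.1).continuousOn.mul hq).mul
      ((by fun_prop : Continuous fun z : ℝ × ℝ => ω z.2).continuousOn.mul hker)
  · intro z hz
    rw [abs_mul]
    refine mul_le_mul (p.prod_weight_deriv_le W hz.1) ?_ (abs_nonneg _) (by positivity)
    rw [abs_mul]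
    exact mul_le_mul (p.vorticity_abs_le W hz.2)
      (abs_logKerAux_le hε (W.weight_pos _ hz.1) (W.weight_pos _ hz.2)) (abs_nonneg _)
      (by positivity)
  · rw [Measure.prod_restrict]
    refine (ae_restrict_iff' (measurableSet_Ioo.prod measurableSet_Ioo)).2
      (Eventually.of_forall fun z hz => ?_)
    obtain ⟨x, y⟩ := z
    obtain ⟨hx, hy⟩ : x ∈ Ioo 0 b ∧ y ∈ Ioo 0 b := hz
    simp only [Prod.swap_prod_mk]
    have hωx := p.vorticity_nonneg x (Ioo_subset_Icc_self hx)
    have hωy := p.vorticity_nonneg y (Ioo_subset_Icc_self hy)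
    have e : θ x * ω x * q x * (ω y * logKerAux ε (φ x) (φ y)) +
        θ y * ω y * q y * (ω x * logKerAux ε (φ y) (φ x)) = ω x * ω y *
        (θ x * q x * logKerAux ε (φ x) (φ y) + θ y * q y * logKerAux ε (φ y) (φ x)) := by ring
    rw [e]
    refine mul_nonneg (mul_nonneg hωx hωy) ?_
    rcases lt_trichotomy x y with h | h | h
    · rw [add_comm]
      exact p.symm_kernel_nonneg W hε hy hx h
    · subst h
      have h1 := logKerAux_nonneg hε (W.weight_pos x hx) le_rfl
      have h2 := p.temperature_nonneg (Ioo_subset_Icc_self hx)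
      have h3 := W.deriv_pos hx
      positivity
    · exact p.symm_kernel_nonneg W hε hx hy h

/-- By the chain rule `φ * logKer ε φ c` has derivative `-q * logKerAux ε φ c`, and `θ ω φ` vanishes
at both ends. The regularisation is essential: for `ε = 0` the new kernel has a non-integrable
singularity of type `1 / (x - y)` on the diagonal. -/
theorem integral_parts_logKer {ε : ℝ} (hε : 0 < ε) {y : ℝ} (hy : y ∈ Ioo 0 b) :
    ∫ x in Ioo 0 b, (θ' x * ω x + θ x * ω' x) * φ x * logKer ε (φ x) (φ y) =
      ∫ x in Ioo 0 b, θ x * ω x * q x * logKerAux ε (φ x) (φ y) := by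
  have hb := W.pos
  have hM := p.M_nonneg hb
  have hK := W.K_nonneg
  have hθ := p.continuous_temperature
  have hω := p.continuous_vorticity
  have hθ' := p.continuous_temperature_deriv
  have hω' := p.continuous_vorticity_deriv
  have hkerc : ContinuousOn (fun x => logKer ε (φ x) (φ y)) (Ioo 0 b) :=
    continuousOn_logKer hε W.continuousOn_Ioo continuousOn_const W.weight_pos
      fun _ _ => W.weight_pos y hy
  have hkerAc : ContinuousOn (fun x => logKerAux ε (φ x) (φ y)) (Ioo 0 b) :=
    continuousOn_logKerAux hε W.continuousOn_Ioo continuousOn_const W.weight_pos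
      fun _ _ => W.weight_pos y hy
  have hker : ∀ x ∈ Ioo 0 b, |logKer ε (φ x) (φ y)| ≤ 1 / 2 * Real.log (1 + 4 / ε) := fun x hx => by
    rw [abs_of_nonneg (logKer_nonneg hε.le (W.weight_pos x hx) (W.weight_pos y hy) (Or.inl hε))]
    exact logKer_le hε (W.weight_pos x hx) (W.weight_pos y hy)
  have i1 : IntegrableOn (fun x => (θ' x * ω x + θ x * ω' x) * φ x * logKer ε (φ x) (φ y))
      (Ioo 0 b) := by
    refine integrableOn_Ioo_of_bound (B := 2 * M ^ 2 * K * b * (1 / 2 * Real.log (1 + 4 / ε)))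
      (((by fun_prop : Continuous fun x => θ' x * ω x + θ x * ω' x).continuousOn.mul
        W.continuousOn_Ioo).mul hkerc) fun x hx => ?_
    rw [abs_mul]
    exact mul_le_mul (p.prod_deriv_weight_le W hx) (hker x hx) (abs_nonneg _) (by positivity)
  have i2 : IntegrableOn (fun x => θ x * ω x * q x * logKerAux ε (φ x) (φ y)) (Ioo 0 b) := by
    refine integrableOn_Ioo_of_bound
      (B := M ^ 2 * K * b * (1 / 2 * Real.log (1 + 4 / ε) + 2 / ε))
      (((by fun_prop : Continuous fun x => θ x * ω x).continuousOn.mul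
        W.continuousOn_deriv).mul hkerAc) fun x hx => ?_
    rw [abs_mul]
    exact mul_le_mul (p.prod_weight_deriv_le W hx)
      (abs_logKerAux_le hε (W.weight_pos x hx) (W.weight_pos y hy)) (abs_nonneg _) (by positivity)
  rw [← sub_eq_zero, ← integral_sub i1 i2]
  set Λ := 1 / 2 * Real.log (1 + 4 / ε) with hΛ
  have hF : ∀ x ∈ Ioo 0 b, |θ x * ω x * (φ x * logKer ε (φ x) (φ y))| ≤ M * K * b * Λ * |ω x| :=
    fun x hx => by
      rw [show θ x * ω x * (φ x * logKer ε (φ x) (φ y)) =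
        θ x * φ x * logKer ε (φ x) (φ y) * ω x by ring, abs_mul, abs_mul]
      refine mul_le_mul_of_nonneg_right (mul_le_mul ?_ (hker x hx) (abs_nonneg _) (by positivity))
        (abs_nonneg _)
      exact (p.temperature_weight_le W hx).trans
        (mul_le_mul_of_nonneg_left hx.2.le (mul_nonneg hM hK))
  have hΛ0 : 0 ≤ Λ := (abs_nonneg _).trans (hker y hy)
  refine (integral_Ioo_of_hasDerivAt (F := fun x => θ x * ω x * (φ x * logKer ε (φ x) (φ y)))
    (A := 0) (B := 0) hb (fun x hx => ?_) (i1.sub i2) ?_ ?_).trans (sub_zero 0)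
  · have h1 := (hasDerivAt_mul_logKer hε (W.weight_pos x hx) (W.weight_pos y hy)).comp x
      (W.hasDerivAt x hx)
    refine (((p.hasDerivAt_temperature x).mul (p.hasDerivAt_vorticity x)).mul h1).congr_deriv ?_
    simp only [Pi.mul_apply, Pi.sub_apply, comp_apply]
    ring
  · refine tendsto_zero_of_abs_le_linear (B := M * K * b * Λ * M) hb fun x hx => ?_
    refine (hF x hx).trans ?_
    rw [mul_assoc (M * K * b * Λ)]
    refine mul_le_mul_of_nonneg_left ?_ (by positivity)
    rw [abs_of_nonneg (p.vorticity_nonneg x (Ioo_subset_Icc_self hx))]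
    exact p.vorticity_le x (Ioo_subset_Icc_self hx)
  · have h1 : Tendsto (fun x : ℝ => M * K * b * Λ * |ω x|) (𝓝[<] b) (𝓝 0) := by
      have : Tendsto (fun x : ℝ => M * K * b * Λ * |ω x|) (𝓝 b) (𝓝 (M * K * b * Λ * |ω b|)) :=
        Continuous.tendsto (by fun_prop) b
      rw [p.vorticity_end, abs_zero, mul_zero] at this
      exact this.mono_left nhdsWithin_le_nhds
    refine squeeze_zero_norm' ?_ h1
    filter_upwards [Ioo_mem_nhdsLT hb] with x hx using hF x hx

/-- Fubini puts the `x`-integral inside, where `integral_parts_logKer` applies for each fixed `y`.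
The result is the double integral of `integral_prod_kernel_nonneg`. -/
theorem integral_regularized_nonneg {ε : ℝ} (hε : 0 < ε) :
    0 ≤ ∫ x in Ioo 0 b, (θ' x * ω x + θ x * ω' x) * φ x *
      ∫ y in Ioo 0 b, ω y * logKer ε (φ x) (φ y) := by
  have hb := W.pos
  have hM := p.M_nonneg hb
  have hK := W.K_nonneg
  have hθ := p.continuous_temperature
  have hω := p.continuous_vorticity
  have hθ' := p.continuous_temperature_deriv
  have hω' := p.continuous_vorticity_deriv
  have m1 : MapsTo (Prod.fst : ℝ × ℝ → ℝ) (Ioo 0 b ×ˢ Ioo 0 b) (Ioo 0 b) := fun z hz => hz.1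
  have m2 : MapsTo (Prod.snd : ℝ × ℝ → ℝ) (Ioo 0 b ×ˢ Ioo 0 b) (Ioo 0 b) := fun z hz => hz.2
  have hφ1 : ContinuousOn (fun z : ℝ × ℝ => φ z.1) (Ioo 0 b ×ˢ Ioo 0 b) :=
    W.continuousOn_Ioo.comp continuousOn_fst m1
  have hφ2 : ContinuousOn (fun z : ℝ × ℝ => φ z.2) (Ioo 0 b ×ˢ Ioo 0 b) :=
    W.continuousOn_Ioo.comp continuousOn_snd m2
  have hq : ContinuousOn (fun z : ℝ × ℝ => q z.1) (Ioo 0 b ×ˢ Ioo 0 b) :=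
    W.continuousOn_deriv.comp continuousOn_fst m1
  have hker : ContinuousOn (fun z : ℝ × ℝ => logKer ε (φ z.1) (φ z.2)) (Ioo 0 b ×ˢ Ioo 0 b) :=
    continuousOn_logKer hε hφ1 hφ2 (fun z hz => W.weight_pos _ hz.1) fun z hz => W.weight_pos _ hz.2
  have hkerA : ContinuousOn (fun z : ℝ × ℝ => logKerAux ε (φ z.1) (φ z.2)) (Ioo 0 b ×ˢ Ioo 0 b) :=
    continuousOn_logKerAux hε hφ1 hφ2 (fun z hz => W.weight_pos _ hz.1) fun z hz => W.weight_pos _ hz.2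
  have i1 : Integrable (fun z : ℝ × ℝ => (θ' z.1 * ω z.1 + θ z.1 * ω' z.1) * φ z.1 *
      (ω z.2 * logKer ε (φ z.1) (φ z.2)))
      ((volume.restrict (Ioo 0 b)).prod (volume.restrict (Ioo 0 b))) := by
    refine integrable_prod_Ioo_of_bound (B := 2 * M ^ 2 * K * b *
      (M * b * (1 / 2 * Real.log (1 + 4 / ε)))) ?_ fun z hz => ?_
    · exact ((by fun_prop : Continuous fun z : ℝ × ℝ =>
        θ' z.1 * ω z.1 + θ z.1 * ω' z.1).continuousOn.mul hφ1).mul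
        ((by fun_prop : Continuous fun z : ℝ × ℝ => ω z.2).continuousOn.mul hker)
    · rw [abs_mul]
      refine mul_le_mul (p.prod_deriv_weight_le W hz.1) ?_ (abs_nonneg _) (by positivity)
      rw [abs_mul, abs_of_nonneg (logKer_nonneg hε.le (W.weight_pos _ hz.1)
        (W.weight_pos _ hz.2) (Or.inl hε))]
      exact mul_le_mul (p.vorticity_abs_le W hz.2)
        (logKer_le hε (W.weight_pos _ hz.1) (W.weight_pos _ hz.2))
        (logKer_nonneg hε.le (W.weight_pos _ hz.1) (W.weight_pos _ hz.2) (Or.inl hε))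
        (by positivity)
  have i2 : Integrable (fun z : ℝ × ℝ => θ z.1 * ω z.1 * q z.1 *
      (ω z.2 * logKerAux ε (φ z.1) (φ z.2)))
      ((volume.restrict (Ioo 0 b)).prod (volume.restrict (Ioo 0 b))) := by
    refine integrable_prod_Ioo_of_bound (B := M ^ 2 * K * b *
      (M * b * (1 / 2 * Real.log (1 + 4 / ε) + 2 / ε))) ?_ fun z hz => ?_
    · exact ((by fun_prop : Continuous fun z : ℝ × ℝ => θ z.1 * ω z.1).continuousOn.mul hq).mul
        ((by fun_prop : Continuous fun z : ℝ × ℝ => ω z.2).continuousOn.mul hkerA)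
    · rw [abs_mul]
      refine mul_le_mul (p.prod_weight_deriv_le W hz.1) ?_ (abs_nonneg _) (by positivity)
      rw [abs_mul]
      exact mul_le_mul (p.vorticity_abs_le W hz.2)
        (abs_logKerAux_le hε (W.weight_pos _ hz.1) (W.weight_pos _ hz.2)) (abs_nonneg _)
        (by positivity)
  have h0 := p.integral_prod_kernel_nonneg W hε
  rw [integral_prod_symm _ i2] at h0
  simp only [← integral_const_mul]
  rw [← integral_prod (f := fun z : ℝ × ℝ => (θ' z.1 * ω z.1 + θ z.1 * ω' z.1) * φ z.1 *
      (ω z.2 * logKer ε (φ z.1) (φ z.2))) i1, integral_prod_symm _ i1]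
  refine h0.trans (le_of_eq ?_)
  refine setIntegral_congr_fun measurableSet_Ioo fun y hy => ?_
  have h1 := congrArg (fun r => ω y * r) (p.integral_parts_logKer W hε hy)
  simp only [← integral_const_mul] at h1
  dsimp only
  calc ∫ x in Ioo 0 b, θ x * ω x * q x * (ω y * logKerAux ε (φ x) (φ y)) =
      ∫ x in Ioo 0 b, ω y * (θ x * ω x * q x * logKerAux ε (φ x) (φ y)) := by
        congr 1; ext x; ring
    _ = _ := h1.symm
    _ = _ := by congr 1; ext x; ring

theorem integrableOn_prod_deriv_potential (hV : IsLogPotential b M' φ ω V) :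
    IntegrableOn (fun x => (θ' x * ω x + θ x * ω' x) * φ x * V x) (Ioo 0 b) := by
  have hM := p.M_nonneg W.pos
  have hθ := p.continuous_temperature
  have hω := p.continuous_vorticity
  have hθ' := p.continuous_temperature_deriv
  have hω' := p.continuous_vorticity_deriv
  refine integrableOn_Ioo_of_bound (B := 2 * M ^ 2 * K * b * M')
    (((by fun_prop : Continuous fun x => θ' x * ω x + θ x * ω' x).continuousOn.mul
      W.continuousOn_Ioo).mul hV.continuousOn) fun x hx => ?_
  have hK := W.K_nonneg
  have hb := W.pos
  rw [abs_mul]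
  exact mul_le_mul (p.prod_deriv_weight_le W hx) (hV.bound x hx) (abs_nonneg _) (by positivity)

/-- The positivity of the quadratic form that drives the growth of `∫ θ ω φ`. -/
theorem integral_prod_deriv_potential_nonneg (hV : IsLogPotential b M' φ ω V) :
    0 ≤ ∫ x in Ioo 0 b, (θ' x * ω x + θ x * ω' x) * φ x * V x := by
  have hω := p.continuous_vorticity
  have hθ := p.continuous_temperature
  have hθ' := p.continuous_temperature_deriv
  have hω' := p.continuous_vorticity_deriv
  set e : ℕ → ℝ := fun n => 1 / ((n : ℝ) + 1) with he
  have he0 : ∀ n, 0 < e n := fun n => by rw [he]; positivity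
  have helim : Tendsto e atTop (𝓝 0) := tendsto_one_div_add_atTop_nhds_zero_nat
  have hne : ∀ x, ∀ᵐ y ∂(volume.restrict (Ioo 0 b)), y ≠ x := fun x => Measure.ae_ne _ x
  have hle : ∀ n, ∀ x ∈ Ioo 0 b, ∀ᵐ y ∂(volume.restrict (Ioo 0 b)),
      ‖ω y * logKer (e n) (φ x) (φ y)‖ ≤ ω y * logKer 0 (φ x) (φ y) := by
    intro n x hx
    filter_upwards [hne x, ae_restrict_mem measurableSet_Ioo] with y hy hyb
    rw [Real.norm_eq_abs, abs_of_nonneg (p.vorticity_logKer_nonneg W (he0 n).le hx hyb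
      (Or.inl (he0 n)))]
    exact mul_le_mul_of_nonneg_left (logKer_anti (he0 n).le (W.weight_pos x hx)
      (W.weight_pos y hyb) (W.ne hx hyb hy.symm)) (p.vorticity_nonneg y (Ioo_subset_Icc_self hyb))
  have hkm : ∀ n, ∀ x ∈ Ioo 0 b, AEStronglyMeasurable (fun y => ω y * logKer (e n) (φ x) (φ y))
      (volume.restrict (Ioo 0 b)) := by
    intro n x hx
    refine (ContinuousOn.mul hω.continuousOn ?_).aestronglyMeasurable measurableSet_Ioo
    exact continuousOn_logKer (he0 n) continuousOn_const W.continuousOn_Ioo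
      (fun _ _ => W.weight_pos x hx) W.weight_pos
  -- Dominated convergence is used twice. In `y` the majorant is the unregularised kernel, by
  -- `logKer_anti`. Its integral is `V`, which then gives the majorant in `x`.
  have hlim : Tendsto (fun n => ∫ x in Ioo 0 b, (θ' x * ω x + θ x * ω' x) * φ x *
      ∫ y in Ioo 0 b, ω y * logKer (e n) (φ x) (φ y)) atTop
      (𝓝 (∫ x in Ioo 0 b, (θ' x * ω x + θ x * ω' x) * φ x * V x)) := by
    refine tendsto_integral_of_dominated_convergence
      (fun x => |(θ' x * ω x + θ x * ω' x) * φ x * V x|) (fun n => ?_)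
      (p.integrableOn_prod_deriv_potential W hV).abs (fun n => ?_) ?_
    · have h1 : AEStronglyMeasurable (fun x => (θ' x * ω x + θ x * ω' x) * φ x)
          (volume.restrict (Ioo 0 b)) :=
        ((by fun_prop : Continuous fun x => θ' x * ω x + θ x * ω' x).continuousOn.mul
          W.continuousOn_Ioo).aestronglyMeasurable measurableSet_Ioo
      refine h1.mul ?_
      refine AEStronglyMeasurable.integral_prod_right' (f := fun z : ℝ × ℝ =>
        ω z.2 * logKer (e n) (φ z.1) (φ z.2)) ?_
      rw [Measure.prod_restrict]
      refine ContinuousOn.aestronglyMeasurable ?_ (measurableSet_Ioo.prod measurableSet_Ioo)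
      refine (by fun_prop : Continuous fun z : ℝ × ℝ => ω z.2).continuousOn.mul ?_
      exact continuousOn_logKer (he0 n)
        (W.continuousOn_Ioo.comp continuousOn_fst fun z hz => hz.1)
        (W.continuousOn_Ioo.comp continuousOn_snd fun z hz => hz.2)
        (fun z hz => W.weight_pos _ hz.1) fun z hz => W.weight_pos _ hz.2
    · filter_upwards [ae_restrict_mem measurableSet_Ioo] with x hx
      rw [Real.norm_eq_abs, abs_mul, abs_mul (_ * φ x) (V x)]
      refine mul_le_mul_of_nonneg_left ?_ (abs_nonneg _)
      refine le_trans ?_ (le_abs_self _)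
      rw [hV.eq x hx]
      exact norm_integral_le_of_norm_le (hV.integrableOn x hx) (hle n x hx)
    · filter_upwards [ae_restrict_mem measurableSet_Ioo] with x hx
      refine Tendsto.const_mul _ ?_
      rw [hV.eq x hx]
      refine tendsto_integral_of_dominated_convergence (fun y => ω y * logKer 0 (φ x) (φ y))
        (fun n => hkm n x hx) (hV.integrableOn x hx) (fun n => hle n x hx) ?_
      filter_upwards [hne x, ae_restrict_mem measurableSet_Ioo] with y hy hyb
      exact (tendsto_logKer (W.weight_pos x hx) (W.weight_pos y hyb) (W.ne hx hyb hy.symm)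
        helim).const_mul _
  exact ge_of_tendsto' hlim fun n => p.integral_regularized_nonneg W (he0 n)

end IsBlowupProfile

/-! ### From the coupled inequalities to a contradiction in finite time -/

/-- A discrete form of blow-up for `f'' ≥ f ^ 2`: over steps of length `c (3/4) ^ n`, whose sum is
`4 c`, the function doubles each time. The gain in step `n` is at least a multiple of `4 ^ n (9/16)
^ n = (9/4) ^ n`, which exceeds `2 ^ n`. -/
theorem false_of_quadratic_growth {f : ℝ → ℝ} {κ f₀ T B : ℝ} (hκ : 0 < κ) (hf₀ : 0 < f₀)
    (h0 : f₀ ≤ f 0) (hT : 4 * (1 + 1 / (κ * f₀)) ≤ T)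
    (hgrow : ∀ t h, 0 ≤ t → 0 ≤ h → t + h ≤ T → f t + κ * f t ^ 2 * h ^ 2 ≤ f (t + h))
    (hB : ∀ t ∈ Icc 0 T, f t ≤ B) : False := by
  -- This `c` satisfies `c ≥ 1` and `κ f₀ c = κ f₀ + 1`, hence `κ f₀ c ^ 2 ≥ 1`, as the first
  -- doubling requires.
  set c := 1 + 1 / (κ * f₀) with hc
  have hc1 : 1 ≤ c := by
    have : 0 < 1 / (κ * f₀) := by positivity
    linarith
  have hκc : 1 ≤ κ * f₀ * c ^ 2 := by
    have h1 : κ * f₀ * c = κ * f₀ + 1 := by rw [hc]; field_simp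
    have h2 : 0 < κ * f₀ := by positivity
    nlinarith
  set t : ℕ → ℝ := fun n => 4 * c * (1 - (3 / 4) ^ n) with ht
  have htmem : ∀ n, t n ∈ Icc 0 T := by
    intro n
    have h1 : (0 : ℝ) < (3 / 4) ^ n := by positivity
    have h2 : ((3 : ℝ) / 4) ^ n ≤ 1 := pow_le_one₀ (by norm_num) (by norm_num)
    simp only [ht, mem_Icc]
    constructor
    · exact mul_nonneg (by linarith) (by linarith)
    · nlinarith
  have hstep : ∀ n, t (n + 1) = t n + c * (3 / 4) ^ n := by
    intro n
    simp only [ht, pow_succ]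
    ring
  have hmain : ∀ n : ℕ, f₀ * 2 ^ n ≤ f (t n) := by
    intro n
    induction n with
    | zero => simpa [ht] using h0
    | succ n ih =>
      have h1 := hgrow (t n) (c * (3 / 4) ^ n) (htmem n).1 (by positivity)
        (by rw [← hstep]; exact (htmem (n + 1)).2)
      rw [← hstep] at h1
      have hF : 0 < f₀ * 2 ^ n := by positivity
      have h2 : (f₀ * 2 ^ n) ^ 2 ≤ f (t n) ^ 2 := pow_le_pow_left₀ hF.le ih 2
      have h3 : κ * (f₀ * 2 ^ n) ^ 2 * (c * (3 / 4) ^ n) ^ 2 ≤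
          κ * f (t n) ^ 2 * (c * (3 / 4) ^ n) ^ 2 := by gcongr
      have h4 : κ * (f₀ * 2 ^ n) ^ 2 * (c * (3 / 4) ^ n) ^ 2 =
          κ * f₀ * c ^ 2 * (f₀ * (9 / 4) ^ n) := by
        have : ((9 : ℝ) / 4) ^ n = (2 ^ n) ^ 2 * ((3 / 4) ^ n) ^ 2 := by
          rw [← pow_mul, ← pow_mul, mul_comm n 2, pow_mul, pow_mul, ← mul_pow]
          norm_num
        rw [this]
        ring
      have h5 : (2 : ℝ) ^ n ≤ (9 / 4) ^ n := pow_le_pow_left₀ (by norm_num) (by norm_num) n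
      have h6 : f₀ * 2 ^ n ≤ κ * f₀ * c ^ 2 * (f₀ * (9 / 4) ^ n) := by
        calc f₀ * 2 ^ n ≤ f₀ * (9 / 4) ^ n := by gcongr
          _ ≤ _ := le_mul_of_one_le_left (by positivity) hκc
      rw [pow_succ]
      linarith
  obtain ⟨n, hn⟩ := pow_unbounded_of_one_lt (B / f₀) (one_lt_two : (1 : ℝ) < 2)
  rw [div_lt_iff₀ hf₀] at hn
  have := (hmain n).trans (hB _ (htmem n))
  linarith

/-- As `I` is nondecreasing, `J' ≥ β I(t) ^ 2` after time `t`. Integrating twice gives the quadratic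
gain, without a second derivative of `I`. -/
theorem quadratic_growth_of_coupled {I J I' J' : ℝ → ℝ} {T α β : ℝ} (hα : 0 ≤ α) (hβ : 0 ≤ β)
    (hI : ContinuousOn I (Icc 0 T)) (hJ : ContinuousOn J (Icc 0 T))
    (hI' : ∀ t ∈ Ioo 0 T, HasDerivAt I (I' t) t) (hJ' : ∀ t ∈ Ioo 0 T, HasDerivAt J (J' t) t)
    (hIJ : ∀ t ∈ Ioo 0 T, α * J t ≤ I' t) (hJI : ∀ t ∈ Ioo 0 T, β * I t ^ 2 ≤ J' t)
    (hI0 : ∀ t ∈ Icc 0 T, 0 ≤ I t) (hJ0 : ∀ t ∈ Icc 0 T, 0 ≤ J t) {t h : ℝ} (ht : 0 ≤ t)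
    (hh : 0 ≤ h) (hth : t + h ≤ T) : I t + α * β / 2 * I t ^ 2 * h ^ 2 ≤ I (t + h) := by
  have hsub : Icc t (t + h) ⊆ Icc 0 T := Icc_subset_Icc ht hth
  have hsub' : Ioo t (t + h) ⊆ Ioo 0 T := Ioo_subset_Ioo ht hth
  have hImono : MonotoneOn I (Icc 0 T) := by
    refine monotoneOn_of_hasDerivWithinAt_nonneg (convex_Icc 0 T) hI (f' := I') ?_ ?_
    · rw [interior_Icc]
      exact fun s hs => (hI' s hs).hasDerivWithinAt
    · rw [interior_Icc]
      exact fun s hs => (mul_nonneg hα (hJ0 s (Ioo_subset_Icc_self hs))).trans (hIJ s hs)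
  have htm : t ∈ Icc t (t + h) := ⟨le_rfl, by linarith⟩
  have hJmono : MonotoneOn (fun s => J s - β * I t ^ 2 * (s - t)) (Icc t (t + h)) := by
    refine monotoneOn_of_hasDerivWithinAt_nonneg (convex_Icc _ _)
      ((hJ.mono hsub).sub (by fun_prop)) (f' := fun s => J' s - β * I t ^ 2) ?_ ?_
    · rw [interior_Icc]
      intro s hs
      refine HasDerivAt.hasDerivWithinAt ((hJ' s (hsub' hs)).sub ?_)
      simpa using ((hasDerivAt_id s).sub_const t).const_mul (β * I t ^ 2)
    · rw [interior_Icc]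
      intro s hs
      have h1 := hImono (hsub htm) (Ioo_subset_Icc_self (hsub' hs)) hs.1.le
      have h2 := mul_le_mul_of_nonneg_left (pow_le_pow_left₀ (hI0 t (hsub htm)) h1 2) hβ
      linarith [hJI s (hsub' hs)]
  have hI2 : MonotoneOn (fun s => I s - α * β / 2 * I t ^ 2 * (s - t) ^ 2) (Icc t (t + h)) := by
    refine monotoneOn_of_hasDerivWithinAt_nonneg (convex_Icc _ _)
      ((hI.mono hsub).sub (by fun_prop)) (f' := fun s => I' s - α * β * I t ^ 2 * (s - t)) ?_ ?_
    · rw [interior_Icc]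
      intro s hs
      refine HasDerivAt.hasDerivWithinAt ((hI' s (hsub' hs)).sub ?_)
      refine ((((hasDerivAt_id s).sub_const t).pow 2).const_mul
        (α * β / 2 * I t ^ 2)).congr_deriv ?_
      simp
      ring
    · rw [interior_Icc]
      intro s hs
      have h1 := hJmono htm (Ioo_subset_Icc_self hs) hs.1.le
      simp only [sub_self, mul_zero, sub_zero] at h1
      have h2 : β * I t ^ 2 * (s - t) ≤ J s := by linarith [hJ0 t (hsub htm)]
      have h3 := mul_le_mul_of_nonneg_left h2 hα
      linarith [hIJ s (hsub' hs)]
  have h1 := hI2 htm ⟨by linarith, le_rfl⟩ (by linarith : t ≤ t + h)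
  simp only [sub_self, add_sub_cancel_left] at h1
  linarith

theorem hasDerivAt_setIntegral_of_bound {b T B t : ℝ} {F F' : ℝ → ℝ → ℝ} (ht : t ∈ Ioo 0 T)
    (hF : ∀ s ∈ Ioo 0 T, IntegrableOn (F s) (Ioo 0 b))
    (hF' : AEStronglyMeasurable (F' t) (volume.restrict (Ioo 0 b)))
    (hB : ∀ s ∈ Ioo 0 T, ∀ x ∈ Ioo 0 b, |F' s x| ≤ B)
    (hd : ∀ s ∈ Ioo 0 T, ∀ x ∈ Ioo 0 b, HasDerivAt (fun r => F r x) (F' s x) s) :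
    HasDerivAt (fun s => ∫ x in Ioo 0 b, F s x) (∫ x in Ioo 0 b, F' t x) t := by
  refine (hasDerivAt_integral_of_dominated_loc_of_deriv_le (bound := fun _ => B)
    (isOpen_Ioo.mem_nhds ht) ?_ (hF t ht) hF' ?_ (by simp) ?_).2
  · filter_upwards [isOpen_Ioo.mem_nhds ht] with s hs using (hF s hs).aestronglyMeasurable
  · filter_upwards [ae_restrict_mem measurableSet_Ioo] with x hx s hs using hB s hs x hx
  · filter_upwards [ae_restrict_mem measurableSet_Ioo] with x hx s hs using hd s hs x hx

theorem continuousOn_setIntegral_of_bound {b T B : ℝ} {F : ℝ → ℝ → ℝ}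
    (hF : ∀ s ∈ Icc 0 T, IntegrableOn (F s) (Ioo 0 b))
    (hB : ∀ s ∈ Icc 0 T, ∀ x ∈ Ioo 0 b, |F s x| ≤ B)
    (hc : ∀ x ∈ Ioo 0 b, ContinuousOn (fun s => F s x) (Icc 0 T)) :
    ContinuousOn (fun s => ∫ x in Ioo 0 b, F s x) (Icc 0 T) := by
  refine continuousOn_of_dominated (bound := fun _ => B)
    (fun s hs => (hF s hs).aestronglyMeasurable) (fun s hs => ?_) (by simp) ?_
  · filter_upwards [ae_restrict_mem measurableSet_Ioo] with x hx using hB s hs x hx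
  · filter_upwards [ae_restrict_mem measurableSet_Ioo] with x hx using hc x hx

/-- No solution with blow-up profiles exists beyond the explicit time
`4 (1 + 1 / (κ ∫ θ₀ φ))`. -/
theorem false_of_blowupProfile {b m K M M' T : ℝ} {φ q : ℝ → ℝ} {θ ω u : ℝ → ℝ → ℝ}
    (W : IsBlowupWeight b m K φ q)
    (p : ∀ t ∈ Icc 0 T, IsBlowupProfile b M (θ t) (deriv (θ t)) (ω t) (deriv (ω t)))
    (V : ∀ t ∈ Icc 0 T, IsLogPotential b M' φ (ω t) (fun x => -(Real.pi * u t x)))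
    (hω : ∀ t ∈ Icc 0 T, ∀ x, HasDerivWithinAt (fun s => ω s x)
      (deriv (θ t) x - u t x * deriv (ω t) x) (Ici 0) t)
    (hθ : ∀ t ∈ Icc 0 T, ∀ x, HasDerivWithinAt (fun s => θ s x)
      (-(u t x * deriv (θ t) x)) (Ici 0) t)
    (hpos : 0 < ∫ x in Ioo 0 b, θ 0 x * φ x)
    (hT : 4 * (1 + 1 / (2 / Real.pi * (m / (2 * b)) / 2 * ∫ x in Ioo 0 b, θ 0 x * φ x)) ≤ T) :
    False := by
  have hb := W.pos
  have hm := W.m_pos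
  have hK := W.K_nonneg
  have hpi := Real.pi_pos
  have hT0 : 0 ≤ T := by
    refine le_trans ?_ hT
    positivity
  have h0T : (0 : ℝ) ∈ Icc 0 T := ⟨le_rfl, hT0⟩
  have hM : 0 ≤ M := (p 0 h0T).M_nonneg hb
  have hM' : 0 ≤ M' := (abs_nonneg _).trans ((V 0 h0T).bound (b / 2) ⟨by linarith, by linarith⟩)
  have hθc : ∀ x, ContinuousOn (fun s => θ s x) (Icc 0 T) := fun x s hs =>
    ((hθ s hs x).mono (fun r hr => hr.1)).continuousWithinAt
  have hωc : ∀ x, ContinuousOn (fun s => ω s x) (Icc 0 T) := fun x s hs =>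
    ((hω s hs x).mono (fun r hr => hr.1)).continuousWithinAt
  have hθd : ∀ t ∈ Ioo 0 T, ∀ x, HasDerivAt (fun s => θ s x) (-(u t x * deriv (θ t) x)) t :=
    fun t ht x => (hθ t (Ioo_subset_Icc_self ht) x).hasDerivAt (Ici_mem_nhds ht.1)
  have hωd : ∀ t ∈ Ioo 0 T, ∀ x, HasDerivAt (fun s => ω s x)
      (deriv (θ t) x - u t x * deriv (ω t) x) t :=
    fun t ht x => (hω t (Ioo_subset_Icc_self ht) x).hasDerivAt (Ici_mem_nhds ht.1)
  set I : ℝ → ℝ := fun t => ∫ x in Ioo 0 b, θ t x * φ x with hI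
  set J : ℝ → ℝ := fun t => ∫ x in Ioo 0 b, θ t x * ω t x * φ x with hJ
  have hu : ∀ t ∈ Icc 0 T, ∀ x ∈ Ioo 0 b, |u t x| ≤ M' / Real.pi := by
    intro t ht x hx
    have := (V t ht).bound x hx
    rw [abs_neg, abs_mul, abs_of_pos hpi] at this
    rw [le_div_iff₀ hpi]
    linarith
  have iV : ∀ t ∈ Icc 0 T, IntegrableOn
      (fun x => -(u t x * deriv (θ t) x) * φ x) (Ioo 0 b) := by
    intro t ht
    refine (((p t ht).integrableOn_temperature_deriv_potential W (V t ht)).const_mul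
      (1 / Real.pi)).congr (Eventually.of_forall fun x => ?_)
    field_simp
  have iV2 : ∀ t ∈ Icc 0 T, IntegrableOn (fun x => -(u t x) * ((deriv (θ t) x * ω t x +
      θ t x * deriv (ω t) x) * φ x)) (Ioo 0 b) := by
    intro t ht
    refine (((p t ht).integrableOn_prod_deriv_potential W (V t ht)).const_mul
      (1 / Real.pi)).congr (Eventually.of_forall fun x => ?_)
    field_simp
  have hIcont : ContinuousOn I (Icc 0 T) :=
    continuousOn_setIntegral_of_bound (B := M * K * b)
      (fun s hs => (p s hs).integrableOn_temperature_weight W)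
      (fun s hs x hx => ((p s hs).temperature_weight_le W hx).trans
        (mul_le_mul_of_nonneg_left hx.2.le (by positivity)))
      (fun x _ => (hθc x).mul_const _)
  have hJcont : ContinuousOn J (Icc 0 T) := by
    refine continuousOn_setIntegral_of_bound (B := M * b ^ 2 * (M * K))
      (fun s hs => (p s hs).integrableOn_prod_weight W) (fun s hs x hx => ?_)
      (fun x _ => ((hθc x).mul (hωc x)).mul_const _)
    rw [mul_assoc, abs_mul]
    exact mul_le_mul ((p s hs).temperature_abs_le W hx) ((p s hs).vorticity_weight_le W hx)
      (abs_nonneg _) (by positivity)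
  have hId : ∀ t ∈ Ioo 0 T, HasDerivAt I (∫ x in Ioo 0 b, -(u t x * deriv (θ t) x) * φ x) t := by
    intro t ht
    refine hasDerivAt_setIntegral_of_bound (B := M' / Real.pi * (M * K)) ht
      (F' := fun t x => -(u t x * deriv (θ t) x) * φ x)
      (fun s hs => (p s (Ioo_subset_Icc_self hs)).integrableOn_temperature_weight W)
      (iV t (Ioo_subset_Icc_self ht)).aestronglyMeasurable (fun s hs x hx => ?_)
      (fun s hs x _ => (hθd s hs x).mul_const _)
    rw [neg_mul, abs_neg, mul_assoc, abs_mul]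
    exact mul_le_mul (hu s (Ioo_subset_Icc_self hs) x hx)
      ((p s (Ioo_subset_Icc_self hs)).temperature_deriv_weight_le W hx) (abs_nonneg _)
      (by positivity)
  -- The equations combine to `(θ ω)_t = -u (θ ω)_x + θ θ_x`: the quadratic form and the source.
  have hJd : ∀ t ∈ Ioo 0 T, HasDerivAt J (∫ x in Ioo 0 b, (-(u t x) * ((deriv (θ t) x * ω t x +
      θ t x * deriv (ω t) x) * φ x) + θ t x * deriv (θ t) x * φ x)) t := by
    intro t ht
    refine hasDerivAt_setIntegral_of_bound
      (B := M' / Real.pi * (2 * M ^ 2 * K * b) + M * b ^ 2 * (M * K)) ht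
      (F' := fun t x => -(u t x) * ((deriv (θ t) x * ω t x +
        θ t x * deriv (ω t) x) * φ x) + θ t x * deriv (θ t) x * φ x)
      (fun s hs => (p s (Ioo_subset_Icc_self hs)).integrableOn_prod_weight W)
      ((iV2 t (Ioo_subset_Icc_self ht)).add ((p t (Ioo_subset_Icc_self ht)
        ).integrableOn_temperature_deriv_weight W)).aestronglyMeasurable (fun s hs x hx => ?_)
      (fun s hs x _ => ?_)
    · have ps := p s (Ioo_subset_Icc_self hs)
      refine (abs_add_le _ _).trans (add_le_add ?_ ?_)
      · rw [abs_mul, abs_neg]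
        exact mul_le_mul (hu s (Ioo_subset_Icc_self hs) x hx)
          (ps.prod_deriv_weight_le W hx) (abs_nonneg _) (by positivity)
      · rw [mul_assoc, abs_mul]
        exact mul_le_mul (ps.temperature_abs_le W hx) (ps.temperature_deriv_weight_le W hx)
          (abs_nonneg _) (by positivity)
    · refine (((hθd s hs x).mul (hωd s hs x)).mul_const (φ x)).congr_deriv ?_
      ring
  -- The coupled inequalities hold with `α = 2 / π` and `β = m / (2 b)`, and `κ = α β / 2`.
  refine false_of_quadratic_growth (f := I) (κ := 2 / Real.pi * (m / (2 * b)) / 2)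
    (f₀ := I 0) (T := T) (B := M * K * b * b) (by positivity) hpos le_rfl hT ?_ ?_
  · intro t h ht hh hth
    refine quadratic_growth_of_coupled (by positivity) (by positivity) hIcont hJcont hId hJd
      (fun t ht => ?_) (fun t ht => ?_) (fun t ht => ?_) (fun t ht => ?_) ht hh hth
    · have ht' := Ioo_subset_Icc_self ht
      have h1 := (p t ht').integral_temperature_deriv_potential_ge W (V t ht')
      have h2 : ∫ x in Ioo 0 b, -(u t x * deriv (θ t) x) * φ x =
          1 / Real.pi * ∫ x in Ioo 0 b, deriv (θ t) x * φ x * -(Real.pi * u t x) := by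
        rw [← integral_const_mul]
        refine setIntegral_congr_fun measurableSet_Ioo fun x _ => ?_
        field_simp
      rw [h2]
      calc 2 / Real.pi * J t = 1 / Real.pi * (2 * J t) := by ring
        _ ≤ _ := mul_le_mul_of_nonneg_left h1 (by positivity)
    · have ht' := Ioo_subset_Icc_self ht
      have h1 := (p t ht').integral_prod_deriv_potential_nonneg W (V t ht')
      have h2 : ∫ x in Ioo 0 b, -(u t x) * ((deriv (θ t) x * ω t x +
          θ t x * deriv (ω t) x) * φ x) = 1 / Real.pi * ∫ x in Ioo 0 b, (deriv (θ t) x * ω t x +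
          θ t x * deriv (ω t) x) * φ x * -(Real.pi * u t x) := by
        rw [← integral_const_mul]
        refine setIntegral_congr_fun measurableSet_Ioo fun x _ => ?_
        field_simp
      have h3 := (p t ht').sq_integral_le W
      rw [integral_add (iV2 t ht') ((p t ht').integrableOn_temperature_deriv_weight W), h2]
      have h4 := mul_nonneg (by positivity : 0 ≤ 1 / Real.pi) h1
      linarith
    · exact setIntegral_nonneg measurableSet_Ioo fun x hx => mul_nonneg
        ((p t ht).temperature_nonneg (Ioo_subset_Icc_self hx)) (W.weight_pos x hx).le
    · exact setIntegral_nonneg measurableSet_Ioo fun x hx => mul_nonneg (mul_nonneg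
        ((p t ht).temperature_nonneg (Ioo_subset_Icc_self hx))
        ((p t ht).vorticity_nonneg x (Ioo_subset_Icc_self hx))) (W.weight_pos x hx).le
  · intro t ht
    have h1 := norm_setIntegral_le_of_norm_le_const (μ := volume) (s := Ioo 0 b) (C := M * K * b)
      (f := fun x => θ t x * φ x) (by simp) (fun x hx => ((p t ht).temperature_weight_le W hx).trans
        (mul_le_mul_of_nonneg_left hx.2.le (by positivity)))
    simp only [measureReal_def, Real.volume_Ioo, sub_zero, ENNReal.toReal_ofReal hb.le] at h1
    exact (le_abs_self _).trans h1

/-! ### Symmetry, barriers and propagation of signs -/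

theorem SmoothST.reflect {f : ℝ → ℝ → ℝ} (hf : SmoothST f) : SmoothST (fun t x => f t (-x)) := by
  have h : ContDiff ℝ (⊤ : ℕ∞) (fun p : ℝ × ℝ => (p.1, -p.2)) := by fun_prop
  exact hf.comp (g := uncurry f) h.contDiffOn (fun p hp => ⟨hp.1, mem_univ _⟩)

theorem deriv_reflect (f : ℝ → ℝ) (x : ℝ) : deriv (fun y => f (-y)) x = -deriv f (-x) :=
  deriv_comp_neg f x

theorem evenConv_reflect (a : ℝ) (k w : ℝ → ℝ) (x : ℝ) :
    evenConv a k (fun y => w (-y)) x = evenConv a k w (-x) := by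
  unfold evenConv
  congr 1
  ext z
  dsimp only
  rw [show -(x - z) = -x + z by ring, show -(x + z) = -x - z by ring]
  ring

theorem evenConv_neg (a : ℝ) (k w : ℝ → ℝ) (x : ℝ) :
    evenConv a k (fun y => -w y) x = -evenConv a k w x := by
  unfold evenConv
  rw [← intervalIntegral.integral_neg]
  congr 1
  ext z
  ring

namespace IsFlowSolution

variable {ω θ u u' : ℝ → ℝ → ℝ}

/-- The reflection of a solution at the origin is a solution. -/
theorem reflect (h : IsFlowSolution ω θ u u') :
    IsFlowSolution (fun t x => -ω t (-x)) (fun t x => θ t (-x)) (fun t x => -u t (-x))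
      (fun t x => u' t (-x)) where
  smooth_vorticity := h.smooth_vorticity.reflect.neg
  smooth_temperature := h.smooth_temperature.reflect
  vorticity_eq t ht x := by
    refine (h.vorticity_eq t ht (-x)).neg.congr_deriv ?_
    rw [deriv_reflect, show (fun y => -ω t (-y)) = -(fun y => ω t (-y)) from rfl, deriv.neg,
      deriv_reflect]
    ring
  temperature_eq t ht x := by
    refine (h.temperature_eq t ht (-x)).congr_deriv ?_
    rw [deriv_reflect]
    ring
  hasDerivAt_velocity t ht x := by
    refine ((h.hasDerivAt_velocity t ht (-x)).comp x (hasDerivAt_neg x)).neg.congr_deriv ?_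
    ring
  exists_trajectory t ht x := by
    obtain ⟨X, hX1, hX2⟩ := h.exists_trajectory t ht (-x)
    refine ⟨fun s => -X s, by simp [hX1], fun s hs => ?_⟩
    refine (hX2 s hs).neg.congr_deriv ?_
    simp
  lipschitz T R := by
    obtain ⟨K, hK⟩ := h.lipschitz T R
    refine ⟨K, fun s hs y hy z hz => ?_⟩
    have := hK s hs (-y) ⟨by linarith [hy.2], by linarith [hy.1]⟩ (-z)
      ⟨by linarith [hz.2], by linarith [hz.1]⟩
    rw [show -u s (-y) - -u s (-z) = -(u s (-y) - u s (-z)) by ring, abs_neg]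
    refine this.trans (le_of_eq ?_)
    rw [show -y - -z = -(y - z) by ring, abs_neg]

/-- The reflected solution has the same data and the same kernel representation, so uniqueness
identifies it with the original. Symmetry of `B` carries the representation over. -/
theorem odd_even {T M a C : ℝ} {k k' : ℝ → ℝ} {B : Set ℝ} (h : IsFlowSolution ω θ u u')
    (hk : LogKernel a C k k') (hl : HasLocalKernel T M a k B ω θ u u')
    (hB : ∀ x, x ∈ B → -x ∈ B) (hω : ∀ x, ω 0 (-x) = -ω 0 x) (hθ : ∀ x, θ 0 (-x) = θ 0 x) :
    ∀ t ∈ Icc 0 T, ∀ x, ω t (-x) = -ω t x ∧ deriv (θ t) (-x) = -deriv (θ t) x := by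
  have dω : ∀ t x, deriv (fun y => -ω t (-y)) x = deriv (ω t) (-x) := fun t x => by
    rw [show (fun y => -ω t (-y)) = -(fun y => ω t (-y)) from rfl, deriv.neg, deriv_reflect,
      neg_neg]
  have dθ : ∀ t, deriv (fun y => θ t (-y)) = fun x => -deriv (θ t) (-x) := fun t => by
    ext x
    exact deriv_reflect _ _
  have ddθ : ∀ t x, deriv (deriv (fun y => θ t (-y))) x = deriv (deriv (θ t)) (-x) := fun t x => by
    rw [dθ, show (fun y => -deriv (θ t) (-y)) = -(fun y => deriv (θ t) (-y)) from rfl, deriv.neg,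
      deriv_reflect, neg_neg]
  have hl' : HasLocalKernel T M a k B (fun t x => -ω t (-x)) (fun t x => θ t (-x))
      (fun t x => -u t (-x)) (fun t x => u' t (-x)) := by
    refine ⟨fun t ht x hx => ?_, fun t ht x hx => ?_, fun t ht x hx => ?_, fun t ht x => ?_⟩
    · rw [hl.velocity t ht (-x) (hB x hx), evenConv_neg a k (fun y => ω t (-y)), evenConv_reflect]
    · rw [hl.velocity_deriv t ht (-x) (hB x hx), funext (dω t), evenConv_reflect]
    · have hx' : -x ∉ B := fun h' => hx (by simpa using hB _ h')
      obtain ⟨h1, h2, h3, h4⟩ := hl.outside t ht (-x) hx'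
      rw [dω, ddθ, dθ]
      simp [h1, h2, h3, h4]
    · obtain ⟨h1, h2, h3, h4⟩ := hl.bound t ht (-x)
      rw [dω, ddθ, dθ, abs_neg, abs_neg]
      exact ⟨h1, h2, h3, h4⟩
  intro t ht x
  have := hl.unique hk h h.reflect hl' (by ext x; simp [hω]) (by ext x; simp [hθ]) t ht x
  rw [dθ] at this
  constructor <;> linarith [this.1, this.2]

/-- A derivative is bounded by a local Lipschitz constant, so no continuity of `u'` in time is
needed. The radius `R + 1` leaves a neighbourhood of each point of the curve. -/
theorem abs_velocity_deriv_le (h : IsFlowSolution ω θ u u') {t x : ℝ} {X : ℝ → ℝ}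
    (hX : IsTrajectory u t x X) : ∃ K, ∀ s ∈ Icc 0 t, |u' s (X s)| ≤ K := by
  obtain ⟨R, hR⟩ := isCompact_Icc.exists_bound_of_continuousOn
    (fun s hs => (hX.2 s hs).continuousWithinAt : ContinuousOn X (Icc 0 t))
  obtain ⟨K, hK⟩ := h.lipschitz t (R + 1)
  refine ⟨|K|, fun s hs => ?_⟩
  have hXs := abs_le.1 (hR s hs)
  have hlip : ∀ e ∈ Icc (X s - 1) (X s + 1), |u s (X s) - u s e| ≤ |K| * |X s - e| :=
    fun e he => (hK s hs (X s) ⟨by linarith [hXs.1], by linarith [hXs.2]⟩ e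
      ⟨by linarith [he.1, hXs.1], by linarith [he.2, hXs.2]⟩).trans
      (mul_le_mul_of_nonneg_right (le_abs_self K) (abs_nonneg _))
  refine (h.hasDerivAt_velocity s hs.1 (X s)).le_of_lip' (abs_nonneg K) ?_
  filter_upwards [Icc_mem_nhds (show X s - 1 < X s by linarith) (show X s < X s + 1 by linarith)]
    with e he
  rw [Real.norm_eq_abs, Real.norm_eq_abs, abs_sub_comm, abs_sub_comm e]
  exact hlip e he

theorem abs_velocity_le_of_fixed (h : IsFlowSolution ω θ u u') {t x e : ℝ} {X : ℝ → ℝ}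
    (hX : IsTrajectory u t x X) (he : ∀ s ∈ Icc 0 t, u s e = 0) :
    ∃ K, ∀ s ∈ Icc 0 t, |u s (X s)| ≤ K * |X s - e| := by
  obtain ⟨R, hR⟩ := isCompact_Icc.exists_bound_of_continuousOn
    (fun s hs => (hX.2 s hs).continuousWithinAt : ContinuousOn X (Icc 0 t))
  obtain ⟨K, hK⟩ := h.lipschitz t (max R |e|)
  refine ⟨K, fun s hs => ?_⟩
  have := hK s hs (X s) (abs_le.1 ((hR s hs).trans (le_max_left _ _))) e
    (abs_le.1 (le_max_right _ _))
  rwa [he s hs, sub_zero] at this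

/-- A stagnation point is a barrier: `X - e` satisfies `|(X - e)'| ≤ K |X - e|` and cannot change
sign. -/
theorem fixed_le_trajectory (h : IsFlowSolution ω θ u u') {t x e : ℝ} (ht : 0 ≤ t) {X : ℝ → ℝ}
    (hX : IsTrajectory u t x X) (he : ∀ s ∈ Icc 0 t, u s e = 0) (hex : e ≤ x) :
    ∀ s ∈ Icc 0 t, e ≤ X s := by
  obtain ⟨K, hK⟩ := h.abs_velocity_le_of_fixed hX he
  have := nonneg_of_abs_deriv_le (f := fun s => X s - e) (s₀ := t)
    (fun s hs => (hX.2 s hs).sub_const e) hK ⟨ht, le_rfl⟩ (by rw [hX.1]; linarith)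
  exact fun s hs => by linarith [this s hs]

theorem trajectory_le_fixed (h : IsFlowSolution ω θ u u') {t x e : ℝ} (ht : 0 ≤ t) {X : ℝ → ℝ}
    (hX : IsTrajectory u t x X) (he : ∀ s ∈ Icc 0 t, u s e = 0) (hex : x ≤ e) :
    ∀ s ∈ Icc 0 t, X s ≤ e := by
  obtain ⟨K, hK⟩ := h.abs_velocity_le_of_fixed hX he
  have := nonneg_of_abs_deriv_le (f := fun s => e - X s) (f' := fun s => -u s (X s)) (s₀ := t)
    (K := K) (fun s hs => (hX.2 s hs).const_sub e)
    (fun s hs => by rw [abs_neg, abs_sub_comm]; exact hK s hs) ⟨ht, le_rfl⟩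
    (by rw [hX.1]; linarith)
  exact fun s hs => by linarith [this s hs]

/-- Along a trajectory `θ_x` solves a homogeneous linear equation with bounded coefficient `-u_x`.
-/
theorem temperature_deriv_nonneg (h : IsFlowSolution ω θ u u') {t x : ℝ} (ht : 0 ≤ t) {X : ℝ → ℝ}
    (hX : IsTrajectory u t x X) (h0 : 0 ≤ deriv (θ 0) (X 0)) :
    ∀ s ∈ Icc 0 t, 0 ≤ deriv (θ s) (X s) := by
  obtain ⟨K, hK⟩ := h.abs_velocity_deriv_le hX
  refine nonneg_of_abs_deriv_le (f := fun s => deriv (θ s) (X s)) (K := K)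
    (fun s hs => h.temperature_deriv_along hX hs) (fun s hs => ?_) ⟨le_rfl, ht⟩ h0
  rw [abs_neg, abs_mul]
  exact mul_le_mul_of_nonneg_right (hK s hs) (abs_nonneg _)

/-- Signs propagate on a set that is invariant under backward trajectories. -/
theorem nonneg_of_invariant (h : IsFlowSolution ω θ u u') {D : Set ℝ} {t : ℝ} (ht : 0 ≤ t)
    (hD : ∀ x ∈ D, ∀ X, IsTrajectory u t x X → ∀ s ∈ Icc 0 t, X s ∈ D)
    (hθ : ∀ x ∈ D, 0 ≤ deriv (θ 0) x) (hω : ∀ x ∈ D, 0 ≤ ω 0 x) :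
    ∀ x ∈ D, 0 ≤ deriv (θ t) x ∧ 0 ≤ ω t x := by
  intro x hx
  obtain ⟨X, hX⟩ := h.exists_trajectory t ht x
  have h0 := hD x hx X hX 0 ⟨le_rfl, ht⟩
  have h1 := h.temperature_deriv_nonneg ht hX (hθ _ h0)
  have h2 := h1 t ⟨ht, le_rfl⟩
  have h3 := (le_of_hasDerivWithinAt_nonneg (f := fun s => ω s (X s)) ht
    (fun s hs => h.vorticity_along hX hs) h1 ⟨le_rfl, ht⟩).2
  rw [hX.1] at h2 h3
  exact ⟨h2, (hω _ h0).trans h3⟩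

end IsFlowSolution

/-! ### Blow-up profiles and potentials obtained from solutions -/

/-- Compactness bounds `ω_x` and `θ_xx` on `[0, T] × [-b, b]`. The vanishing orders follow by
integrating these bounds from the zeros at the origin. -/
theorem exists_isBlowupProfile {ω θ : ℝ → ℝ → ℝ} {T b : ℝ} (hb : 0 < b) (hω : SmoothST ω)
    (hθ : SmoothST θ)
    (h0 : ∀ t ∈ Icc 0 T, θ t 0 = 0 ∧ deriv (θ t) 0 = 0 ∧ ω t 0 = 0 ∧ ω t b = 0)
    (hs : ∀ t ∈ Icc 0 T, ∀ x ∈ Icc 0 b, 0 ≤ deriv (θ t) x ∧ 0 ≤ ω t x) :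
    ∃ M, ∀ t ∈ Icc 0 T, IsBlowupProfile b M (θ t) (deriv (θ t)) (ω t) (deriv (ω t)) := by
  obtain ⟨M₁, hM₁, h₁⟩ := hω.deriv.bounded T b
  obtain ⟨M₂, hM₂, h₂⟩ := hθ.deriv.deriv.bounded T b
  refine ⟨M₁ + M₂, fun t ht => ?_⟩
  obtain ⟨z1, z2, z3, z4⟩ := h0 t ht
  have lin : ∀ {f f' : ℝ → ℝ} {C x : ℝ}, (∀ y, HasDerivAt f (f' y) y) → f 0 = 0 → x ∈ Icc 0 b →
      (∀ y ∈ Icc 0 x, |f' y| ≤ C) → f x ≤ C * x := by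
    intro f f' C x hf hf0 hx hC
    have := norm_image_sub_le_of_norm_deriv_le_segment' (f := f) (f' := f') (C := C) (a := 0)
      (b := x) (fun y _ => (hf y).hasDerivWithinAt) (fun y hy => hC y ⟨hy.1, hy.2.le⟩) x
      ⟨hx.1, le_rfl⟩
    rw [hf0, sub_zero, sub_zero] at this
    exact (le_abs_self _).trans this
  have mem : ∀ {x y : ℝ}, x ∈ Icc 0 b → y ∈ Icc 0 x → y ∈ Icc (-b) b := fun hx hy =>
    ⟨by linarith [hy.1], hy.2.trans hx.2⟩
  have hθ' : ∀ x ∈ Icc 0 b, deriv (θ t) x ≤ (M₁ + M₂) * x := fun x hx =>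
    lin (fun y => hθ.deriv.hasDerivAt ht.1 y) z2 hx
      (fun y hy => (h₂ t ht y (mem hx hy)).trans (by linarith))
  refine ⟨hθ.hasDerivAt ht.1, hω.hasDerivAt ht.1, hθ.deriv.continuous_slice ht.1,
    hω.deriv.continuous_slice ht.1, z1, z4, fun x hx => (hs t ht x hx).1,
    fun x hx => (hs t ht x hx).2, fun x hx => ?_, hθ', fun x hx => ?_, fun x hx => ?_⟩
  · have := lin (C := (M₁ + M₂) * x) (hθ.hasDerivAt ht.1) z1 hx (fun y hy => ?_)
    · rwa [mul_assoc, ← sq] at this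
    · have hy' : y ∈ Icc 0 b := ⟨hy.1, hy.2.trans hx.2⟩
      rw [abs_of_nonneg (hs t ht y hy').1]
      exact (hθ' y hy').trans (mul_le_mul_of_nonneg_left hy.2 (by positivity))
  · exact lin (hω.hasDerivAt ht.1) z3 hx
      (fun y hy => (h₁ t ht y (mem hx hy)).trans (by linarith))
  · exact (h₁ t ht x ⟨by linarith [hx.1], hx.2⟩).trans (by linarith)

/-- The identity `hφ` links weight and velocity: for odd vorticity the kernel folded to `(0, b)`
must be a function of `φ x` and `φ y` alone. Since `Real.log` ignores the sign of its argument, `l`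
can be used at negative arguments. -/
theorem isLogPotential_of_kernel {b M : ℝ} {φ w l v : ℝ → ℝ} (hb : 0 < b) (hw : Continuous w)
    (hl₁ : ∀ x, IntervalIntegrable (fun y => l (x - y)) volume 0 b)
    (hl₂ : ∀ x, IntervalIntegrable (fun y => l (x + y)) volume 0 b)
    (hφ : ∀ x ∈ Ioo 0 b, ∀ y ∈ Ioo 0 b, x ≠ y → logKer 0 (φ x) (φ y) = l (x + y) - l (x - y))
    (hv : ContinuousOn v (Ioo 0 b)) (hM : ∀ x ∈ Ioo 0 b, |v x| ≤ M)
    (hvl : ∀ x ∈ Ioo 0 b, v x = 1 / Real.pi * ∫ y in (0 : ℝ)..b, w y * (l (x - y) - l (x + y))) :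
    IsLogPotential b (Real.pi * M) φ w (fun x => -(Real.pi * v x)) := by
  have hae : ∀ x ∈ Ioo 0 b, (fun y => w y * (l (x + y) - l (x - y))) =ᵐ[volume.restrict (Ioo 0 b)]
      fun y => w y * logKer 0 (φ x) (φ y) := by
    intro x hx
    have hne : ∀ᵐ y ∂(volume.restrict (Ioo 0 b)), y ≠ x := Measure.ae_ne _ x
    filter_upwards [hne, ae_restrict_mem measurableSet_Ioo] with y hy hyb
    rw [hφ x hx y hyb hy.symm]
  have hint : ∀ x, IntegrableOn (fun y => w y * (l (x + y) - l (x - y))) (Ioo 0 b) := fun x =>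
    (intervalIntegrable_iff_integrableOn_Ioo_of_le hb.le).1
      (((hl₂ x).sub (hl₁ x)).continuousOn_mul hw.continuousOn)
  refine ⟨(continuousOn_const.mul hv).neg, fun x hx => ?_, fun x hx => (hint x).congr (hae x hx),
    fun x hx => ?_⟩
  · rw [abs_neg, abs_mul, abs_of_pos Real.pi_pos]
    exact mul_le_mul_of_nonneg_left (hM x hx) Real.pi_pos.le
  · rw [← integral_congr_ae (hae x hx), hvl x hx, intervalIntegral.integral_of_le hb.le,
      integral_Ioc_eq_integral_Ioo, ← integral_const_mul, ← integral_const_mul, ← integral_neg]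
    congr 1
    ext y
    field_simp
    ring

/-! ### The circle -/

theorem periodic_deriv {f : ℝ → ℝ} {L : ℝ} (hf : Periodic f L) : Periodic (deriv f) L := fun x => by
  rw [← deriv_comp_add_const, show (fun y => f (y + L)) = f from funext hf]

theorem SmoothST.bounded_of_periodic {f : ℝ → ℝ → ℝ} (hf : SmoothST f) {L : ℝ} (hL : 0 < L)
    (hp : ∀ t, 0 ≤ t → Periodic (f t) L) (T : ℝ) :
    ∃ M, 0 ≤ M ∧ ∀ t ∈ Icc 0 T, ∀ x, |f t x| ≤ M := by
  obtain ⟨M, hM, h⟩ := hf.bounded T L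
  refine ⟨M, hM, fun t ht x => ?_⟩
  obtain ⟨y, hy, hxy⟩ := (hp t ht.1).exists_mem_Ico₀ hL x
  rw [hxy]
  exact h t ht y ⟨by linarith [hy.1], hy.2.le⟩

/-- The kernel of `circleVelocity`. -/
noncomputable def circleKernel (L z : ℝ) : ℝ := 1 / Real.pi * Real.log (Real.sin (Real.pi / L * z))

/-- The derivative of `circleKernel`. -/
noncomputable def circleKernelDeriv (L z : ℝ) : ℝ :=
  1 / L * (Real.cos (Real.pi / L * z) / Real.sin (Real.pi / L * z))

section

variable {L : ℝ}

theorem two_div_mul_le_sin (hL : 0 < L) {z : ℝ} (hz : z ∈ Ioc 0 (L / 2)) :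
    2 / L * z ≤ Real.sin (Real.pi / L * z) := by
  have hpi := Real.pi_pos
  have h := Real.mul_le_sin (x := Real.pi / L * z) (mul_nonneg (by positivity) hz.1.le) ?_
  · refine le_trans (le_of_eq ?_) h
    field_simp
  · calc Real.pi / L * z ≤ Real.pi / L * (L / 2) :=
        mul_le_mul_of_nonneg_left hz.2 (by positivity)
      _ = Real.pi / 2 := by field_simp

theorem logKernel_circle (hL : 0 < L) :
    LogKernel (L / 2) 1 (circleKernel L) (circleKernelDeriv L) := by
  have hpi := Real.pi_pos
  have hs : ∀ z ∈ Ioc 0 (L / 2), 0 < Real.sin (Real.pi / L * z) := fun z hz =>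
    lt_of_lt_of_le (mul_pos (by positivity) hz.1) (two_div_mul_le_sin hL hz)
  refine ⟨by positivity, zero_le_one, fun z hz => ?_, fun z hz => ?_, fun z hz => ?_, ?_⟩
  · have h1 := hs z hz
    have h2 : Real.log (Real.sin (Real.pi / L * z)) ≤ 0 :=
      Real.log_nonpos h1.le (Real.sin_le_one _)
    have h3 : Real.log (2 / L * z) ≤ Real.log (Real.sin (Real.pi / L * z)) :=
      Real.log_le_log (mul_pos (by positivity) hz.1) (two_div_mul_le_sin hL hz)
    have h4 : Real.log (L / 2 / z) = -Real.log (2 / L * z) := by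
      rw [← Real.log_inv]
      congr 1
      have := hz.1.ne'
      field_simp
    have h5 : 1 / Real.pi ≤ 1 := by
      rw [div_le_one hpi]
      linarith [Real.two_le_pi]
    unfold circleKernel
    rw [abs_mul, abs_of_pos (by positivity), abs_of_nonpos h2, h4]
    nlinarith
  · unfold circleKernel circleKernelDeriv
    have h1 : HasDerivAt (fun z => Real.pi / L * z) (Real.pi / L) z := by
      simpa using (hasDerivAt_id z).const_mul (Real.pi / L)
    refine ((h1.sin.log (hs z hz).ne').const_mul (1 / Real.pi)).congr_deriv ?_
    field_simp
  · have h1 := hs z hz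
    have h2 := two_div_mul_le_sin hL hz
    have hz0 := hz.1
    unfold circleKernelDeriv
    rw [abs_mul, abs_div (Real.cos _), abs_of_pos h1, abs_of_pos (show 0 < 1 / L by positivity)]
    have h3 : |Real.cos (Real.pi / L * z)| / Real.sin (Real.pi / L * z) ≤ 1 / (2 / L * z) :=
      div_le_div₀ zero_le_one (Real.abs_cos_le_one _) (by positivity) h2
    calc 1 / L * (|Real.cos (Real.pi / L * z)| / Real.sin (Real.pi / L * z))
        ≤ 1 / L * (1 / (2 / L * z)) := mul_le_mul_of_nonneg_left h3 (by positivity)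
      _ = 1 / 2 * (1 / z) := by field_simp
      _ ≤ 1 / z := by
        have : 0 < 1 / z := by positivity
        linarith
  · unfold circleKernelDeriv
    exact continuousOn_const.mul (ContinuousOn.div (by fun_prop) (by fun_prop)
      fun z hz => (hs z hz).ne')

theorem intervalIntegrable_circleLog (hL : 0 < L) (a b : ℝ) :
    IntervalIntegrable (fun z => Real.log (Real.sin (Real.pi / L * z))) volume a b := by
  have hc : Real.pi / L ≠ 0 := by positivity
  have h : IntervalIntegrable (Real.log ∘ Real.sin) volume (Real.pi / L * a) (Real.pi / L * b) :=
    intervalIntegrable_log_sin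
  have := h.comp_mul_left (c := Real.pi / L)
  simpa [hc] using this

theorem circleLog_neg (z : ℝ) :
    Real.log (Real.sin (Real.pi / L * -z)) = Real.log (Real.sin (Real.pi / L * z)) := by
  rw [mul_neg, Real.sin_neg, Real.log_neg_eq_log]

theorem circleLog_periodic (hL : 0 < L) :
    Periodic (fun z => Real.log (Real.sin (Real.pi / L * z))) L := fun z => by
  dsimp only
  rw [mul_add, div_mul_cancel₀ _ hL.ne', Real.sin_add_pi, Real.log_neg_eq_log]

theorem integral_symm_split {f : ℝ → ℝ} {a : ℝ} (hf : ∀ c d, IntervalIntegrable f volume c d) :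
    ∫ z in (-a)..a, f z = ∫ z in (0 : ℝ)..a, (f z + f (-z)) := by
  have h1 : IntervalIntegrable (fun z => f (-z)) volume 0 a := by
    simpa using (hf 0 (-a)).comp_sub_left 0
  have h2 := intervalIntegral.integral_comp_neg f (a := 0) (b := a)
  rw [neg_zero] at h2
  rw [intervalIntegral.integral_add (hf 0 a) h1, h2, add_comm]
  exact (intervalIntegral.integral_add_adjacent_intervals (hf (-a) 0) (hf 0 a)).symm

/-- By periodicity the integral is moved to `[-L / 2, L / 2]`, centred at the singularity, and
folded. The kernel is even because `Real.log (-x) = Real.log x`. -/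
theorem circleVelocity_eq_evenConv (hL : 0 < L) {w : ℝ → ℝ} (hw : Continuous w)
    (hp : Periodic w L) (x : ℝ) :
    circleVelocity L w x = evenConv (L / 2) (circleKernel L) w x := by
  set g : ℝ → ℝ := fun z => w (x - z) * Real.log (Real.sin (Real.pi / L * z)) with hg
  have hgi : ∀ c d, IntervalIntegrable g volume c d := fun c d =>
    (intervalIntegrable_circleLog hL c d).continuousOn_mul (by fun_prop)
  have hgp : Periodic g L := fun z => by
    simp only [hg]
    have hl := circleLog_periodic hL z
    dsimp only at hl
    rw [hl, ← sub_sub, hp.sub_eq]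
  have h1 : ∫ y in (0 : ℝ)..L, w y * Real.log |Real.sin (Real.pi / L * (x - y))| =
      ∫ y in (0 : ℝ)..L, g (x - y) := by
    congr 1
    ext y
    simp only [hg, Real.log_abs, sub_sub_cancel]
  have h2 : ∫ z in (x - L)..x, g z = ∫ z in (-(L / 2))..(L / 2), g z := by
    have := hgp.intervalIntegral_add_eq (x - L) (-(L / 2))
    rwa [sub_add_cancel, show -(L / 2) + L = L / 2 by ring] at this
  unfold circleVelocity evenConv
  rw [h1, intervalIntegral.integral_comp_sub_left, sub_zero, h2, integral_symm_split hgi,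
    ← intervalIntegral.integral_const_mul]
  congr 1
  ext z
  simp only [hg, circleKernel, circleLog_neg, sub_neg_eq_add]
  ring

theorem circleVelocity_of_odd (hL : 0 < L) {w : ℝ → ℝ} (hw : Continuous w)
    (hp : Periodic w L) (ho : ∀ x, w (-x) = -w x) (x : ℝ) :
    circleVelocity L w x = 1 / Real.pi * ∫ y in (0 : ℝ)..(L / 2),
      w y * (Real.log (Real.sin (Real.pi / L * (x - y))) -
        Real.log (Real.sin (Real.pi / L * (x + y)))) := by
  set g : ℝ → ℝ := fun y => w y * Real.log (Real.sin (Real.pi / L * (x - y))) with hg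
  have hgi : ∀ c d, IntervalIntegrable g volume c d := fun c d => by
    have h := (intervalIntegrable_circleLog hL (x - c) (x - d)).comp_sub_left x
    simp only [sub_sub_cancel] at h
    exact h.continuousOn_mul hw.continuousOn
  have hgp : Periodic g L := fun z => by
    simp only [hg]
    rw [hp z, ← sub_sub]
    congr 1
    exact (circleLog_periodic hL).sub_eq (x - z)
  have h1 : ∫ y in (0 : ℝ)..L, w y * Real.log |Real.sin (Real.pi / L * (x - y))| =
      ∫ y in (0 : ℝ)..L, g y := by
    congr 1
    ext y
    simp only [hg, Real.log_abs]
  have h2 : ∫ z in (0 : ℝ)..L, g z = ∫ z in (-(L / 2))..(L / 2), g z := by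
    have := hgp.intervalIntegral_add_eq 0 (-(L / 2))
    rwa [zero_add, show -(L / 2) + L = L / 2 by ring] at this
  unfold circleVelocity
  rw [h1, h2, integral_symm_split hgi]
  congr 2
  ext y
  simp only [hg, ho, sub_neg_eq_add]
  ring

/-- The weight `cot (π x / L)` on the half circle. -/
theorem isBlowupWeight_circle (hL : 0 < L) :
    IsBlowupWeight (L / 2) (Real.pi / L) (L / 2 + Real.pi / L * (L / 2) ^ 2)
      (fun x => Real.cos (Real.pi / L * x) / Real.sin (Real.pi / L * x))
      (fun x => Real.pi / L / Real.sin (Real.pi / L * x) ^ 2) := by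
  have hpi := Real.pi_pos
  have hs : ∀ z ∈ Ioc 0 (L / 2), 0 < Real.sin (Real.pi / L * z) := fun z hz =>
    lt_of_lt_of_le (mul_pos (by positivity) hz.1) (two_div_mul_le_sin hL hz)
  have hs' : ∀ z ∈ Ioo 0 (L / 2), 0 < Real.sin (Real.pi / L * z) := fun z hz =>
    hs z (Ioo_subset_Ioc_self hz)
  have hlt : ∀ z ∈ Ioo 0 (L / 2), Real.pi / L * z < Real.pi / 2 := fun z hz => by
    calc Real.pi / L * z < Real.pi / L * (L / 2) :=
        mul_lt_mul_of_pos_left hz.2 (by positivity)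
      _ = Real.pi / 2 := by field_simp
  have hp : ∀ z ∈ Ioo 0 (L / 2), 0 < Real.pi / L * z := fun z hz => mul_pos (by positivity) hz.1
  have hc : ∀ z ∈ Ioo 0 (L / 2), 0 < Real.cos (Real.pi / L * z) := fun z hz =>
    Real.cos_pos_of_mem_Ioo ⟨by linarith [hp z hz], hlt z hz⟩
  -- The constant `K` is the sum of the bounds for `φ * x` and `q * x ^ 2` that follow from `sin (π
  -- x / L) ≥ 2 x / L`.
  refine ⟨by positivity, by positivity, by positivity, fun x hx => div_pos (hc x hx) (hs' x hx),
    ?_, ContinuousOn.div (by fun_prop) (by fun_prop) fun z hz => (hs z hz).ne', fun x hx => ?_,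
    ContinuousOn.div (by fun_prop) (by fun_prop) fun z hz => (pow_pos (hs' z hz) 2).ne',
    fun x hx => ?_, fun x hx => ?_, fun x hx => ?_, fun x hx y hy hxy => ?_⟩
  · rw [show Real.pi / L * (L / 2) = Real.pi / 2 by field_simp, Real.cos_pi_div_two, zero_div]
  · have h1 : HasDerivAt (fun z => Real.pi / L * z) (Real.pi / L) x := by
      simpa using (hasDerivAt_id x).const_mul (Real.pi / L)
    refine (h1.cos.div h1.sin (hs' x hx).ne').congr_deriv ?_
    rw [← neg_div]
    congr 1
    have := Real.sin_sq_add_cos_sq (Real.pi / L * x)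
    linear_combination (-(Real.pi / L)) * this
  · rw [div_pow, ← mul_div_assoc]
    have := pow_pos (hs' x hx) 2
    refine div_le_div_of_nonneg_right ?_ this.le
    exact mul_le_of_le_one_right (by positivity) (Real.cos_sq_le_one _)
  · have h1 := two_div_mul_le_sin hL (Ioo_subset_Ioc_self hx)
    have hx0 := hx.1
    calc Real.cos (Real.pi / L * x) / Real.sin (Real.pi / L * x) ≤ 1 / (2 / L * x) :=
          div_le_div₀ zero_le_one (Real.cos_le_one _) (by positivity) h1
      _ = L / 2 / x := by field_simp
      _ ≤ _ := div_le_div_of_nonneg_right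
        (le_add_of_nonneg_right (by positivity)) hx0.le
  · have h1 := two_div_mul_le_sin hL (Ioo_subset_Ioc_self hx)
    have hx0 := hx.1
    calc Real.pi / L / Real.sin (Real.pi / L * x) ^ 2 ≤ Real.pi / L / (2 / L * x) ^ 2 :=
          div_le_div_of_nonneg_left (by positivity) (by positivity)
            (pow_le_pow_left₀ (by positivity) h1 2)
      _ = Real.pi / L * (L / 2) ^ 2 / x ^ 2 := by field_simp
      _ ≤ _ := div_le_div_of_nonneg_right
        (le_add_of_nonneg_left (by positivity)) (by positivity)
  -- Here `q / φ ^ 2 = (π / L) / cos (π x / L) ^ 2`, which increases on `(0, L / 2)`.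
  · have h1 := hs' x hx
    have h2 := hs' y hy
    have h3 : Real.cos (Real.pi / L * x) ≤ Real.cos (Real.pi / L * y) :=
      Real.cos_le_cos_of_nonneg_of_le_pi (hp y hy).le (by linarith [hlt x hx])
        (mul_le_mul_of_nonneg_left hxy.le (by positivity))
    have h4 := pow_le_pow_left₀ (hc x hx).le h3 2
    have e : ∀ p q r : ℝ, Real.pi / L / p * (q / r) = Real.pi / L * q / (p * r) := fun p q r => by
      rw [div_mul_div_comm]
    rw [div_pow, div_pow, e, e, mul_comm (Real.sin (Real.pi / L * x) ^ 2)]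
    exact div_le_div_of_nonneg_right (mul_le_mul_of_nonneg_left h4 (by positivity)) (by positivity)

/-- The numbers `cot p ± cot q` are, up to sign, `sin (p ± q) / (sin p sin q)`, and the common
denominator cancels in the quotient. -/
theorem logKer_cot {L x y : ℝ} (hL : 0 < L) (hx : x ∈ Ioo 0 (L / 2)) (hy : y ∈ Ioo 0 (L / 2))
    (hxy : x ≠ y) :
    logKer 0 (Real.cos (Real.pi / L * x) / Real.sin (Real.pi / L * x))
      (Real.cos (Real.pi / L * y) / Real.sin (Real.pi / L * y)) =
      Real.log (Real.sin (Real.pi / L * (x + y))) - Real.log (Real.sin (Real.pi / L * (x - y))) := by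
  have W := isBlowupWeight_circle hL
  have h1 : 0 < Real.sin (Real.pi / L * x) := lt_of_lt_of_le (mul_pos (by positivity) hx.1)
    (two_div_mul_le_sin hL (Ioo_subset_Ioc_self hx))
  have h2 : 0 < Real.sin (Real.pi / L * y) := lt_of_lt_of_le (mul_pos (by positivity) hy.1)
    (two_div_mul_le_sin hL (Ioo_subset_Ioc_self hy))
  have hF := W.weight_pos x hx
  have hG := W.weight_pos y hy
  have hne := W.ne hx hy hxy
  have ha : Real.cos (Real.pi / L * x) / Real.sin (Real.pi / L * x) +
      Real.cos (Real.pi / L * y) / Real.sin (Real.pi / L * y) =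
      Real.sin (Real.pi / L * (x + y)) /
        (Real.sin (Real.pi / L * x) * Real.sin (Real.pi / L * y)) := by
    rw [div_add_div _ _ h1.ne' h2.ne', mul_add, Real.sin_add]
    congr 1
    ring
  have hs : Real.cos (Real.pi / L * x) / Real.sin (Real.pi / L * x) -
      Real.cos (Real.pi / L * y) / Real.sin (Real.pi / L * y) =
      -(Real.sin (Real.pi / L * (x - y)) /
        (Real.sin (Real.pi / L * x) * Real.sin (Real.pi / L * y))) := by
    rw [div_sub_div _ _ h1.ne' h2.ne', mul_sub, Real.sin_sub, ← neg_div]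
    congr 1
    ring
  have hpos := add_pos hF hG
  have hsub := sub_ne_zero.2 hne
  rw [logKer_zero hF hG hne, Real.log_abs, Real.log_abs]
  rw [ha] at hpos ⊢
  rw [hs] at hsub ⊢
  have h3 : Real.sin (Real.pi / L * (x + y)) ≠ 0 := fun h => by simp [h] at hpos
  have h4 : Real.sin (Real.pi / L * (x - y)) ≠ 0 := fun h => by simp [h] at hsub
  rw [Real.log_neg_eq_log, Real.log_div h3 (by positivity), Real.log_div h4 (by positivity)]
  ring

end

theorem abs_sub_le_of_hasDerivAt {f f' : ℝ → ℝ} {s : Set ℝ} {K : ℝ} (hs : Convex ℝ s)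
    (hf : ∀ x ∈ s, HasDerivAt f (f' x) x) (hK : ∀ x ∈ s, |f' x| ≤ K) :
    ∀ y ∈ s, ∀ z ∈ s, |f y - f z| ≤ K * |y - z| := fun _ hy _ hz =>
  hs.norm_image_sub_le_of_norm_hasDerivWithin_le (fun x hx => (hf x hx).hasDerivWithinAt) hK hz hy

namespace IsCircleSolution

variable {L : ℝ} {ω₀ θ₀ : ℝ → ℝ} {ω θ : ℝ → ℝ → ℝ}

theorem velocity_eq (h : IsCircleSolution L ω₀ θ₀ ω θ) (hL : 0 < L) {t : ℝ} (ht : 0 ≤ t) :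
    circleVelocity L (ω t) = evenConv (L / 2) (circleKernel L) (ω t) :=
  funext fun x => circleVelocity_eq_evenConv hL (SmoothST.continuous_slice h.smooth_vorticity ht)
    (h.periodic_vorticity t ht) x

theorem isFlowSolution (h : IsCircleSolution L ω₀ θ₀ ω θ) (hL : 0 < L) :
    IsFlowSolution ω θ (fun t => circleVelocity L (ω t))
      (fun t => evenConv (L / 2) (circleKernel L) (deriv (ω t))) := by
  have hk := logKernel_circle hL
  have hω : SmoothST ω := h.smooth_vorticity
  have hder : ∀ t, 0 ≤ t → ∀ x, HasDerivAt (circleVelocity L (ω t))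
      (evenConv (L / 2) (circleKernel L) (deriv (ω t)) x) x := fun t ht x => by
    rw [h.velocity_eq hL ht]
    exact hk.hasDerivAt_evenConv (hω.hasDerivAt ht) (hω.deriv.continuous_slice ht) x
  have hlip : ∀ T, ∃ K : ℝ, ∀ s ∈ Icc 0 T, ∀ y z,
      |circleVelocity L (ω s) y - circleVelocity L (ω s) z| ≤ K * |y - z| := by
    intro T
    obtain ⟨M, -, hM⟩ := hω.deriv.bounded_of_periodic hL
      (fun t ht => periodic_deriv (h.periodic_vorticity t ht)) T
    exact ⟨8 * 1 * (L / 2) * M, fun s hs y z => abs_sub_le_of_hasDerivAt convex_univ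
      (fun x _ => hder s hs.1 x) (fun x _ => hk.abs_evenConv_le (hM s hs)) y trivial z trivial⟩
  refine ⟨hω, h.smooth_temperature, h.vorticity_eq, h.temperature_eq, hder, fun t ht x => ?_,
    fun T R => ?_⟩
  · refine exists_trajectory ht x (fun y => ?_) (fun R => ?_) ?_
    · exact ((hk.continuousOn_evenConv_time hω y).mono fun s hs => hs.1).congr
        fun s hs => congrFun (h.velocity_eq hL hs.1) y
    · obtain ⟨K, hK⟩ := hlip t
      exact ⟨K, fun s hs y _ z _ => hK s hs y z⟩
    · obtain ⟨M, hM0, hM⟩ := hω.bounded_of_periodic hL h.periodic_vorticity t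
      refine ⟨8 * 1 * (L / 2) * M, fun s hs y => ?_⟩
      rw [h.velocity_eq hL hs.1]
      refine (hk.abs_evenConv_le (hM s hs)).trans (le_mul_of_one_le_right (by positivity) ?_)
      linarith [Real.log_nonneg (show 1 ≤ 2 + |y| by linarith [abs_nonneg y])]
  · obtain ⟨K, hK⟩ := hlip T
    exact ⟨K, fun s hs y _ z _ => hK s hs y z⟩

theorem exists_hasLocalKernel (h : IsCircleSolution L ω₀ θ₀ ω θ) (hL : 0 < L) (T : ℝ) :
    ∃ M, HasLocalKernel T M (L / 2) (circleKernel L) univ ω θ (fun t => circleVelocity L (ω t))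
      (fun t => evenConv (L / 2) (circleKernel L) (deriv (ω t))) := by
  have hω : SmoothST ω := h.smooth_vorticity
  have hθ : SmoothST θ := h.smooth_temperature
  obtain ⟨M₁, p1, h1⟩ := hω.bounded_of_periodic hL h.periodic_vorticity T
  obtain ⟨M₂, p2, h2⟩ := hω.deriv.bounded_of_periodic hL
    (fun t ht => periodic_deriv (h.periodic_vorticity t ht)) T
  obtain ⟨M₃, p3, h3⟩ := hθ.deriv.bounded_of_periodic hL
    (fun t ht => periodic_deriv (h.periodic_temperature t ht)) T
  obtain ⟨M₄, p4, h4⟩ := hθ.deriv.deriv.bounded_of_periodic hL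
    (fun t ht => periodic_deriv (periodic_deriv (h.periodic_temperature t ht))) T
  refine ⟨M₁ + M₂ + M₃ + M₄, fun t ht x _ => congrFun (h.velocity_eq hL ht.1) x,
    fun t _ x _ => rfl, fun t _ x hx => absurd (mem_univ x) hx, fun t ht x => ⟨?_, ?_, ?_, ?_⟩⟩
  · linarith [h1 t ht x]
  · linarith [h2 t ht x]
  · linarith [h3 t ht x]
  · linarith [h4 t ht x]

theorem odd_even (h : IsCircleSolution L ω₀ θ₀ ω θ) (hL : 0 < L) (hω₀ : ∀ x, ω₀ (-x) = -ω₀ x)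
    (hθ₀ : ∀ x, θ₀ (-x) = θ₀ x) {t : ℝ} (ht : 0 ≤ t) (x : ℝ) :
    ω t (-x) = -ω t x ∧ deriv (θ t) (-x) = -deriv (θ t) x := by
  obtain ⟨M, hl⟩ := h.exists_hasLocalKernel hL t
  exact (h.isFlowSolution hL).odd_even (logKernel_circle hL) hl (fun _ _ => mem_univ _)
    (fun x => by rw [h.initial_vorticity, hω₀]) (fun x => by rw [h.initial_temperature, hθ₀]) t
    ⟨ht, le_rfl⟩ x

end IsCircleSolution

theorem eq_zero_of_odd {r : ℝ} (h : r = -r) : r = 0 := by linarith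

theorem IsFlowSolution.temperature_at_zero {ω θ u u' : ℝ → ℝ → ℝ} (h : IsFlowSolution ω θ u u')
    {t : ℝ} (ht : 0 ≤ t) (h0 : ∀ s ∈ Icc 0 t, deriv (θ s) 0 = 0) : θ t 0 = θ 0 0 :=
  eq_of_hasDerivWithinAt_zero (f := fun s => θ s 0) ht fun s hs =>
    ((h.temperature_eq s hs.1 0).mono fun r hr => hr.1).congr_deriv (by rw [h0 s hs]; ring)

theorem IsBlowupWeight.integral_pos {b m K : ℝ} {φ q θ : ℝ → ℝ} (W : IsBlowupWeight b m K φ q)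
    (hi : IntegrableOn (fun x => θ x * φ x) (Ioo 0 b)) (hθ : ∀ x ∈ Ioo 0 b, 0 < θ x) :
    0 < ∫ x in Ioo 0 b, θ x * φ x := by
  have hp : ∀ x ∈ Ioo 0 b, 0 < θ x * φ x := fun x hx => mul_pos (hθ x hx) (W.weight_pos x hx)
  rw [setIntegral_pos_iff_support_of_nonneg_ae
    ((ae_restrict_iff' measurableSet_Ioo).2 (Eventually.of_forall fun x hx => (hp x hx).le)) hi]
  refine lt_of_lt_of_le (b := volume (Ioo 0 b)) ?_ (measure_mono fun x hx => ⟨(hp x hx).ne', hx⟩)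
  simpa using W.pos

/-- Oddness together with periodicity makes both `0` and `L / 2` stagnation points. The half circle
is thus invariant, and the signs of the data persist on it. -/
theorem not_exists_circleSolution {L : ℝ} (hL : 0 < L) :
    ¬ ∃ ω θ : ℝ → ℝ → ℝ, IsCircleSolution L (fun _ => 0)
      (fun x => 1 - Real.cos (2 * Real.pi / L * x)) ω θ := by
  rintro ⟨ω, θ, h⟩
  have hpi := Real.pi_pos
  have hb : 0 < L / 2 := by positivity
  have W := isBlowupWeight_circle hL
  have F := h.isFlowSolution hL
  have hω : SmoothST ω := h.smooth_vorticity
  have hθ : SmoothST θ := h.smooth_temperature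
  have hsymm := fun (t : ℝ) (ht : 0 ≤ t) (x : ℝ) => h.odd_even hL (by simp) (by simp) ht x
  have hu_odd : ∀ t, 0 ≤ t → ∀ x, circleVelocity L (ω t) (-x) = -circleVelocity L (ω t) x := by
    intro t ht x
    rw [h.velocity_eq hL ht, ← evenConv_reflect, ← evenConv_neg]
    congr 1
    ext y
    exact (hsymm t ht y).1
  have hu_per : ∀ t, 0 ≤ t → Periodic (circleVelocity L (ω t)) L := by
    intro t ht x
    rw [h.velocity_eq hL ht]
    unfold evenConv
    congr 1
    ext z
    rw [add_sub_right_comm, add_right_comm, h.periodic_vorticity t ht, h.periodic_vorticity t ht]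
  have hend : ∀ f : ℝ → ℝ, Periodic f L → (∀ x, f (-x) = -f x) → f (L / 2) = 0 := by
    intro f hp ho
    refine eq_zero_of_odd ?_
    rw [← ho, ← hp (-(L / 2))]
    congr 1
    ring
  have hzero : ∀ f : ℝ → ℝ, (∀ x, f (-x) = -f x) → f 0 = 0 := fun f ho =>
    eq_zero_of_odd (by simpa using ho 0)
  have hθ0' : ∀ x, deriv (θ 0) x = 2 * Real.pi / L * Real.sin (2 * Real.pi / L * x) := by
    intro x
    rw [h.initial_temperature]
    have h1 : HasDerivAt (fun z => 2 * Real.pi / L * z) (2 * Real.pi / L) x := by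
      simpa using (hasDerivAt_id x).const_mul (2 * Real.pi / L)
    rw [(h1.cos.const_sub 1).deriv]
    ring
  have harg : ∀ x ∈ Icc 0 (L / 2), 2 * Real.pi / L * x ∈ Icc 0 Real.pi := by
    intro x hx
    refine ⟨mul_nonneg (by positivity) hx.1, ?_⟩
    calc 2 * Real.pi / L * x ≤ 2 * Real.pi / L * (L / 2) :=
        mul_le_mul_of_nonneg_left hx.2 (by positivity)
      _ = Real.pi := by field_simp
  have hsign : ∀ t, 0 ≤ t → ∀ x ∈ Icc 0 (L / 2), 0 ≤ deriv (θ t) x ∧ 0 ≤ ω t x := by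
    intro t ht
    refine F.nonneg_of_invariant ht (fun x hx X hX s hs => ⟨?_, ?_⟩) (fun x hx => ?_)
      (fun x _ => by rw [h.initial_vorticity])
    · exact F.fixed_le_trajectory ht hX (fun r hr => hzero _ (hu_odd r hr.1)) hx.1 s hs
    · exact F.trajectory_le_fixed ht hX
        (fun r hr => hend _ (hu_per r hr.1) (hu_odd r hr.1)) hx.2 s hs
    · rw [hθ0']
      exact mul_nonneg (by positivity)
        (Real.sin_nonneg_of_nonneg_of_le_pi (harg x hx).1 (harg x hx).2)
  have hz : ∀ t, 0 ≤ t → θ t 0 = 0 ∧ deriv (θ t) 0 = 0 ∧ ω t 0 = 0 ∧ ω t (L / 2) = 0 := by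
    intro t ht
    refine ⟨?_, hzero _ fun x => (hsymm t ht x).2, hzero _ fun x => (hsymm t ht x).1,
      hend _ (h.periodic_vorticity t ht) fun x => (hsymm t ht x).1⟩
    rw [F.temperature_at_zero ht fun s hs => hzero _ fun x => (hsymm s hs.1 x).2,
      h.initial_temperature]
    simp
  set I₀ := ∫ x in Ioo 0 (L / 2), θ 0 x *
    (Real.cos (Real.pi / L * x) / Real.sin (Real.pi / L * x)) with hI₀
  set T := 4 * (1 + 1 / (2 / Real.pi * (Real.pi / L / (2 * (L / 2))) / 2 * I₀)) with hT
  -- With `max T 0` the initial time lies in the interval before `I₀ > 0` is known; that positivity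
  -- itself uses the profile at time `0`.
  obtain ⟨M, hM⟩ := exists_isBlowupProfile (T := max T 0) hb hω hθ (fun t ht => hz t ht.1)
    (fun t ht => hsign t ht.1)
  obtain ⟨Mω, -, hMω⟩ := hω.bounded_of_periodic hL h.periodic_vorticity (max T 0)
  refine false_of_blowupProfile W (u := fun t => circleVelocity L (ω t)) hM
    (M' := Real.pi * (8 * 1 * (L / 2) * Mω)) (fun t ht => ?_) (fun t ht => h.vorticity_eq t ht.1)
    (fun t ht => h.temperature_eq t ht.1) ?_ (le_max_left T 0)
  · refine isLogPotential_of_kernel (l := fun z => Real.log (Real.sin (Real.pi / L * z))) hb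
      (hω.continuous_slice ht.1) (fun x => ?_) (fun x => ?_)
      (fun x hx y hy hxy => logKer_cot hL hx hy hxy)
      (fun x _ => (F.hasDerivAt_velocity t ht.1 x).continuousAt.continuousWithinAt)
      (fun x _ => ?_) (fun x _ => circleVelocity_of_odd hL (hω.continuous_slice ht.1)
        (h.periodic_vorticity t ht.1) (fun y => (hsymm t ht.1 y).1) x)
    · have := (intervalIntegrable_circleLog hL x (x - L / 2)).comp_sub_left x
      simpa using this
    · have := (intervalIntegrable_circleLog hL x (x + L / 2)).comp_add_left x
      simpa using this
    · rw [h.velocity_eq hL ht.1]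
      exact (logKernel_circle hL).abs_evenConv_le (hMω t ht)
  · refine W.integral_pos ((hM 0 ⟨le_rfl, le_max_right _ _⟩).integrableOn_temperature_weight W)
      fun x hx => ?_
    rw [h.initial_temperature]
    have hx' := harg x (Ioo_subset_Icc_self hx)
    have hne : 0 < 2 * Real.pi / L * x := mul_pos (by positivity) hx.1
    have := Real.cos_lt_cos_of_nonneg_of_le_pi le_rfl hx'.2 hne
    rw [Real.cos_zero] at this
    linarith

/-! ### The line: logarithmic kernel and compactly supported vorticity -/

/-- The kernel of `lineVelocity`. -/
noncomputable def lineKernel (z : ℝ) : ℝ := 1 / Real.pi * Real.log z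

theorem logKernel_line {a : ℝ} (ha : 0 < a) :
    LogKernel a (1 + |Real.log a|) lineKernel (fun z => 1 / Real.pi * z⁻¹) := by
  have hpi := Real.pi_pos
  have h5 : 1 / Real.pi ≤ 1 := by
    rw [div_le_one hpi]
    linarith [Real.two_le_pi]
  refine ⟨ha, by positivity, fun z hz => ?_, fun z hz => ?_, fun z hz => ?_, ?_⟩
  · have h1 : 0 ≤ Real.log (a / z) := Real.log_nonneg ((one_le_div hz.1).2 hz.2)
    have h2 : Real.log z = Real.log a - Real.log (a / z) := by
      rw [Real.log_div ha.ne' hz.1.ne']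
      ring
    have h3 : |Real.log z| ≤ |Real.log a| + Real.log (a / z) := by
      rw [h2]
      refine (abs_sub _ _).trans ?_
      rw [abs_of_nonneg h1]
    unfold lineKernel
    rw [abs_mul, abs_of_pos (by positivity)]
    nlinarith [mul_nonneg (abs_nonneg (Real.log a)) h1, abs_nonneg (Real.log z)]
  · exact (Real.hasDerivAt_log hz.1.ne').const_mul _
  · have hz0 := hz.1
    rw [abs_of_pos (by positivity), div_eq_mul_inv _ z]
    exact mul_le_mul_of_nonneg_right (h5.trans (le_add_of_nonneg_right (abs_nonneg _)))
      (by positivity)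
  · exact continuousOn_const.mul (continuousOn_inv₀.mono fun z hz => hz.1.ne')

theorem intervalIntegrable_comp_mul_log {w : ℝ → ℝ} (hw : Continuous w) (x c d : ℝ) :
    IntervalIntegrable (fun z => w (x - z) * Real.log z) volume c d :=
  intervalIntegral.intervalIntegrable_log'.continuousOn_mul (by fun_prop)

/-- An integral over the line that agrees with a truncated logarithmic convolution. -/
theorem integral_eq_evenConv {a x : ℝ} {w F : ℝ → ℝ} (ha : 0 < a) (hw : Continuous w)
    (hF : ∀ z ∈ Ioc (-a) a, F z = w (x - z) * Real.log z) (hF' : ∀ z, z ∉ Ioc (-a) a → F z = 0) :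
    Integrable F ∧ 1 / Real.pi * ∫ z, F z = evenConv a lineKernel w x := by
  have haa : -a ≤ a := by linarith
  constructor
  · rw [← integrableOn_iff_integrable_of_support_subset (s := Ioc (-a) a)
      fun z hz => by_contra fun h => hz (hF' z h)]
    exact ((intervalIntegrable_iff_integrableOn_Ioc_of_le haa).1
      (intervalIntegrable_comp_mul_log hw x (-a) a)).congr_fun (fun z hz => (hF z hz).symm)
      measurableSet_Ioc
  · rw [← setIntegral_eq_integral_of_forall_compl_eq_zero (s := Ioc (-a) a) fun z hz => hF' z hz,
      setIntegral_congr_fun measurableSet_Ioc hF, ← intervalIntegral.integral_of_le haa,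
      integral_symm_split (intervalIntegrable_comp_mul_log hw x),
      ← intervalIntegral.integral_const_mul]
    unfold evenConv lineKernel
    congr 1
    ext z
    rw [Real.log_neg_eq_log, sub_neg_eq_add]
    ring

theorem lineVelocity_eq_evenConv {a R x : ℝ} {w : ℝ → ℝ} (hw : Continuous w)
    (hR : ∀ y, R < |y| → w y = 0) (ha : 0 < a) (hx : |x| + R < a) :
    lineVelocity w x = evenConv a lineKernel w x := by
  unfold lineVelocity
  rw [← (integral_eq_evenConv (F := fun z => w (x - z) * Real.log z) ha hw
    (fun z _ => rfl) fun z hz => ?_).2,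
    ← integral_sub_left_eq_self (fun z => w z * Real.log |x - z|) volume x]
  · simp only [sub_sub_cancel, Real.log_abs]
  · have : a ≤ |z| := by
      by_contra! h
      exact hz ⟨(abs_lt.1 h).1, (abs_lt.1 h).2.le⟩
    rw [hR, zero_mul]
    rw [abs_sub_comm]
    linarith [abs_sub_abs_le_abs_sub z x]

theorem eq_zero_of_forall_gt {w : ℝ → ℝ} {R : ℝ} (hw : Continuous w) (hR : ∀ y, R < y → w y = 0) :
    w R = 0 := by
  have hc : ContinuousWithinAt w (Ioi R) R := hw.continuousWithinAt
  have : Tendsto w (𝓝[>] R) (𝓝 0) := tendsto_const_nhds.congr' <| by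
    filter_upwards [self_mem_nhdsWithin] with z hz
    exact (hR z hz).symm
  exact tendsto_nhds_unique hc this

theorem lineVelocity_reflect {w : ℝ → ℝ} (ho : ∀ y, w (-y) = -w y) (x : ℝ) :
    lineVelocity w (-x) = -lineVelocity w x := by
  unfold lineVelocity
  rw [← integral_neg_eq_self, ← mul_neg, ← integral_neg]
  congr 2
  ext y
  rw [ho, ← neg_sub', abs_neg, neg_mul]

theorem lineVelocity_of_odd {R : ℝ} {w : ℝ → ℝ} (hw : Continuous w) (hR0 : 0 ≤ R)
    (hR : ∀ y, R < |y| → w y = 0) (ho : ∀ y, w (-y) = -w y) (x : ℝ) :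
    lineVelocity w x = 1 / Real.pi * ∫ y in (0 : ℝ)..R,
      w y * (Real.log (x - y) - Real.log (x + y)) := by
  have hi : ∀ c d, IntervalIntegrable (fun y => w y * Real.log (x - y)) volume c d := fun c d => by
    have h := (intervalIntegrable_comp_mul_log (w := w) hw x (x - c) (x - d)).comp_sub_left x
    simpa using h
  unfold lineVelocity
  simp only [Real.log_abs]
  rw [← setIntegral_eq_integral_of_forall_compl_eq_zero (s := Ioc (-R) R), ←
    intervalIntegral.integral_of_le (by linarith), integral_symm_split hi]
  · congr 2
    ext y
    rw [ho, sub_neg_eq_add]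
    ring
  · intro y hy
    by_cases h : R < |y|
    · rw [hR y h, zero_mul]
    · have h1 := abs_le.1 (not_lt.1 h)
      have h2 : y = -R := by
        by_contra h3
        exact hy ⟨lt_of_le_of_ne h1.1 (Ne.symm h3), h1.2⟩
      rw [h2, ho, eq_zero_of_forall_gt hw fun z hz => hR z (hz.trans_le (le_abs_self z))]
      simp

/-! ### The line: near and far parts of the velocity under logarithmic decay -/

section

theorem log_max_one_nonneg (z : ℝ) : 0 ≤ Real.log (max 1 |z|) := Real.log_nonneg (le_max_left _ _)

theorem log_max_one_sub_le (x y : ℝ) :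
    Real.log (max 1 |x - y|) ≤ Real.log (2 + |x|) + Real.log (2 + |y|) := by
  have hx := abs_nonneg x
  have hy := abs_nonneg y
  rw [← Real.log_mul (by positivity) (by positivity)]
  refine Real.log_le_log (by positivity) (max_le ?_ ((abs_sub _ _).trans ?_)) <;> nlinarith

/-- Cutting the logarithm off at distance one makes it Lipschitz with constant `1`. So the far
velocity is Lipschitz without any information on `ω_x` at infinity. -/
theorem abs_log_max_one_sub_le (x y : ℝ) :
    |Real.log (max 1 |x|) - Real.log (max 1 |y|)| ≤ |x - y| := by
  have key : ∀ p q : ℝ, 1 ≤ p → 1 ≤ q → Real.log p - Real.log q ≤ |p - q| := by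
    intro p q hp hq
    have hq0 : 0 < q := by linarith
    rw [← Real.log_div (by positivity) (by positivity)]
    calc Real.log (p / q) ≤ p / q - 1 := Real.log_le_sub_one_of_pos (by positivity)
      _ = (p - q) / q := by field_simp
      _ ≤ |p - q| / q := by gcongr; exact le_abs_self _
      _ ≤ |p - q| := div_le_self (abs_nonneg _) hq
  have h1 : |max 1 (|x|) - max 1 (|y|)| ≤ |x - y| := by
    have := abs_max_sub_max_le_abs |x| |y| 1
    rw [max_comm 1, max_comm 1]
    exact this.trans (abs_abs_sub_abs_le x y)
  refine le_trans (abs_le.2 ⟨?_, key _ _ (le_max_left _ _) (le_max_left _ _)⟩) h1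
  have := key (max 1 |y|) (max 1 |x|) (le_max_left _ _) (le_max_left _ _)
  rw [abs_sub_comm] at this
  linarith

theorem continuous_log_max_one : Continuous fun z : ℝ => Real.log (max 1 |z|) :=
  Continuous.log (by fun_prop) fun z => (lt_of_lt_of_le one_pos (le_max_left _ _)).ne'

/-- A function that is integrable against the logarithmic weight. -/
structure IsLogMajorant (g : ℝ → ℝ) : Prop where
  integrable : Integrable g
  integrable_log : Integrable fun y => g y * Real.log (2 + |y|)

/-- The contribution of distances larger than one to `lineVelocity`. -/
noncomputable def farVelocity (w : ℝ → ℝ) (x : ℝ) : ℝ :=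
  1 / Real.pi * ∫ y, w y * Real.log (max 1 |x - y|)

variable {g w : ℝ → ℝ}

theorem IsLogMajorant.integrable_mul (hg : IsLogMajorant g) (x : ℝ) :
    Integrable fun y => g y * (Real.log (2 + |x|) + Real.log (2 + |y|)) := by
  simp only [mul_add]
  exact (hg.integrable.mul_const _).add hg.integrable_log

theorem abs_mul_log_max_one_le (hwg : ∀ y, |w y| ≤ g y) (x y : ℝ) :
    |w y * Real.log (max 1 |x - y|)| ≤ g y * (Real.log (2 + |x|) + Real.log (2 + |y|)) := by
  rw [abs_mul, abs_of_nonneg (log_max_one_nonneg _)]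
  exact mul_le_mul (hwg y) (log_max_one_sub_le x y) (log_max_one_nonneg _)
    ((abs_nonneg _).trans (hwg y))

theorem IsLogMajorant.integrable_far (hg : IsLogMajorant g) (hw : Continuous w)
    (hwg : ∀ y, |w y| ≤ g y) (x : ℝ) : Integrable fun y => w y * Real.log (max 1 |x - y|) :=
  (hg.integrable_mul x).mono' (Continuous.aestronglyMeasurable
    (hw.mul (continuous_log_max_one.comp (by fun_prop))))
    (Eventually.of_forall fun y => abs_mul_log_max_one_le hwg x y)

theorem IsLogMajorant.abs_farVelocity_le (hg : IsLogMajorant g)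
    (hwg : ∀ y, |w y| ≤ g y) (x : ℝ) :
    |farVelocity w x| ≤ 1 / Real.pi * ((∫ y, g y) * Real.log (2 + |x|) +
      ∫ y, g y * Real.log (2 + |y|)) := by
  have hpi := Real.pi_pos
  unfold farVelocity
  rw [abs_mul, abs_of_pos (by positivity), ← integral_mul_const,
    ← integral_add (hg.integrable.mul_const _) hg.integrable_log]
  refine mul_le_mul_of_nonneg_left ?_ (by positivity)
  simp only [← mul_add]
  exact norm_integral_le_of_norm_le (f := fun y => w y * Real.log (max 1 |x - y|))
    (hg.integrable_mul x)
    (Eventually.of_forall fun y => abs_mul_log_max_one_le hwg x y)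

theorem IsLogMajorant.abs_farVelocity_sub_le (hg : IsLogMajorant g) (hw : Continuous w)
    (hwg : ∀ y, |w y| ≤ g y) (x z : ℝ) :
    |farVelocity w x - farVelocity w z| ≤ 1 / Real.pi * (∫ y, g y) * |x - z| := by
  have hpi := Real.pi_pos
  unfold farVelocity
  rw [← mul_sub, abs_mul, abs_of_pos (by positivity), mul_assoc, ← integral_mul_const,
    ← integral_sub (hg.integrable_far hw hwg x) (hg.integrable_far hw hwg z)]
  refine mul_le_mul_of_nonneg_left ?_ (by positivity)
  refine norm_integral_le_of_norm_le (f := fun y => w y * Real.log (max 1 |x - y|) -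
    w y * Real.log (max 1 |z - y|)) (hg.integrable.mul_const _) (Eventually.of_forall fun y => ?_)
  rw [Real.norm_eq_abs, ← mul_sub, abs_mul]
  refine mul_le_mul (hwg y) ?_ (abs_nonneg _) ((abs_nonneg _).trans (hwg y))
  simpa using abs_log_max_one_sub_le (x - y) (z - y)

theorem IsLogMajorant.continuousOn_farVelocity_time {f : ℝ → ℝ → ℝ} {T : ℝ}
    (hg : IsLogMajorant g) (hf : SmoothST f) (hfg : ∀ t ∈ Icc 0 T, ∀ y, |f t y| ≤ g y) (x : ℝ) :
    ContinuousOn (fun t => farVelocity (f t) x) (Icc 0 T) := by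
  refine continuousOn_const.mul (continuousOn_of_dominated
    (bound := fun y => g y * (Real.log (2 + |x|) + Real.log (2 + |y|)))
    (fun t ht => (hg.integrable_far (hf.continuous_slice ht.1) (hfg t ht) x).aestronglyMeasurable)
    (fun t ht => Eventually.of_forall fun y => abs_mul_log_max_one_le (hfg t ht) x y)
    (hg.integrable_mul x) (Eventually.of_forall fun y => ?_))
  exact ((hf.continuousOn_time y).mono fun t ht => ht.1).mul continuousOn_const

/-- The splitting is `log |z| = log (max 1 |z|) + log (min 1 |z|)`. The second term lives on `[-1,
1]`, where local smoothness of `w` suffices. -/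
theorem IsLogMajorant.lineVelocity_eq (hg : IsLogMajorant g) (hw : Continuous w)
    (hwg : ∀ y, |w y| ≤ g y) (x : ℝ) :
    lineVelocity w x = farVelocity w x + evenConv 1 lineKernel w x := by
  have h := integral_eq_evenConv (F := fun z => w (x - z) * Real.log (min 1 |z|)) (x := x)
    one_pos hw (fun z hz => ?_) (fun z hz => ?_)
  · have h1 : Integrable fun y => w y * Real.log (min 1 |x - y|) := by
      simpa using h.1.comp_sub_left x
    have h2 : ∫ z, w (x - z) * Real.log (min 1 |z|) = ∫ y, w y * Real.log (min 1 |x - y|) := by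
      rw [← integral_sub_left_eq_self (fun y => w y * Real.log (min 1 |x - y|)) volume x]
      simp
    rw [← h.2, h2]
    unfold lineVelocity farVelocity
    rw [← mul_add, ← integral_add (hg.integrable_far hw hwg x) h1]
    congr 2
    ext y
    rw [← mul_add]
    congr 1
    rcases le_total 1 |x - y| with h | h
    · rw [max_eq_right h, min_eq_left h, Real.log_one, add_zero]
    · rw [max_eq_left h, min_eq_right h, Real.log_one, zero_add]
  · rw [min_eq_right (abs_le.2 ⟨hz.1.le, hz.2⟩), Real.log_abs]
  · have : 1 ≤ |z| := by
      by_contra! h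
      exact hz ⟨(abs_lt.1 h).1, (abs_lt.1 h).2.le⟩
    rw [min_eq_left this, Real.log_one, mul_zero]

theorem HasLogDecay.exists_majorant {ω : ℝ → ℝ → ℝ} (h : HasLogDecay ω) (T : ℝ) :
    ∃ g S, IsLogMajorant g ∧ ∀ t ∈ Icc 0 T, ∀ x, |ω t x| ≤ g x ∧ |ω t x| ≤ S := by
  -- The decay hypothesis needs a positive time, hence `max T 1`.
  obtain ⟨g, ⟨S, hS⟩, hi, hg⟩ := h (max T 1) (lt_max_of_lt_right one_pos)
  refine ⟨g, S, ⟨?_, hi⟩, fun t ht x => ?_⟩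
  · have hl : ∀ y : ℝ, Real.log 2 ≤ Real.log (2 + |y|) := fun y =>
      Real.log_le_log two_pos (by linarith [abs_nonneg y])
    have h2 : 0 < Real.log 2 := Real.log_pos one_lt_two
    have hc : Continuous fun y : ℝ => (Real.log (2 + |y|))⁻¹ :=
      Continuous.inv₀ (Continuous.log (by fun_prop) fun y => by positivity)
        fun y => (h2.trans_le (hl y)).ne'
    refine (hi.mul_bdd (c := (Real.log 2)⁻¹) hc.aestronglyMeasurable
      (Eventually.of_forall fun y => ?_)).congr (Eventually.of_forall fun y => ?_)
    · rw [norm_inv, Real.norm_eq_abs, abs_of_pos (h2.trans_le (hl y))]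
      exact inv_anti₀ h2 (hl y)
    · exact mul_inv_cancel_right₀ (h2.trans_le (hl y)).ne' _
  · have := hg t ⟨ht.1, ht.2.trans (le_max_left _ _)⟩ x
    exact ⟨this, this.trans (hS ⟨x, rfl⟩)⟩

end

/-! ### The line: support, symmetry and signs -/

/-- The vorticity and the temperature gradient stay zero on a region that is invariant under
backward trajectories, if initially the vorticity vanishes and the temperature is constant there. -/
theorem IsSmoothGlobalSolution.eq_zero_of_invariant {V : (ℝ → ℝ) → ℝ → ℝ} {ω₀ θ₀ : ℝ → ℝ}
    {ω θ : ℝ → ℝ → ℝ} (h : IsSmoothGlobalSolution V ω₀ θ₀ ω θ) {U : ℝ → Set ℝ} {t c : ℝ}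
    (ht : 0 ≤ t) (hU : ∀ s, IsOpen (U s))
    (hX : ∀ s ∈ Icc 0 t, ∀ x ∈ U s, ∃ X, IsTrajectory (fun r => V (ω r)) s x X ∧
      ∀ r ∈ Icc 0 s, X r ∈ U r)
    (hω₀ : ∀ x ∈ U 0, ω₀ x = 0) (hθ₀ : ∀ x ∈ U 0, θ₀ x = c) :
    ∀ x ∈ U t, ω t x = 0 ∧ deriv (θ t) x = 0 := by
  have hω : SmoothST ω := h.smooth_vorticity
  have hθ : SmoothST θ := h.smooth_temperature
  -- It is `θ` that is transported, not `θ_x`, so no derivative of the velocity is needed. Openness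
  -- of `U s` then gives `θ_x = 0`, after which `ω` is constant along trajectories too.
  have h1 : ∀ s ∈ Icc 0 t, ∀ x ∈ U s, θ s x = c := by
    intro s hs x hx
    obtain ⟨X, hXt, hXU⟩ := hX s hs x hx
    have := eq_of_hasDerivWithinAt_zero (f := fun r => θ r (X r)) hs.1 fun r hr =>
      (hθ.hasDerivWithinAt_curve hr (hXt.2 r hr) (h.temperature_eq r hr.1 (X r))).congr_deriv
        (by ring)
    rw [hXt.1, h.initial_temperature] at this
    rw [this, hθ₀ _ (hXU 0 ⟨le_rfl, hs.1⟩)]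
  have h2 : ∀ s ∈ Icc 0 t, ∀ x ∈ U s, deriv (θ s) x = 0 := by
    intro s hs x hx
    have : θ s =ᶠ[𝓝 x] fun _ => c := by
      filter_upwards [(hU s).mem_nhds hx] with y hy
      exact h1 s hs y hy
    rw [this.deriv_eq, deriv_const]
  intro x hx
  refine ⟨?_, h2 t ⟨ht, le_rfl⟩ x hx⟩
  obtain ⟨X, hXt, hXU⟩ := hX t ⟨ht, le_rfl⟩ x hx
  have := eq_of_hasDerivWithinAt_zero (f := fun r => ω r (X r)) ht fun r hr =>
    (hω.hasDerivWithinAt_curve hr (hXt.2 r hr) (h.vorticity_eq r hr.1 (X r))).congr_deriv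
      (by rw [h2 r hr _ (hXU r hr)]; ring)
  rw [hXt.1, h.initial_vorticity] at this
  rw [this, hω₀ _ (hXU 0 ⟨le_rfl, ht⟩)]

theorem deriv_eq_zero_of_eqOn_zero {f : ℝ → ℝ} {s : Set ℝ} (hs : IsOpen s) (hf : ∀ x ∈ s, f x = 0) :
    ∀ x ∈ s, deriv f x = 0 := fun x hx => by
  have : f =ᶠ[𝓝 x] fun _ => 0 := by
    filter_upwards [hs.mem_nhds hx] with y hy
    exact hf y hy
  rw [this.deriv_eq, deriv_const]

theorem SmoothST.bounded_of_eq_zero {f : ℝ → ℝ → ℝ} (hf : SmoothST f) {T R : ℝ}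
    (h0 : ∀ t ∈ Icc 0 T, ∀ x, R < |x| → f t x = 0) :
    ∃ M, 0 ≤ M ∧ ∀ t ∈ Icc 0 T, ∀ x, |f t x| ≤ M := by
  obtain ⟨M, hM, h⟩ := hf.bounded T R
  refine ⟨M, hM, fun t ht x => ?_⟩
  rcases le_or_gt |x| R with hx | hx
  · exact h t ht x (abs_le.1 hx)
  · rwa [h0 t ht x hx, abs_zero]

namespace IsLineSolution

variable {θ₀ : ℝ → ℝ} {ω θ : ℝ → ℝ → ℝ}

theorem velocity_growth {ω₀ : ℝ → ℝ} (h : IsLineSolution ω₀ θ₀ ω θ) (T : ℝ) :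
    ∃ C, 0 < C ∧ ∀ s ∈ Icc 0 T, ∀ y, |lineVelocity (ω s) y| ≤ C * (1 + Real.log (2 + |y|)) := by
  have hω : SmoothST ω := h.smooth_vorticity
  have hpi := Real.pi_pos
  have hk := logKernel_line one_pos
  obtain ⟨g, S, hg, hb⟩ := h.decay.exists_majorant T
  set I := |∫ y, g y|
  set J := |∫ y, g y * Real.log (2 + |y|)|
  set D := 8 * (1 + |Real.log 1|) * 1 * |S|
  refine ⟨1 / Real.pi * (I + J) + D + 1, by positivity, fun s hs y => ?_⟩
  have h1 := hg.abs_farVelocity_le (fun y => (hb s hs y).1) y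
  have h2 := hk.abs_evenConv_le (x := y) fun y => (hb s hs y).2.trans (le_abs_self S)
  have hl := Real.log_nonneg (show 1 ≤ 2 + |y| by linarith [abs_nonneg y])
  rw [hg.lineVelocity_eq (hω.continuous_slice hs.1) fun y => (hb s hs y).1]
  refine (abs_add_le _ _).trans ((add_le_add h1 h2).trans ?_)
  have h3 : (∫ y, g y) * Real.log (2 + |y|) + ∫ y, g y * Real.log (2 + |y|) ≤
      (I + J) * (1 + Real.log (2 + |y|)) := by
    have e1 : (∫ y, g y) * Real.log (2 + |y|) ≤ I * Real.log (2 + |y|) :=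
      mul_le_mul_of_nonneg_right (le_abs_self _) hl
    have e2 : ∫ y, g y * Real.log (2 + |y|) ≤ J := le_abs_self _
    have e3 : 0 ≤ J * Real.log (2 + |y|) := by positivity
    have e4 : 0 ≤ I := abs_nonneg _
    linarith
  have h4 : D ≤ (D + 1) * (1 + Real.log (2 + |y|)) := by
    have : 0 ≤ D := by positivity
    nlinarith
  calc _ ≤ 1 / Real.pi * ((I + J) * (1 + Real.log (2 + |y|))) +
        (D + 1) * (1 + Real.log (2 + |y|)) :=
        add_le_add (mul_le_mul_of_nonneg_left h3 (by positivity)) h4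
    _ = _ := by ring

theorem lipschitz {ω₀ : ℝ → ℝ} (h : IsLineSolution ω₀ θ₀ ω θ) (T R : ℝ) :
    ∃ K : ℝ, ∀ s ∈ Icc 0 T, ∀ y ∈ Icc (-R) R, ∀ z ∈ Icc (-R) R,
      |lineVelocity (ω s) y - lineVelocity (ω s) z| ≤ K * |y - z| := by
  have hω : SmoothST ω := h.smooth_vorticity
  have hk := logKernel_line one_pos
  obtain ⟨g, S, hg, hb⟩ := h.decay.exists_majorant T
  obtain ⟨M, -, hM⟩ := hω.deriv.bounded T (R + 1)
  refine ⟨1 / Real.pi * (∫ y, g y) + 8 * (1 + |Real.log 1|) * 1 * M, fun s hs y hy z hz => ?_⟩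
  have hc := hω.continuous_slice hs.1
  have h1 := hg.abs_farVelocity_sub_le hc (fun y => (hb s hs y).1) y z
  have h2 := abs_sub_le_of_hasDerivAt (convex_Icc (-R) R)
    (fun x _ => hk.hasDerivAt_evenConv (hω.hasDerivAt hs.1) (hω.deriv.continuous_slice hs.1) x)
    (fun x hx => hk.abs_evenConv_le_of_local fun y hy =>
      hM s hs y ⟨by linarith [hx.1, hy.1], by linarith [hx.2, hy.2]⟩) y hy z hz
  rw [hg.lineVelocity_eq hc fun y => (hb s hs y).1, hg.lineVelocity_eq hc fun y => (hb s hs y).1,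
    add_sub_add_comm, add_mul]
  exact (abs_add_le _ _).trans (add_le_add h1 h2)

theorem exists_trajectory {ω₀ : ℝ → ℝ} (h : IsLineSolution ω₀ θ₀ ω θ) {t : ℝ} (ht : 0 ≤ t) (x : ℝ) :
    ∃ X, IsTrajectory (fun s => lineVelocity (ω s)) t x X := by
  have hω : SmoothST ω := h.smooth_vorticity
  obtain ⟨g, S, hg, hb⟩ := h.decay.exists_majorant t
  obtain ⟨C, -, hC⟩ := h.velocity_growth t
  refine HLModel.exists_trajectory ht x (fun y => ?_) (h.lipschitz t) ⟨C, hC⟩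
  exact ((hg.continuousOn_farVelocity_time hω (fun s hs y => (hb s hs y).1) y).add
    (((logKernel_line one_pos).continuousOn_evenConv_time hω y).mono fun s hs => hs.1)).congr
    fun s hs => hg.lineVelocity_eq (hω.continuous_slice hs.1) (fun y => (hb s hs y).1) y

/-- The support of the vorticity and of the temperature gradient stays bounded. -/
theorem exists_support_bound (h : IsLineSolution (fun _ => 0) θ₀ ω θ)
    (hθ₀ : ∀ x, 1 < |x| → θ₀ x = 1) (T : ℝ) :
    ∃ R, 0 < R ∧ ∀ t ∈ Icc 0 T, ∀ x, R < |x| → ω t x = 0 ∧ deriv (ω t) x = 0 ∧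
      deriv (θ t) x = 0 ∧ deriv (deriv (θ t)) x = 0 := by
  obtain ⟨D, hD, hu⟩ := h.velocity_growth T
  -- The factor `2` comes from `1 + log (2 + |y|) ≤ 2 (1 + |y|)`. By Gronwall, a backward trajectory
  -- starting in `U s` remains in the sets `U r`, and `U 0` is the region `|x| > 1` where the data
  -- are trivial.
  obtain ⟨C, hC, hCD⟩ : ∃ C, 0 < C ∧ C = 2 * D := ⟨2 * D, by positivity, rfl⟩
  set U : ℝ → Set ℝ := fun s => {x | 2 * Real.exp (C * s) < 1 + |x|} with hU
  have hUo : ∀ s, IsOpen (U s) := fun s => isOpen_lt (by fun_prop) (by fun_prop)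
  have hU0 : ∀ x ∈ U 0, 1 < |x| := fun x hx => by
    have : 2 * Real.exp (C * 0) < 1 + |x| := hx
    rw [mul_zero, Real.exp_zero] at this
    linarith
  have key : ∀ t ∈ Icc 0 T, ∀ x ∈ U t, ω t x = 0 ∧ deriv (θ t) x = 0 := by
    intro t ht
    refine h.eq_zero_of_invariant (c := 1) ht.1 hUo (fun s hs x hx => ?_) (fun _ _ => rfl)
      fun x hx => hθ₀ x (hU0 x hx)
    obtain ⟨X, hX⟩ := h.exists_trajectory hs.1 x
    refine ⟨X, hX, fun r hr => ?_⟩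
    have h1 := one_add_abs_le_exp_of_linear_growth hC hX.2 (fun q hq => ?_) hr
    · rw [hX.1] at h1
      have h2 : 2 * Real.exp (C * s) < 1 + |x| := hx
      have h3 : Real.exp (C * s) = Real.exp (C * r) * Real.exp (C * (s - r)) := by
        rw [← Real.exp_add]
        congr 1
        ring
      rw [h3, ← mul_assoc] at h2
      exact lt_of_mul_lt_mul_right (h2.trans_le h1) (Real.exp_pos _).le
    · refine (hu q ⟨hq.1, hq.2.trans (hs.2.trans ht.2)⟩ (X q)).trans ?_
      rw [hCD, mul_comm 2 D, mul_assoc]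
      refine mul_le_mul_of_nonneg_left ?_ hD.le
      linarith [Real.log_le_sub_one_of_pos (show 0 < 2 + |X q| by positivity), abs_nonneg (X q)]
  refine ⟨2 * Real.exp (C * T), by positivity, fun t ht x hx => ?_⟩
  have hx' : x ∈ U t := by
    have : Real.exp (C * t) ≤ Real.exp (C * T) :=
      Real.exp_le_exp.2 (mul_le_mul_of_nonneg_left ht.2 hC.le)
    change 2 * Real.exp (C * t) < 1 + |x|
    linarith
  exact ⟨(key t ht x hx').1,
    deriv_eq_zero_of_eqOn_zero (hUo t) (fun y hy => (key t ht y hy).1) x hx', (key t ht x hx').2,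
    deriv_eq_zero_of_eqOn_zero (hUo t) (fun y hy => (key t ht y hy).2) x hx'⟩

/-- Decay is assumed for `ω` only, not for `ω_x`. The support bound fills the gap: near `x` the
velocity is a truncated convolution, which can be differentiated. -/
theorem isFlowSolution (h : IsLineSolution (fun _ => 0) θ₀ ω θ)
    (hθ₀ : ∀ x, 1 < |x| → θ₀ x = 1) :
    IsFlowSolution ω θ (fun t => lineVelocity (ω t)) (fun t => lineVelocity (deriv (ω t))) := by
  have hω : SmoothST ω := h.smooth_vorticity
  refine ⟨hω, h.smooth_temperature, h.vorticity_eq, h.temperature_eq, fun t ht x => ?_,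
    fun t ht x => h.exists_trajectory ht x, h.lipschitz⟩
  obtain ⟨R, hR0, hR⟩ := h.exists_support_bound hθ₀ t
  have ha : 0 < |x| + R + 1 := by positivity
  have hev : ∀ᶠ y in 𝓝 x, |y| + R < |x| + R + 1 :=
    (isOpen_lt (by fun_prop) (by fun_prop)).mem_nhds (show |x| + R < |x| + R + 1 by linarith)
  rw [lineVelocity_eq_evenConv (hω.deriv.continuous_slice ht)
    (fun y hy => (hR t ⟨ht, le_rfl⟩ y hy).2.1) ha (show |x| + R < |x| + R + 1 by linarith)]
  refine ((logKernel_line ha).hasDerivAt_evenConv (hω.hasDerivAt ht)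
    (hω.deriv.continuous_slice ht) x).congr_of_eventuallyEq ?_
  filter_upwards [hev] with y hy
  exact lineVelocity_eq_evenConv (hω.continuous_slice ht)
    (fun y hy => (hR t ⟨ht, le_rfl⟩ y hy).1) ha hy

theorem odd_even (h : IsLineSolution (fun _ => 0) θ₀ ω θ) (hθ₀ : ∀ x, 1 < |x| → θ₀ x = 1)
    (he : ∀ x, θ₀ (-x) = θ₀ x) {t : ℝ} (ht : 0 ≤ t) (x : ℝ) :
    ω t (-x) = -ω t x ∧ deriv (θ t) (-x) = -deriv (θ t) x := by
  have hω : SmoothST ω := h.smooth_vorticity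
  have hθ : SmoothST θ := h.smooth_temperature
  obtain ⟨R, hR0, hR⟩ := h.exists_support_bound hθ₀ t
  have ha : 0 < 2 * R + 1 := by positivity
  obtain ⟨M₁, p1, h1⟩ := hω.bounded_of_eq_zero fun t ht x hx => (hR t ht x hx).1
  obtain ⟨M₂, p2, h2⟩ := hω.deriv.bounded_of_eq_zero fun t ht x hx => (hR t ht x hx).2.1
  obtain ⟨M₃, p3, h3⟩ := hθ.deriv.bounded_of_eq_zero fun t ht x hx => (hR t ht x hx).2.2.1
  obtain ⟨M₄, p4, h4⟩ := hθ.deriv.deriv.bounded_of_eq_zero fun t ht x hx => (hR t ht x hx).2.2.2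
  have hB : ∀ x ∈ Icc (-R) R, |x| + R < 2 * R + 1 := fun x hx => by
    linarith [abs_le.2 hx]
  have hl : HasLocalKernel t (M₁ + M₂ + M₃ + M₄) (2 * R + 1) lineKernel (Icc (-R) R) ω θ
      (fun t => lineVelocity (ω t)) (fun t => lineVelocity (deriv (ω t))) := by
    refine ⟨fun s hs x hx => lineVelocity_eq_evenConv (hω.continuous_slice hs.1)
        (fun y hy => (hR s hs y hy).1) ha (hB x hx),
      fun s hs x hx => lineVelocity_eq_evenConv (hω.deriv.continuous_slice hs.1)
        (fun y hy => (hR s hs y hy).2.1) ha (hB x hx),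
      fun s hs x hx => hR s hs x (by_contra fun h => hx (abs_le.1 (not_lt.1 h))),
      fun s hs x => ⟨?_, ?_, ?_, ?_⟩⟩
    · linarith [h1 s hs x]
    · linarith [h2 s hs x]
    · linarith [h3 s hs x]
    · linarith [h4 s hs x]
  exact (h.isFlowSolution hθ₀).odd_even (logKernel_line ha) hl
    (fun x hx => ⟨by linarith [hx.2], by linarith [hx.1]⟩)
    (fun x => by rw [h.initial_vorticity, neg_zero])
    (fun x => by rw [h.initial_temperature, he]) t ⟨ht, le_rfl⟩ x

theorem nonneg (h : IsLineSolution (fun _ => 0) θ₀ ω θ) (hθ₀ : ∀ x, 1 < |x| → θ₀ x = 1)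
    (he : ∀ x, θ₀ (-x) = θ₀ x) (hm : ∀ x, 0 ≤ x → 0 ≤ deriv θ₀ x) {t : ℝ} (ht : 0 ≤ t) :
    ∀ x ∈ Ici 0, 0 ≤ deriv (θ t) x ∧ 0 ≤ ω t x := by
  have F := h.isFlowSolution hθ₀
  refine F.nonneg_of_invariant ht (fun x hx X hX s hs => ?_)
    (fun x hx => by rw [h.initial_temperature]; exact hm x hx)
    (fun x _ => by rw [h.initial_vorticity])
  refine F.fixed_le_trajectory ht hX (fun r hr => eq_zero_of_odd ?_) hx s hs
  rw [← lineVelocity_reflect (fun y => (h.odd_even hθ₀ he hr.1 y).1), neg_zero]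

/-- For `x ≥ 0` and `y > 0` one has `|x - y| ≤ x + y`, so the folded kernel is nonpositive while `ω
≥ 0`. -/
theorem velocity_nonpos (h : IsLineSolution (fun _ => 0) θ₀ ω θ) (hθ₀ : ∀ x, 1 < |x| → θ₀ x = 1)
    (he : ∀ x, θ₀ (-x) = θ₀ x) (hm : ∀ x, 0 ≤ x → 0 ≤ deriv θ₀ x) {t : ℝ} (ht : 0 ≤ t) {x : ℝ}
    (hx : 0 ≤ x) : lineVelocity (ω t) x ≤ 0 := by
  have hω : SmoothST ω := h.smooth_vorticity
  obtain ⟨R, hR0, hR⟩ := h.exists_support_bound hθ₀ t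
  rw [lineVelocity_of_odd (hω.continuous_slice ht) hR0.le (fun y hy => (hR t ⟨ht, le_rfl⟩ y hy).1)
    (fun y => (h.odd_even hθ₀ he ht y).1), intervalIntegral.integral_of_le hR0.le]
  refine mul_nonpos_of_nonneg_of_nonpos (by positivity) (integral_nonpos_of_ae ?_)
  have hne : ∀ᵐ y ∂(volume.restrict (Ioc 0 R)), y ≠ x := Measure.ae_ne _ x
  filter_upwards [hne, ae_restrict_mem measurableSet_Ioc] with y hy hyR
  refine mul_nonpos_of_nonneg_of_nonpos (h.nonneg hθ₀ he hm ht y hyR.1.le).2 (sub_nonpos.2 ?_)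
  rw [← Real.log_abs]
  have hy0 := hyR.1
  exact Real.log_le_log (abs_pos.2 (sub_ne_zero.2 hy.symm)) (abs_le.2 ⟨by linarith, by linarith⟩)

/-- The flow on `x ≥ 0` points to the origin, so backward trajectories from `x > 1` stay in `(1,
∞)`, where the data are trivial. This replaces the growing support bound by the fixed interval of
the weight. -/
theorem vorticity_eq_zero (h : IsLineSolution (fun _ => 0) θ₀ ω θ)
    (hθ₀ : ∀ x, 1 < |x| → θ₀ x = 1) (he : ∀ x, θ₀ (-x) = θ₀ x)
    (hm : ∀ x, 0 ≤ x → 0 ≤ deriv θ₀ x) {t : ℝ} (ht : 0 ≤ t) : ∀ x, 1 < |x| → ω t x = 0 := by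
  have F := h.isFlowSolution hθ₀
  have h1 : ∀ x ∈ Ioi (1 : ℝ), ω t x = 0 ∧ deriv (θ t) x = 0 := by
    refine h.eq_zero_of_invariant (U := fun _ => Ioi 1) (c := 1) ht (fun _ => isOpen_Ioi)
      (fun s hs x hx => ?_) (fun _ _ => rfl) fun x hx => hθ₀ x (lt_of_lt_of_le hx (le_abs_self x))
    obtain ⟨X, hX⟩ := h.exists_trajectory hs.1 x
    have hX0 : ∀ r ∈ Icc 0 s, 0 ≤ X r := by
      refine F.fixed_le_trajectory hs.1 hX (fun r hr => eq_zero_of_odd ?_)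
        (zero_le_one.trans (le_of_lt hx))
      rw [← lineVelocity_reflect (fun y => (h.odd_even hθ₀ he hr.1 y).1), neg_zero]
    refine ⟨X, hX, fun r hr => ?_⟩
    have := (le_of_hasDerivWithinAt_nonneg (f := fun r => -X r) hs.1
      (fun r hr => (hX.2 r hr).neg)
      (fun r hr => neg_nonneg.2 (h.velocity_nonpos hθ₀ he hm hr.1 (hX0 r hr))) hr).2
    rw [hX.1] at this
    exact lt_of_lt_of_le hx (neg_le_neg_iff.1 this)
  intro x hx
  rcases lt_abs.1 hx with hx | hx
  · exact (h1 x hx).1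
  · have := (h.odd_even hθ₀ he ht (-x)).1
    rwa [(h1 (-x) hx).1, neg_neg, neg_zero] at this

end IsLineSolution

/-! ### The line: weight `1 / x` and nonexistence -/

/-- The weight `1 / x` on the unit interval. -/
theorem isBlowupWeight_line : IsBlowupWeight 1 1 1 (fun x => x⁻¹) (fun x => (x ^ 2)⁻¹) := by
  refine ⟨one_pos, one_pos, zero_le_one, fun x hx => inv_pos.2 hx.1, by norm_num,
    continuousOn_inv₀.mono fun x hx => hx.1.ne', fun x hx => hasDerivAt_inv hx.1.ne',
    ContinuousOn.inv₀ (by fun_prop) fun x hx => (pow_pos hx.1 2).ne', fun x hx => ?_,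
    fun x hx => ?_, fun x hx => ?_, fun x hx y hy hxy => ?_⟩
  · rw [one_mul, inv_pow]
  · rw [one_div]
  · rw [one_div]
  · rw [inv_pow, inv_pow, mul_comm]

theorem logKer_inv {x y : ℝ} (hx : 0 < x) (hy : 0 < y) (hxy : x ≠ y) :
    logKer 0 x⁻¹ y⁻¹ = Real.log (x + y) - Real.log (x - y) := by
  have hs := sub_ne_zero.2 hxy
  rw [logKer_zero (inv_pos.2 hx) (inv_pos.2 hy) fun h => hxy (inv_injective h), Real.log_abs,
    Real.log_abs, show x⁻¹ + y⁻¹ = (x + y) / (x * y) by field_simp; ring,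
    show x⁻¹ - y⁻¹ = -((x - y) / (x * y)) by field_simp; ring, Real.log_neg_eq_log,
    Real.log_div (by positivity) (by positivity), Real.log_div hs (by positivity)]
  ring

theorem not_exists_lineSolution {θ₀ : ℝ → ℝ} (hθ₀ : ∀ x, 1 < |x| → θ₀ x = 1)
    (he : ∀ x, θ₀ (-x) = θ₀ x) (hm : ∀ x, 0 ≤ x → 0 ≤ deriv θ₀ x) (h0 : θ₀ 0 = 0)
    (hpos : ∀ x ∈ Ioo 0 1, 0 < θ₀ x) :
    ¬ ∃ ω θ : ℝ → ℝ → ℝ, IsLineSolution (fun _ => 0) θ₀ ω θ := by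
  rintro ⟨ω, θ, h⟩
  have W := isBlowupWeight_line
  have F := h.isFlowSolution hθ₀
  have hω : SmoothST ω := h.smooth_vorticity
  have hθ : SmoothST θ := h.smooth_temperature
  have hsymm := fun (t : ℝ) (ht : 0 ≤ t) (x : ℝ) => h.odd_even hθ₀ he ht x
  have hsupp := fun (t : ℝ) (ht : 0 ≤ t) => h.vorticity_eq_zero hθ₀ he hm ht
  have hzero : ∀ f : ℝ → ℝ, (∀ x, f (-x) = -f x) → f 0 = 0 := fun f ho =>
    eq_zero_of_odd (by simpa using ho 0)
  have hz : ∀ t, 0 ≤ t → θ t 0 = 0 ∧ deriv (θ t) 0 = 0 ∧ ω t 0 = 0 ∧ ω t 1 = 0 := by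
    intro t ht
    refine ⟨?_, hzero _ fun x => (hsymm t ht x).2, hzero _ fun x => (hsymm t ht x).1,
      eq_zero_of_forall_gt (hω.continuous_slice ht)
        fun y hy => hsupp t ht y (hy.trans_le (le_abs_self y))⟩
    rw [F.temperature_at_zero ht fun s hs => hzero _ fun x => (hsymm s hs.1 x).2,
      h.initial_temperature, h0]
  set I₀ := ∫ x in Ioo 0 1, θ 0 x * x⁻¹ with hI₀
  set T := 4 * (1 + 1 / (2 / Real.pi * (1 / (2 * 1)) / 2 * I₀)) with hT
  obtain ⟨M, hM⟩ := exists_isBlowupProfile (T := max T 0) one_pos hω hθ (fun t ht => hz t ht.1)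
    (fun t ht x hx => h.nonneg hθ₀ he hm ht.1 x hx.1)
  obtain ⟨Mω, -, hMω⟩ := hω.bounded_of_eq_zero (T := max T 0) (R := 1)
    fun t ht x hx => hsupp t ht.1 x hx
  refine false_of_blowupProfile W (u := fun t => lineVelocity (ω t)) hM
    (M' := Real.pi * (8 * (1 + |Real.log 3|) * 3 * Mω)) (fun t ht => ?_)
    (fun t ht => h.vorticity_eq t ht.1) (fun t ht => h.temperature_eq t ht.1) ?_ (le_max_left T 0)
  · refine isLogPotential_of_kernel (l := Real.log) one_pos
      (hω.continuous_slice ht.1) (fun x => ?_) (fun x => ?_)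
      (fun x hx y hy hxy => logKer_inv hx.1 hy.1 hxy)
      (fun x _ => (F.hasDerivAt_velocity t ht.1 x).continuousAt.continuousWithinAt)
      (fun x hx => ?_) (fun x _ => lineVelocity_of_odd (hω.continuous_slice ht.1) zero_le_one
        (hsupp t ht.1) (fun y => (hsymm t ht.1 y).1) x)
    · have := (intervalIntegral.intervalIntegrable_log' (a := x) (b := x - 1)).comp_sub_left x
      simpa using this
    · have := (intervalIntegral.intervalIntegrable_log' (a := x) (b := x + 1)).comp_add_left x
      simpa using this
    · rw [lineVelocity_eq_evenConv (a := 3) (hω.continuous_slice ht.1) (hsupp t ht.1) (by norm_num)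
        (by rw [abs_of_pos hx.1]; linarith [hx.2])]
      exact (logKernel_line (by norm_num)).abs_evenConv_le (hMω t ht)
  · refine W.integral_pos ((hM 0 ⟨le_rfl, le_max_right _ _⟩).integrableOn_temperature_weight W)
      fun x hx => ?_
    rw [h.initial_temperature]
    exact hpos x hx

/-- The function `smoothTransition (x ^ 2)` is even, zero at the origin, positive elsewhere,
nondecreasing on `x ≥ 0` and equal to `1` for `|x| ≥ 1`. -/
theorem not_exists_lineSolution_smoothTransition :
    ¬ ∃ ω θ : ℝ → ℝ → ℝ, IsLineSolution (fun _ => 0) (fun x => Real.smoothTransition (x ^ 2)) ω θ := by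
  refine not_exists_lineSolution (fun x hx => Real.smoothTransition.one_of_one_le ?_)
    (fun x => by simp) (fun x hx => ?_) (by simp) fun x hx =>
      Real.smoothTransition.pos_of_pos (pow_pos hx.1 2)
  · rw [← sq_abs]
    nlinarith
  · have hd : DifferentiableAt ℝ Real.smoothTransition (x ^ 2) :=
      (Real.smoothTransition.contDiff (n := 1)).differentiable one_ne_zero _
    have := HasDerivAt.comp (h := fun x : ℝ => x ^ 2) x hd.hasDerivAt (hasDerivAt_pow 2 x)
    have h2 := this.deriv
    rw [show Real.smoothTransition ∘ (fun x => x ^ 2) = fun x => Real.smoothTransition (x ^ 2)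
      from rfl] at h2
    rw [h2]
    exact mul_nonneg Real.smoothTransition.monotone.deriv_nonneg (by positivity)

end HLModel

theorem mainTheorem1 :
    (∀ L : ℝ, 0 < L →
      ∃ ω₀ θ₀ : ℝ → ℝ,
        ContDiff ℝ (⊤ : ℕ∞) ω₀ ∧ ContDiff ℝ (⊤ : ℕ∞) θ₀ ∧
        Function.Periodic ω₀ L ∧ Function.Periodic θ₀ L ∧
        ¬ ∃ ω θ : ℝ → ℝ → ℝ, HLModel.IsCircleSolution L ω₀ θ₀ ω θ) ∧
    (∃ ω₀ θ₀ : ℝ → ℝ,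
      ContDiff ℝ (⊤ : ℕ∞) ω₀ ∧ ContDiff ℝ (⊤ : ℕ∞) θ₀ ∧
      HasCompactSupport ω₀ ∧ HasCompactSupport (deriv θ₀) ∧
      ¬ ∃ ω θ : ℝ → ℝ → ℝ, HLModel.IsLineSolution ω₀ θ₀ ω θ) := by
  refine ⟨fun L hL => ⟨fun _ => 0, fun x => 1 - Real.cos (2 * Real.pi / L * x), contDiff_const,
    contDiff_const.sub (Real.contDiff_cos.comp (contDiff_const.mul contDiff_id)), fun _ => rfl,
    fun x => ?_, HLModel.not_exists_circleSolution hL⟩,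
    fun _ => 0, fun x => Real.smoothTransition (x ^ 2), contDiff_const,
    Real.smoothTransition.contDiff.comp (contDiff_id.pow 2), HasCompactSupport.zero,
    HasCompactSupport.intro (isCompact_Icc (a := -1) (b := 1)) fun x hx => ?_,
    HLModel.not_exists_lineSolution_smoothTransition⟩
  · dsimp only
    rw [mul_add, div_mul_cancel₀ _ hL.ne', Real.cos_add_two_pi]
  · have hx' : 1 < |x| := by
      by_contra h
      exact hx (abs_le.1 (not_lt.1 h))
    have : (fun x : ℝ => Real.smoothTransition (x ^ 2)) =ᶠ[𝓝 x] fun _ => 1 := by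
      filter_upwards [(isOpen_lt continuous_const continuous_abs).mem_nhds hx'] with y hy
      refine Real.smoothTransition.one_of_one_le ?_
      rw [← sq_abs]
      have : 1 < |y| := hy
      nlinarith
    rw [this.deriv_eq, deriv_const]
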